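/- **Setting.** Let $N,k\ge 1$. On $N$ qubits, labelled by $\Lambda=\{1,\dots,N\}$, let $H=\sum_{X\subset\Lambda,\,|X|\le k}h_X$ be a $k$-local Hamiltonian, where each $h_X\ge 0$ is positive semidefinite and acts nontrivially only on $X$. Its extensiveness is at most $g$ if $\sum_{X\ni i}\|h_X\|\le g$ for every $i\in\Lambda$ (operator norm). Let $H=\sum_{\gamma=1}^{\Gamma}H_\gamma$, $H_\gamma=\sum_X h_X^\gamma$, be a splitting with $h_X^\gamma\ge0$ acting on $X$, $h_X=\sum_\gamma h_X^\gamma$, and $[h_X^\gamma,h_{Y}^\gamma]=0$ for all $\gamma,X,Y$. Let $$T_p(t)=\prod_{v=1}^{c_p\Gamma}e^{-iH_{\gamma_v}\alpha_v t},\qquad |\alpha_v|\le1,$$ be a product formula of order $p\ge1$, i.e. $T_p(t)=e^{-iHt}+O(t^{p+1})$ as $t\to0$. Let $\Pi_{\le\Delta}$ be the spectral projection of $H$ on the energies $\le\Delta$, where $\Delta\ge0$, and put $\varepsilon_{p,\Delta}(t)=\|(e^{-iHt}-T_p(t))\Pi_{\le\Delta}\|$. Let $\epsilon\in(0,1)$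 and $t\in\mathbb R$. **Theorem.** 1. *(Boundedly many groups.)* For all $k,p,c_p,\Gamma_0$ there is $a>0$, and for every $b>0$ there is $C>0$, such that for all $N\ge2$, all $\Gamma\le\Gamma_0$ and all data as above with extensiveness at most $g$: with $\Delta'=\Delta+a\,g\log(N/\epsilon)$, if $g|t|\le b$, then $$\varepsilon_{p,\Delta}(t)\le C\,(g|t|)^p\,\Delta'\,|t|+\epsilon .$$ 2. *(Any number of groups.)* For all $k,p,c_p$ there is $a>0$, and for every $b>0$ there is $C>0$, such that for all $N\ge2$, all $\Gamma$ and all data as above with extensiveness at most $g$ in which every $H_\gamma$ is used at most $c_p$ times in the product $T_p$: with $\Delta'=\Delta+a\,g\log(N/\epsilon)$, if $g\log(N/\epsilon)\,|t|\le b$, then $$\varepsilon_{p,\Delta}(t)\le C\,\{g|t|\log(N/\epsilon)\}^p\,\Delta'\,|t|+\epsilon .$$ 3. *(Explicit constants, suited to boundedly many groups.)* Let $k\le N$, let the extensiveness be at most $g$, and let $\Delta'=\Delta+4kg\log\!\big(2^{-p+1}k^{-1}N/\epsilon\big)$. If $2c_p\Gamma kg|t|\le 1/e$, then $$\varepsilon_{p,\Delta}(t)\le\frac{2c_p\Gamma}{(1-e^{-1})(p+1)}\,(2c_p\Gamma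 kg|t|)^p\,\Delta'\,|t|+\epsilon .$$ 4. *(Explicit constants, any number of groups.)* Let $k\le N$, let every $H_\gamma$ be used at most $c_p$ times in $T_p$, and let $g$ satisfy $\sum_{\gamma}\sum_{X\ni i}\|h_X^\gamma\|\le g$ for every $i\in\Lambda$ (if every $h_X$ is put as a whole into one group, this means that the extensiveness is at most $g$). Let $p_0=\lceil\log(2k^{-1}N/\epsilon)+1\rceil$ and $\Delta'=\Delta+4kg\log(e^2N/\epsilon)$. If $2c_pp_0kg|t|\le\frac12$, then $$\varepsilon_{p,\Delta}(t)\le\frac{4c_p}{p+1}\,(2c_pp_0kg|t|)^p\,\Delta'\,|t|+\epsilon .$$ -/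

import Mathlib

open scoped Matrix.Norms.L2Operator ComplexOrder

noncomputable section

namespace LowEnergyTrotter

/-- Operators on `N` qubits, as matrices in the computational basis (indexed by bit strings).
The norm on them is the operator norm with respect to the Euclidean norm. -/
abbrev Op (N : ℕ) : Type := Matrix (Fin N → Fin 2) (Fin N → Fin 2) ℂ

/-- `A` acts nontrivially only on the sites in `X`: it is `M ⊗ 1`, where `M` acts on the qubits
in `X` and `1` is the identity on the other qubits. -/
def SupportedOn {N : ℕ} (X : Finset (Fin N)) (A : Op N) : Prop :=
  ∃ M : Matrix (X → Fin 2) (X → Fin 2) ℂ, ∀ s t : Fin N → Fin 2,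
    A s t = if ∀ i, i ∉ X → s i = t i then M (fun i => s i) (fun i => t i) else 0

/-- The local terms `h_X ≥ 0` of a `k`-local Hamiltonian on the lattice of `N` qubits. -/
structure LocalHamiltonian (N k : ℕ) where
  /-- the term `h_X` -/
  term : Finset (Fin N) → Op N
  posSemidef : ∀ X, (term X).PosSemidef
  supported : ∀ X, SupportedOn X (term X)
  isLocal : ∀ X, k < X.card → term X = 0

namespace LocalHamiltonian

variable {N k : ℕ}

/-- The Hamiltonian `H = ∑_X h_X`. -/
def H (h : LocalHamiltonian N k) : Op N := ∑ X, h.term X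

theorem isHermitian_H (h : LocalHamiltonian N k) : h.H.IsHermitian :=
  (Matrix.posSemidef_sum _ fun X _ => h.posSemidef X).isHermitian

/-- The extensiveness of the Hamiltonian is at most `g`: for every site `i`, the norms of the terms
`h_X` with `i ∈ X` add up to at most `g`. -/
def IsExtensive (h : LocalHamiltonian N k) (g : ℝ) : Prop :=
  ∀ i : Fin N, ∑ X with i ∈ X, ‖h.term X‖ ≤ g

end LocalHamiltonian

/-- A splitting `H = ∑_γ H_γ`, `H_γ = ∑_X h_X^γ`, of a local Hamiltonian into `Γ` groups: the
`h_X^γ ≥ 0` act on `X`, those of the same group commute, and `h_X = ∑_γ h_X^γ`. -/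
structure Splitting {N k : ℕ} (h : LocalHamiltonian N k) (Γ : ℕ) where
  /-- the piece `h_X^γ` -/
  piece : Fin Γ → Finset (Fin N) → Op N
  posSemidef : ∀ γ X, (piece γ X).PosSemidef
  supported : ∀ γ X, SupportedOn X (piece γ X)
  commute : ∀ γ X Y, Commute (piece γ X) (piece γ Y)
  sum_piece : ∀ X, ∑ γ, piece γ X = h.term X

namespace Splitting

variable {N k Γ : ℕ} {h : LocalHamiltonian N k}

/-- The group `H_γ = ∑_X h_X^γ`. -/
def group (S : Splitting h Γ) (γ : Fin Γ) : Op N := ∑ X, S.piece γ X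

/-- For every site `i`, the norms of all the pieces `h_X^γ` with `i ∈ X` add up to at most `g`.
When every `h_X` is put as a whole into one group, this says exactly that the extensiveness of the
Hamiltonian is at most `g`. -/
def IsExtensive (S : Splitting h Γ) (g : ℝ) : Prop :=
  ∀ i : Fin N, ∑ γ, ∑ X with i ∈ X, ‖S.piece γ X‖ ≤ g

end Splitting

/-- Time evolution `e^{-iAt}`. -/
def evol {N : ℕ} (A : Op N) (t : ℝ) : Op N := NormedSpace.exp ((-Complex.I * (t : ℂ)) • A)

/-- The data of a product of `c Γ` time evolutions: the labels `γ_v` and the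
coefficients `α_v ∈ [-1, 1]`. -/
structure ProductFormula (c Γ : ℕ) where
  /-- the label `γ_v` -/
  label : Fin (c * Γ) → Fin Γ
  /-- the coefficient `α_v` -/
  coeff : Fin (c * Γ) → ℝ
  abs_coeff_le : ∀ v, |coeff v| ≤ 1

namespace ProductFormula

variable {N k c Γ : ℕ} {h : LocalHamiltonian N k}

/-- The ordered product `T(t) = ∏_v e^{-i H_{γ_v} α_v t}`. -/
def eval (P : ProductFormula c Γ) (S : Splitting h Γ) (t : ℝ) : Op N :=
  (List.ofFn fun v => evol (S.group (P.label v)) (P.coeff v * t)).prod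

/-- `P` is a `p`-th order formula for the split Hamiltonian: `T(t) = e^{-iHt} + O(t^{p+1})`
as `t → 0`. -/
def HasOrder (P : ProductFormula c Γ) (S : Splitting h Γ) (p : ℕ) : Prop :=
  (fun t : ℝ => P.eval S t - evol h.H t) =O[nhds 0] fun t : ℝ => t ^ (p + 1)

/-- Each group is used at most `c` times in the product. -/
def Repeats (P : ProductFormula c Γ) : Prop :=
  ∀ γ, (Finset.univ.filter fun v => P.label v = γ).card ≤ c

end ProductFormula

open Classical in
/-- The projection `Π_{≤ Δ} = ∑_{n : E_n ≤ Δ} |E_n⟩⟨E_n|`. -/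
def lowEnergyProj {N : ℕ} (A : Op N) (hA : A.IsHermitian) (Δ : ℝ) : Op N :=
  ∑ n with hA.eigenvalues n ≤ Δ,
    Matrix.vecMulVec (hA.eigenvectorBasis n : (Fin N → Fin 2) → ℂ)
      (star (hA.eigenvectorBasis n : (Fin N → Fin 2) → ℂ))

/-- The Trotter error `‖(e^{-iHt} - T(t)) Π_{≤ Δ}‖` in the low-energy subspace. -/
def trotterError {N k c Γ : ℕ} {h : LocalHamiltonian N k} (S : Splitting h Γ)
    (P : ProductFormula c Γ) (Δ t : ℝ) : ℝ :=
  ‖(evol h.H t - P.eval S t) * lowEnergyProj h.H h.isHermitian_H Δ‖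

end LowEnergyTrotter

end

/-!
The error is expressed through the generator `K = T' T⁻¹` of the product formula. Since the exact
evolution `W` commutes with the spectral projection `Π` of the energies up to `Δ`, the error
satisfies `(W - T) Π = - T ∫ T⁻¹ (K + iH) Π W`. The Taylor coefficients of `K` are sums of nested
commutators of the groups `H_γ`, and those of `K + iH` vanish below the order `p` for a formula of
the order `p`. So it suffices to bound the coefficients `K_n Π` for `n ≥ p` (`norm_error_le`,
`trotterError_le_tsum`).

Let `Π'` be the spectral projection of the energies up to `Δ' ≥ Δ`, and split `K_n Π` into
`Π' K_n Π` and `(1 - Π') K_n Π`.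

* The low-energy block is bounded by matrix elements `⟨φ|K_n|ψ⟩`. A nested commutator of positive
  local terms is a sum of monomials that begin and end with a local term `h_X`, and
  `‖h_X ψ‖² ≤ ‖h_X‖ ⟨ψ|h_X|ψ⟩`. So the sum over the positions of the whole cluster, which would give
  a factor `N g`, can be replaced by the energy of a term at one of the ends: the block is of the
  size `Δ'` instead of `N g`. The bookkeeping of the end terms is done with weights on the sites
  (`exists_wordSum_matrixElement_le`, `sum_wordSum_matrixElement_le`).
* The rest is at most `e^{-λ(Δ' - Δ)} ‖e^{λH} K_n e^{-λH}‖`. As conjugation with `e^{λH}` is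
  harmless for local operators when `λ k g < 1` (`conjSeminorm_le`), the last factor is bounded
  by a sum over nested commutators, which is of the size `N g` (`sum_wordSum_op_le`). The choice
  `λ = 1 / (4 k g)` and a cutoff `Δ' - Δ` of the order `g log (N / ε)` make this contribution
  smaller than `ε` (`norm_mul_lowEnergyProj_le_of_growsBy`).

With all factors of the product treated alike, the factorial `n!` in the number of clusters of `n`
commutators is cancelled by the `1 / n!` in the Taylor coefficients, at the cost of a power of the
number of factors (`seminorm_genCoeff_le_of_words`, `trotterError_le_of_length`). If instead the
groups share a common extensiveness, the sum over all the words keeps the factorial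
(`seminorm_genCoeff_le_wordSum`), which is acceptable for `n < p₀`, where `n! ≤ p₀ ^ n`. For larger
`n`, the terms inside each group commute, so that commuting with a whole exponential only attaches
terms that meet the present support, each of them repeatedly, and the number of the sites grows by a
bounded factor. An induction over the factors with site weights then gives a geometric bound without
a factorial (`pow_mul_norm_genCoeff_le`, `trotterError_le_of_repeats`).

The asymptotic bounds follow from those with explicit constants: where the time is too large for the
latter, the right hand side exceeds the trivial bound `2`. For the bound with any number of groups,
positivity of the pieces implies `∑_γ ‖h_X^γ‖ ≤ 4^k ‖h_X‖` (`Splitting.sum_norm_piece_le`).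
-/

noncomputable section

namespace LowEnergyTrotter

open Finset NormedSpace

/-! ### Nested commutators and the generator of a product of exponentials -/

section BanachAlgebra

variable {𝔸 : Type*} [NormedRing 𝔸] [NormedAlgebra ℂ 𝔸]

/-- The commutator `N ↦ B N - N B`, as a continuous linear map. -/
def adL (B : 𝔸) : 𝔸 →L[ℂ] 𝔸 :=
  ContinuousLinearMap.mul ℂ 𝔸 B - (ContinuousLinearMap.mul ℂ 𝔸).flip B

@[simp] theorem adL_apply (B N : 𝔸) : adL B N = B * N - N * B := rfl

theorem adL_smul (z : ℂ) (B : 𝔸) : adL (z • B) = z • adL B := by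
  ext N; simp [smul_sub]

theorem mul_apply_eq {E : Type*} [NormedAddCommGroup E] [NormedSpace ℂ E] (A B : E →L[ℂ] E)
    (N : E) : (A * B) N = A (B N) := rfl

theorem smul_pow_apply {E : Type*} [NormedAddCommGroup E] [NormedSpace ℂ E] (z : ℂ)
    (A : E →L[ℂ] E) (n : ℕ) (N : E) : ((z • A) ^ n) N = z ^ n • (A ^ n) N := by
  induction n with
  | zero => simp
  | succ n ih =>
    rw [pow_succ', mul_apply_eq, ih, pow_succ' A, mul_apply_eq, map_smul, pow_succ, mul_smul]
    rfl

theorem hasSum_exp_apply {E : Type*} [NormedAddCommGroup E] [NormedSpace ℂ E] [CompleteSpace E]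
    (A : E →L[ℂ] E) (N : E) :
    HasSum (fun n : ℕ => ((n.factorial : ℂ)⁻¹) • (A ^ n) N) (exp A N) := by
  have h := exp_series_hasSum_exp' (𝕂 := ℂ) A
  simpa using h.mapL (ContinuousLinearMap.apply ℂ E N)

/-- The coefficients of a power series that is `O(τ^m)` vanish below the order `m`. -/
theorem coeff_eq_zero_of_isBigO {c : ℕ → 𝔸} {F : ℝ → 𝔸}
    (hs : Summable fun n => ‖c n‖) (hF : ∀ τ : ℝ, HasSum (fun n => (τ : ℂ) ^ n • c n) (F τ))
    {m : ℕ} (hO : F =O[nhds 0] fun τ => τ ^ m) (n : ℕ) (hn : n < m) : c n = 0 := by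
  induction n using Nat.strong_induction_on with
  | _ n ih =>
    obtain ⟨C, hC⟩ := hO.bound
    have key : ∀ᶠ τ : ℝ in nhdsWithin 0 (Set.Ioi 0), ‖c n‖ ≤ τ * (C + ∑' k, ‖c k‖) := by
      have h1 : ∀ᶠ τ : ℝ in nhdsWithin 0 (Set.Ioi 0), τ ∈ Set.Ioo (0 : ℝ) 1 :=
        Ioo_mem_nhdsGT one_pos
      filter_upwards [hC.filter_mono nhdsWithin_le_nhds, h1] with τ hτ hτ1
      obtain ⟨h0, h1⟩ := hτ1
      have hsum : HasSum (fun k => (τ : ℂ) ^ (k + (n + 1)) • c (k + (n + 1)))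
          (F τ - (τ : ℂ) ^ n • c n) := by
        have := (hasSum_nat_add_iff' (n + 1)).mpr (hF τ)
        rwa [sum_range_succ, sum_eq_zero, zero_add] at this
        intro i hi
        rw [ih i (mem_range.mp hi) ((mem_range.mp hi).trans hn), smul_zero]
      have hs' : Summable fun k => ‖c (k + (n + 1))‖ := (summable_nat_add_iff (n + 1)).mpr hs
      have hb : ‖F τ - (τ : ℂ) ^ n • c n‖ ≤ τ ^ (n + 1) * ∑' k, ‖c k‖ := by
        rw [← hsum.tsum_eq]
        have hle : ∀ k, ‖(τ : ℂ) ^ (k + (n + 1)) • c (k + (n + 1))‖ ≤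
            τ ^ (n + 1) * ‖c (k + (n + 1))‖ := by
          intro k
          rw [norm_smul, norm_pow, Complex.norm_real, Real.norm_of_nonneg h0.le]
          exact mul_le_mul_of_nonneg_right
            (pow_le_pow_of_le_one h0.le h1.le (Nat.le_add_left _ _)) (norm_nonneg _)
        refine (tsum_of_norm_bounded (hs'.mul_left _).hasSum hle).trans ?_
        rw [tsum_mul_left]
        refine mul_le_mul_of_nonneg_left ?_ (by positivity)
        rw [← hs.sum_add_tsum_nat_add (n + 1)]
        exact le_add_of_nonneg_left (sum_nonneg fun _ _ => norm_nonneg _)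
      have hF' : ‖F τ‖ ≤ C * τ ^ (n + 1) := by
        have hC0 : 0 ≤ C := by
          have := (norm_nonneg _).trans hτ
          rw [Real.norm_of_nonneg (by positivity)] at this
          exact nonneg_of_mul_nonneg_left this (by positivity)
        refine hτ.trans ?_
        rw [Real.norm_of_nonneg (by positivity)]
        exact mul_le_mul_of_nonneg_left (pow_le_pow_of_le_one h0.le h1.le hn) hC0
      have hn1 : ‖(τ : ℂ) ^ n • c n‖ = τ ^ n * ‖c n‖ := by
        rw [norm_smul, norm_pow, Complex.norm_real, Real.norm_of_nonneg h0.le]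
      have h2 : τ ^ n * ‖c n‖ ≤ τ ^ n * (τ * (C + ∑' k, ‖c k‖)) := by
        rw [← hn1]
        have h3 := norm_sub_norm_le ((τ : ℂ) ^ n • c n) (F τ)
        rw [norm_sub_rev] at h3
        calc _ ≤ ‖F τ‖ + ‖F τ - (τ : ℂ) ^ n • c n‖ := by linarith
          _ ≤ C * τ ^ (n + 1) + τ ^ (n + 1) * ∑' k, ‖c k‖ := add_le_add hF' hb
          _ = _ := by ring
      exact le_of_mul_le_mul_left h2 (by positivity)
    have hlim : Filter.Tendsto (fun τ : ℝ => τ * (C + ∑' k, ‖c k‖)) (nhdsWithin 0 (Set.Ioi 0))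
        (nhds 0) := by
      have : Filter.Tendsto (fun τ : ℝ => τ * (C + ∑' k, ‖c k‖)) (nhds 0) (nhds (0 * _)) :=
        Filter.tendsto_id.mul_const _
      rw [zero_mul] at this
      exact this.mono_left nhdsWithin_le_nhds
    exact norm_le_zero_iff.mp (ge_of_tendsto hlim key)

variable [CompleteSpace 𝔸]

theorem exp_mulLeft_apply (B N : 𝔸) : exp (ContinuousLinearMap.mul ℂ 𝔸 B) N = exp B * N := by
  have hp : ∀ n : ℕ, (ContinuousLinearMap.mul ℂ 𝔸 B ^ n) N = B ^ n * N := by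
    intro n
    induction n with
    | zero => simp
    | succ n ih => simp [pow_succ', ih, mul_assoc]
  refine (hasSum_exp_apply (ContinuousLinearMap.mul ℂ 𝔸 B) N).unique ?_
  simp_rw [hp, ← smul_mul_assoc]
  exact (exp_series_hasSum_exp' (𝕂 := ℂ) B).mul_right N

theorem exp_mulRight_apply (B N : 𝔸) :
    exp ((ContinuousLinearMap.mul ℂ 𝔸).flip B) N = N * exp B := by
  have hp : ∀ n : ℕ, ((ContinuousLinearMap.mul ℂ 𝔸).flip B ^ n) N = N * B ^ n := by
    intro n
    induction n with
    | zero => simp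
    | succ n ih => rw [pow_succ', mul_apply_eq, ih]; simp [pow_succ, mul_assoc]
  refine (hasSum_exp_apply ((ContinuousLinearMap.mul ℂ 𝔸).flip B) N).unique ?_
  simp_rw [hp, ← mul_smul_comm]
  exact (exp_series_hasSum_exp' (𝕂 := ℂ) B).mul_left N

/-- Conjugation by `e^B` is the exponential of the commutator with `B`. -/
theorem exp_adL_apply (B N : 𝔸) : exp (adL B) N = exp B * N * exp (-B) := by
  let _ : NormedAlgebra ℚ (𝔸 →L[ℂ] 𝔸) := NormedAlgebra.restrictScalars ℚ ℂ _
  have hc : Commute (ContinuousLinearMap.mul ℂ 𝔸 B) ((ContinuousLinearMap.mul ℂ 𝔸).flip (-B)) := by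
    ext N; simp [mul_assoc]
  have : adL B = ContinuousLinearMap.mul ℂ 𝔸 B + (ContinuousLinearMap.mul ℂ 𝔸).flip (-B) := by
    rw [adL, map_neg, sub_eq_add_neg]
  rw [this, exp_add_of_commute hc, mul_apply_eq, exp_mulLeft_apply,
    exp_mulRight_apply, mul_assoc]

/-- Cauchy product of a series of operators and a series of vectors. -/
theorem hasSum_apply_antidiagonal {E : Type*} [NormedAddCommGroup E] [NormedSpace ℂ E]
    [CompleteSpace E] {f : ℕ → E →L[ℂ] E} {g : ℕ → E} {F : E →L[ℂ] E} {G : E}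
    (hf : Summable fun n => ‖f n‖) (hg : Summable fun n => ‖g n‖) (hF : HasSum f F)
    (hG : HasSum g G) :
    (Summable fun n => ‖∑ ij ∈ antidiagonal n, f ij.1 (g ij.2)‖) ∧
      HasSum (fun n => ∑ ij ∈ antidiagonal n, f ij.1 (g ij.2)) (F G) := by
  have hb : Summable fun x : ℕ × ℕ => ‖f x.1‖ * ‖g x.2‖ :=
    hf.mul_of_nonneg hg (fun _ => norm_nonneg _) fun _ => norm_nonneg _
  have hn : Summable fun x : ℕ × ℕ => ‖f x.1 (g x.2)‖ :=
    hb.of_nonneg_of_le (fun _ => norm_nonneg _) fun x => (f x.1).le_opNorm _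
  have hs : Summable fun x : ℕ × ℕ => f x.1 (g x.2) := hn.of_norm
  have hsum : HasSum (fun x : ℕ × ℕ => f x.1 (g x.2)) (F G) := by
    have h1 := hs.hasSum
    have h2 := h1.prod_fiberwise fun i => (f i).hasSum hG
    have h3 : HasSum (fun i => f i G) (F G) := by
      simpa using hF.mapL (ContinuousLinearMap.apply ℂ E G)
    rwa [h2.unique h3] at h1
  constructor
  · have h1 := (HasAntidiagonal.sigmaAntidiagonalEquivProd (A := ℕ)).summable_iff.mpr hn
    have h2 := h1.sigma
    refine h2.of_nonneg_of_le (fun _ => norm_nonneg _) fun n => ?_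
    refine (norm_sum_le _ _).trans_eq ?_
    rw [tsum_fintype]
    exact (Finset.sum_coe_sort (antidiagonal n) fun x => ‖f x.1 (g x.2)‖).symm
  · have h1 := (HasAntidiagonal.sigmaAntidiagonalEquivProd (A := ℕ)).hasSum_iff.mpr hsum
    have h2 := h1.sigma fun n => hasSum_fintype _
    convert h2 using 1
    funext n
    exact (Finset.sum_coe_sort (antidiagonal n) fun x => f x.1 (g x.2)).symm

/-- The product `e^{z B_1} ⋯ e^{z B_m}`. -/
def prodExp : List 𝔸 → ℂ → 𝔸
  | [], _ => 1
  | B :: l, z => exp (z • B) * prodExp l z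

/-- The inverse `e^{-z B_m} ⋯ e^{-z B_1}` of `prodExp`. -/
def prodExpInv : List 𝔸 → ℂ → 𝔸
  | [], _ => 1
  | B :: l, z => prodExpInv l z * exp (-(z • B))

/-- The generator `K(z) = T'(z) T(z)⁻¹` of the product `T(z) = e^{z B_1} ⋯ e^{z B_m}`. -/
def generator : List 𝔸 → ℂ → 𝔸
  | [], _ => 0
  | B :: l, z => B + exp (z • B) * generator l z * exp (-(z • B))

/-- The Taylor coefficients of `generator`: sums of nested commutators of the `B_v`. -/
def genCoeff : List 𝔸 → ℕ → 𝔸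
  | [], _ => 0
  | B :: l, n => (if n = 0 then B else 0) +
      ∑ ij ∈ antidiagonal n, ((ij.1.factorial : ℂ)⁻¹) • (adL B ^ ij.1) (genCoeff l ij.2)

theorem exp_mul_exp_neg' (B : 𝔸) : exp B * exp (-B) = 1 := by
  let _ : NormedAlgebra ℚ 𝔸 := NormedAlgebra.restrictScalars ℚ ℂ _
  rw [← exp_add_of_commute (Commute.refl B).neg_right, add_neg_cancel, exp_zero]

theorem exp_neg_mul_exp' (B : 𝔸) : exp (-B) * exp B = 1 := by
  simpa using exp_mul_exp_neg' (-B)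

theorem prodExp_mul_inv (l : List 𝔸) (z : ℂ) : prodExp l z * prodExpInv l z = 1 := by
  induction l with
  | nil => simp [prodExp, prodExpInv]
  | cons B l ih =>
    rw [prodExp, prodExpInv, mul_assoc, ← mul_assoc (prodExp l z), ih, one_mul, exp_mul_exp_neg']

theorem hasDerivAt_exp_smul' (B : 𝔸) (z : ℂ) :
    HasDerivAt (fun u : ℂ => exp (u • B)) (B * exp (z • B)) z :=
  hasDerivAt_exp_smul_const' B z

theorem hasDerivAt_exp_neg_smul' (B : 𝔸) (z : ℂ) :
    HasDerivAt (fun u : ℂ => exp (-(u • B))) (-(exp (-(z • B)) * B)) z := by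
  have := hasDerivAt_exp_smul_const (-B) z
  simpa using this

theorem hasDerivAt_prodExp (l : List 𝔸) (z : ℂ) :
    HasDerivAt (prodExp l) (generator l z * prodExp l z) z := by
  induction l with
  | nil => simp [prodExp, generator, hasDerivAt_const]
  | cons B l ih =>
    refine ((hasDerivAt_exp_smul' B z).mul ih).congr_deriv ?_
    rw [generator, prodExp, add_mul, mul_assoc, mul_assoc, mul_assoc, ← mul_assoc (exp (-(z • B))),
      exp_neg_mul_exp', one_mul]

theorem hasDerivAt_prodExpInv (l : List 𝔸) (z : ℂ) :
    HasDerivAt (prodExpInv l) (-(prodExpInv l z * generator l z)) z := by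
  induction l with
  | nil => simpa [prodExpInv, generator] using hasDerivAt_const z (1 : 𝔸)
  | cons B l ih =>
    refine (ih.mul (hasDerivAt_exp_neg_smul' B z)).congr_deriv ?_
    rw [generator, prodExpInv, mul_add, mul_assoc _ _ B,
      mul_assoc _ (exp (-(z • B))) (exp (z • B) * _ * _), ← mul_assoc (exp (-(z • B))),
      ← mul_assoc (exp (-(z • B))), exp_neg_mul_exp', one_mul, neg_mul, mul_neg, mul_assoc,
      neg_add, add_comm]

/-- The Taylor series of the generator converges everywhere. -/
theorem hasSum_generator (l : List 𝔸) (z : ℂ) :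
    (Summable fun n => ‖z ^ n • genCoeff l n‖) ∧
      HasSum (fun n => z ^ n • genCoeff l n) (generator l z) := by
  induction l with
  | nil => simp [genCoeff, generator, hasSum_zero]
  | cons B l ih =>
    have h0 : HasSum (fun n => z ^ n • (if n = 0 then B else 0)) B := by
      convert hasSum_ite_eq 0 B using 2 with n
      split_ifs with h <;> simp [h]
    have h0' : Summable fun n => ‖z ^ n • (if n = 0 then B else 0)‖ :=
      (summable_of_ne_finset_zero (s := {0})) fun n hn => by
        simp only [mem_singleton] at hn; simp [hn]
    have hc := hasSum_apply_antidiagonal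
      (norm_expSeries_summable' (𝕂 := ℂ) (z • adL B)) ih.1
      (exp_series_hasSum_exp' (𝕂 := ℂ) (z • adL B)) ih.2
    have he : ∀ n, z ^ n • genCoeff (B :: l) n = z ^ n • (if n = 0 then B else 0) +
        ∑ ij ∈ antidiagonal n,
          ((ij.1.factorial : ℂ)⁻¹ • (z • adL B) ^ ij.1) (z ^ ij.2 • genCoeff l ij.2) := by
      intro n
      rw [genCoeff, smul_add, smul_sum]
      congr 1
      refine sum_congr rfl fun ij hij => ?_
      rw [← mem_antidiagonal.mp hij, smul_apply, smul_pow_apply, map_smul, smul_comm, pow_add,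
        mul_smul]
    constructor
    · refine (h0'.add hc.1).of_nonneg_of_le (fun _ => norm_nonneg _) fun n => ?_
      rw [he]; exact norm_add_le _ _
    · simp_rw [he]
      convert h0.add hc.2 using 1
      rw [generator, ← adL_smul, exp_adL_apply]

end BanachAlgebra

/-! ### The error in terms of the Taylor coefficients of the generator -/

section ErrorRepresentation

/-- An analytic function that is `O(τ^(p+1))` has a derivative that is `O(τ^p)`. -/
theorem isBigO_deriv_of_analyticAt {E : Type*} [NormedAddCommGroup E] [NormedSpace ℝ E]
    [CompleteSpace E] {D : ℝ → E} (hD : AnalyticAt ℝ D 0) {p : ℕ}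
    (hO : D =O[nhds 0] fun τ => τ ^ (p + 1)) : deriv D =O[nhds 0] fun τ => τ ^ p := by
  have hord : ((p + 1 : ℕ) : ℕ∞) ≤ analyticOrderAt D 0 := by
    by_contra! hlt
    obtain ⟨n, hn⟩ := ENat.ne_top_iff_exists.mp hlt.ne_top
    rw [← hn, Nat.cast_lt] at hlt
    obtain ⟨g, hg, hg0, hDg⟩ := hD.analyticOrderAt_eq_natCast.mp hn.symm
    obtain ⟨C, hC⟩ := hO.bound
    have hlim : Filter.Tendsto (fun τ : ℝ => C * |τ|) (nhdsWithin 0 {0}ᶜ) (nhds 0) := by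
      have : Filter.Tendsto (fun τ : ℝ => C * |τ|) (nhds 0) (nhds (C * |0|)) :=
        (continuous_const.mul continuous_abs).tendsto 0
      rw [abs_zero, mul_zero] at this
      exact this.mono_left nhdsWithin_le_nhds
    have hgl : Filter.Tendsto (fun τ => ‖g τ‖) (nhdsWithin 0 {0}ᶜ) (nhds ‖g 0‖) :=
      (hg.continuousAt.norm.tendsto).mono_left nhdsWithin_le_nhds
    have hle : ∀ᶠ τ in nhdsWithin (0 : ℝ) {0}ᶜ, ‖g τ‖ ≤ C * |τ| := by
      have h1 : ∀ᶠ τ : ℝ in nhds 0, |τ| < 1 := by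
        have := Metric.ball_mem_nhds (0 : ℝ) one_pos
        filter_upwards [this] with τ hτ
        simpa using hτ
      filter_upwards [hC.filter_mono nhdsWithin_le_nhds, hDg.filter_mono nhdsWithin_le_nhds,
        h1.filter_mono nhdsWithin_le_nhds, self_mem_nhdsWithin] with τ h2 h3 h4 h5
      have hpos : 0 < |τ| := abs_pos.mpr h5
      rw [h3, sub_zero, norm_smul, norm_pow, norm_pow, Real.norm_eq_abs] at h2
      have hC0 : 0 ≤ C := by
        have h6 : 0 ≤ C * |τ| ^ (p + 1) := le_trans (by positivity) h2
        exact nonneg_of_mul_nonneg_left h6 (by positivity)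
      have h7 : |τ| ^ n * ‖g τ‖ ≤ |τ| ^ n * (C * |τ|) := by
        refine h2.trans ?_
        calc C * |τ| ^ (p + 1) ≤ C * |τ| ^ (n + 1) :=
              mul_le_mul_of_nonneg_left (pow_le_pow_of_le_one hpos.le h4.le hlt) hC0
          _ = _ := by ring
      exact le_of_mul_le_mul_left h7 (by positivity)
    exact hg0 (norm_le_zero_iff.mp (le_of_tendsto_of_tendsto hgl hlim hle))
  obtain ⟨g, hg, hDg⟩ := (natCast_le_analyticOrderAt hD).mp hord
  have hder : deriv D =ᶠ[nhds 0] fun τ => τ ^ p • (((p + 1 : ℕ) : ℝ) • g τ + τ • deriv g τ) := by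
    have hDg' : D =ᶠ[nhds 0] fun τ => τ ^ (p + 1) • g τ := by
      simp only [sub_zero] at hDg; exact hDg
    filter_upwards [hDg'.deriv, hg.eventually_analyticAt] with τ h1 h2
    have h3 := ((hasDerivAt_pow (p + 1) τ).fun_smul h2.differentiableAt.hasDerivAt).deriv
    rw [h1, h3, add_tsub_cancel_right, smul_add, smul_smul, smul_smul, add_comm,
      ← pow_succ, mul_comm]
  refine hder.trans_isBigO ?_
  have hcont : ContinuousAt (fun τ : ℝ => ((p + 1 : ℕ) : ℝ) • g τ + τ • deriv g τ) 0 :=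
    (hg.continuousAt.const_smul _).add (continuousAt_id.smul hg.deriv.continuousAt)
  simpa using (Asymptotics.isBigO_refl (fun τ : ℝ => τ ^ p) (nhds 0)).smul
    (hcont.tendsto.isBigO_one ℝ)

variable {𝔸 : Type*} [NormedRing 𝔸] [NormedAlgebra ℂ 𝔸]

theorem prodExp_zero (l : List 𝔸) : prodExp l 0 = 1 := by
  induction l with
  | nil => rfl
  | cons B l ih => simp [prodExp, ih]

theorem prodExpInv_zero (l : List 𝔸) : prodExpInv l 0 = 1 := by
  induction l with
  | nil => rfl
  | cons B l ih => simp [prodExpInv, ih]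

theorem hasDerivAt_comp_ofReal {F : ℂ → 𝔸} {F' : 𝔸} {τ : ℝ} (hF : HasDerivAt F F' (τ : ℂ)) :
    HasDerivAt (fun τ : ℝ => F τ) F' τ := by
  have h : HasDerivAt (fun τ : ℝ => (τ : ℂ)) 1 τ := Complex.ofRealCLM.hasDerivAt
  have h1 := hF.scomp τ h
  rw [one_smul] at h1
  exact h1

variable [CompleteSpace 𝔸]

theorem analyticAt_comp_ofReal {F : ℂ → 𝔸} (hF : Differentiable ℂ F) (τ : ℝ) :
    AnalyticAt ℝ (fun τ : ℝ => F τ) τ := by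
  have h1 : AnalyticAt ℝ F (τ : ℂ) := (hF.analyticAt (τ : ℂ)).restrictScalars
  exact h1.comp (Complex.ofRealCLM.analyticAt τ)

theorem differentiable_exp_smul (A : 𝔸) : Differentiable ℂ fun z : ℂ => exp (z • A) :=
  fun z => (hasDerivAt_exp_smul' A z).differentiableAt

theorem differentiable_prodExp (l : List 𝔸) : Differentiable ℂ (prodExp l) :=
  fun z => (hasDerivAt_prodExp l z).differentiableAt

theorem differentiable_prodExpInv (l : List 𝔸) : Differentiable ℂ (prodExpInv l) :=
  fun z => (hasDerivAt_prodExpInv l z).differentiableAt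

/-- The Taylor series of `K(τ) - A`, where `K` is the generator of the product. -/
theorem hasSum_generator_sub (l : List 𝔸) (A : 𝔸) (z : ℂ) :
    (Summable fun n => ‖z ^ n • (genCoeff l n - if n = 0 then A else 0)‖) ∧
      HasSum (fun n => z ^ n • (genCoeff l n - if n = 0 then A else 0)) (generator l z - A) := by
  have h0 : HasSum (fun n => z ^ n • (if n = 0 then A else 0)) A := by
    convert hasSum_ite_eq 0 A using 2 with n
    split_ifs with h <;> simp [h]
  have h0' : Summable fun n => ‖z ^ n • (if n = 0 then A else 0)‖ :=
    (summable_of_ne_finset_zero (s := {0})) fun n hn => by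
      simp only [mem_singleton] at hn; simp [hn]
  simp_rw [smul_sub]
  refine ⟨((hasSum_generator l z).1.add h0').of_nonneg_of_le (fun _ => norm_nonneg _) fun n =>
    norm_sub_le _ _, (hasSum_generator l z).2.sub h0⟩

/-- If the product agrees with `e^{τ A}` to order `p`, then its generator agrees with `A` up to
terms of order `τ^p`. -/
theorem genCoeff_eq_of_isBigO (l : List 𝔸) (A : 𝔸) {p : ℕ}
    (hO : (fun τ : ℝ => prodExp l τ - exp ((τ : ℂ) • A)) =O[nhds 0] fun τ : ℝ => τ ^ (p + 1))
    (n : ℕ) (hn : n < p) : genCoeff l n - (if n = 0 then A else 0) = 0 := by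
  have hs : Summable fun n => ‖genCoeff l n - if n = 0 then A else 0‖ := by
    simpa using (hasSum_generator_sub l A 1).1
  refine coeff_eq_zero_of_isBigO hs (fun τ => (hasSum_generator_sub l A τ).2) ?_ n hn
  set D : ℝ → 𝔸 := fun τ => prodExp l τ - exp ((τ : ℂ) • A) with hDdef
  have hDan : AnalyticAt ℝ D 0 := by
    have := analyticAt_comp_ofReal
      ((differentiable_prodExp l).fun_sub (differentiable_exp_smul A)) 0
    exact this
  have hD' : ∀ τ : ℝ, HasDerivAt D
      (generator l τ * prodExp l τ - A * exp ((τ : ℂ) • A)) τ := fun τ =>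
    (hasDerivAt_comp_ofReal (hasDerivAt_prodExp l τ)).fun_sub
      (hasDerivAt_comp_ofReal (hasDerivAt_exp_smul' A τ))
  have h1 := isBigO_deriv_of_analyticAt hDan hO
  have h2 : D =O[nhds 0] fun τ : ℝ => τ ^ p := by
    refine hO.trans (Asymptotics.IsBigO.of_bound 1 ?_)
    filter_upwards [Metric.ball_mem_nhds (0 : ℝ) one_pos] with τ hτ
    have hτ' : |τ| < 1 := by simpa using hτ
    rw [one_mul, norm_pow, norm_pow, Real.norm_eq_abs]
    exact pow_le_pow_of_le_one (abs_nonneg _) hτ'.le (Nat.le_succ p)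
  have hinv : (fun τ : ℝ => prodExpInv l τ) =O[nhds 0] fun _ => (1 : ℝ) :=
    (((differentiable_prodExpInv l).continuous.comp Complex.continuous_ofReal).tendsto 0).isBigO_one
      ℝ
  have hA : (fun _ : ℝ => A) =O[nhds 0] fun _ => (1 : ℝ) :=
    Asymptotics.isBigO_const_const _ one_ne_zero _
  have h3 : (fun τ => (deriv D τ - A * D τ) * prodExpInv l τ) =O[nhds 0] fun τ : ℝ => τ ^ p := by
    have h4 : (fun τ => A * D τ) =O[nhds 0] fun τ : ℝ => τ ^ p := by
      simpa using hA.mul h2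
    simpa using (h1.sub h4).mul hinv
  refine h3.congr_left fun τ => ?_
  rw [(hD' τ).deriv]
  have : generator l τ * prodExp l τ - A * exp ((τ : ℂ) • A) - A * D τ =
      (generator l τ - A) * prodExp l τ := by
    rw [hDdef]; noncomm_ring
  rw [this, mul_assoc, prodExp_mul_inv, mul_one]

/-- The error of the product on the range of a projection `Q` that commutes with the evolution. As
`W(τ) = e^{τA}` satisfies `(T⁻¹ W)' = - T⁻¹ (K - A) W`, only `(K - A) Q` enters, and the Taylor
series of `K - A` starts at the order `p`. -/
theorem norm_error_le (l : List 𝔸) (A Q : 𝔸) {p : ℕ} (hp : 1 ≤ p) (t : ℝ) (d : ℕ → ℝ)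
    (hT : ∀ τ : ℝ, ‖prodExp l τ‖ ≤ 1) (hTi : ∀ τ : ℝ, ‖prodExpInv l τ‖ ≤ 1)
    (hW : ∀ τ : ℝ, ‖exp ((τ : ℂ) • A)‖ ≤ 1)
    (hQ : ∀ τ : ℝ, exp ((τ : ℂ) • A) * Q = Q * exp ((τ : ℂ) • A))
    (hO : (fun τ : ℝ => prodExp l τ - exp ((τ : ℂ) • A)) =O[nhds 0] fun τ : ℝ => τ ^ (p + 1))
    (hd : ∀ n, p ≤ n → |t| ^ n * ‖genCoeff l n * Q‖ ≤ d n) (hs : Summable fun n => d (n + p)) :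
    ‖(exp ((t : ℂ) • A) - prodExp l t) * Q‖ ≤ |t| / (p + 1) * ∑' n, d (n + p) := by
  set S := ∑' n, d (n + p) with hS
  have hd0 : ∀ n, 0 ≤ d (n + p) := fun n =>
    le_trans (by positivity) (hd (n + p) (Nat.le_add_left _ _))
  have hS0 : 0 ≤ S := tsum_nonneg hd0
  obtain ⟨σ, hσ, hσt⟩ : ∃ σ : ℝ, |σ| = 1 ∧ σ * |t| = t := by
    rcases le_total 0 t with h | h
    · exact ⟨1, by simp, by rw [abs_of_nonneg h, one_mul]⟩
    · exact ⟨-1, by simp, by rw [abs_of_nonpos h]; ring⟩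
  rcases eq_or_ne t 0 with rfl | ht
  · have h0 := prodExp_zero l
    simp [h0]
  have htp : 0 < |t| := abs_pos.mpr ht
  -- the Taylor series bounds the generator along the segment from `0` to `t`
  have hK : ∀ s : ℝ, 0 ≤ s → s ≤ |t| →
      ‖(generator l ((σ * s : ℝ) : ℂ) - A) * Q‖ ≤ S / |t| ^ p * s ^ p := by
    intro s hs0 hst
    have h1 := (hasSum_generator_sub l A ((σ * s : ℝ) : ℂ)).2
    have h2 := (hasSum_nat_add_iff' p).mpr h1
    rw [sum_eq_zero (fun i hi => by
      rw [genCoeff_eq_of_isBigO l A hO i (mem_range.mp hi), smul_zero]), sub_zero] at h2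
    rw [← (h2.mul_right Q).tsum_eq]
    have h3 : ∀ n, ‖((σ * s : ℝ) : ℂ) ^ (n + p) •
        (genCoeff l (n + p) - if n + p = 0 then A else 0) * Q‖ ≤ (s / |t|) ^ p * d (n + p) := by
      intro n
      have hne : n + p ≠ 0 := by omega
      rw [if_neg hne, sub_zero, smul_mul_assoc, norm_smul, norm_pow, Complex.norm_real,
        Real.norm_eq_abs, abs_mul, hσ, one_mul, abs_of_nonneg hs0]
      have h4 : s ^ (n + p) = (s / |t|) ^ (n + p) * |t| ^ (n + p) := by
        rw [← mul_pow, div_mul_cancel₀ _ htp.ne']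
      have h5 : (s / |t|) ^ (n + p) ≤ (s / |t|) ^ p :=
        pow_le_pow_of_le_one (by positivity) ((div_le_one htp).mpr hst) (Nat.le_add_left _ _)
      rw [h4, mul_assoc]
      exact mul_le_mul h5 (hd _ (Nat.le_add_left _ _)) (by positivity) (by positivity)
    refine (tsum_of_norm_bounded (hs.mul_left _).hasSum h3).trans_eq ?_
    rw [tsum_mul_left, div_pow]
    ring
  let f : ℝ → 𝔸 := fun s =>
    prodExpInv l ((σ * s : ℝ) : ℂ) * exp (((σ * s : ℝ) : ℂ) • A) * Q - Q
  let f' : ℝ → 𝔸 := fun s => σ • -(prodExpInv l ((σ * s : ℝ) : ℂ) *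
    ((generator l ((σ * s : ℝ) : ℂ) - A) * Q) * exp (((σ * s : ℝ) : ℂ) • A))
  have hf : ∀ s : ℝ, HasDerivAt f (f' s) s := by
    intro s
    have h1 : HasDerivAt (fun τ : ℝ => prodExpInv l τ * exp ((τ : ℂ) • A))
        (-(prodExpInv l ((σ * s : ℝ) : ℂ) * generator l ((σ * s : ℝ) : ℂ)) *
            exp (((σ * s : ℝ) : ℂ) • A) +
          prodExpInv l ((σ * s : ℝ) : ℂ) * (A * exp (((σ * s : ℝ) : ℂ) • A))) (σ * s) :=
      (hasDerivAt_comp_ofReal (hasDerivAt_prodExpInv l _)).fun_mul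
        (hasDerivAt_comp_ofReal (hasDerivAt_exp_smul' A _))
    have h2 : HasDerivAt (fun s : ℝ => σ * s) σ s := by
      simpa using (hasDerivAt_id s).const_mul σ
    have h3 := ((h1.scomp s h2).mul_const Q).sub_const Q
    refine h3.congr_deriv ?_
    simp only [f']
    rw [smul_mul_assoc]
    congr 1
    have e1 := hQ (σ * s)
    rw [show ∀ P K W : 𝔸, P * ((K - A) * Q) * W = P * (K - A) * (Q * W) by
      intros; noncomm_ring, ← e1]
    noncomm_ring
  have hf0 : f 0 = 0 := by
    have h0 := prodExpInv_zero l
    simp [f, h0]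
  have hB : ∀ s : ℝ, HasDerivAt (fun s : ℝ => S / |t| ^ p * (s ^ (p + 1) / (p + 1)))
      (S / |t| ^ p * s ^ p) s := by
    intro s
    refine (((hasDerivAt_pow (p + 1) s).div_const _).const_mul _).congr_deriv ?_
    push_cast
    field_simp
  have hmain := image_norm_le_of_norm_deriv_right_le_deriv_boundary (f := f) (f' := f')
    (a := 0) (b := |t|) (fun s _ => (hf s).continuousAt.continuousWithinAt)
    (fun s _ => (hf s).hasDerivWithinAt) (by rw [hf0]; simp) hB
    (fun s hs => by
      obtain ⟨hs0, hst⟩ := hs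
      refine le_trans ?_ (hK s hs0 hst.le)
      simp only [f']
      rw [norm_smul, Real.norm_eq_abs, hσ, one_mul, norm_neg]
      refine (norm_mul_le _ _).trans ?_
      refine (mul_le_of_le_one_right (norm_nonneg _) (hW _)).trans ?_
      refine (norm_mul_le _ _).trans ?_
      exact mul_le_of_le_one_left (norm_nonneg _) (hTi _))
    (Set.right_mem_Icc.mpr htp.le)
  have hft : (exp ((t : ℂ) • A) - prodExp l t) * Q = prodExp l t * f |t| := by
    simp only [f]
    rw [hσt, mul_sub, ← mul_assoc, ← mul_assoc, prodExp_mul_inv, one_mul, sub_mul]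
  rw [hft]
  refine (norm_mul_le _ _).trans ((mul_le_of_le_one_left (norm_nonneg _) (hT t)).trans
    (hmain.trans_eq ?_))
  rw [pow_succ]
  field_simp

end ErrorRepresentation

/-! ### Sums over words of nested commutators -/

section Words

variable {𝔸 : Type*} [NormedRing 𝔸] [NormedAlgebra ℂ 𝔸]

theorem list_sum_seminorm_apply {ι : Type*} (l : List ι) (g : ι → Seminorm ℂ 𝔸) (N : 𝔸) :
    (l.map g).sum N = (l.map fun B => g B N).sum := by
  induction l with
  | nil => rfl
  | cons B l ih => rw [List.map_cons, List.sum_cons, add_apply, ih, List.map_cons,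
      List.sum_cons]

theorem seminorm_sum_le {ι : Type*} (f : Seminorm ℂ 𝔸) (s : Finset ι) (g : ι → 𝔸) :
    f (∑ i ∈ s, g i) ≤ ∑ i ∈ s, f (g i) :=
  Finset.le_sum_of_subadditive f (map_zero f).le (map_add_le_add f) s g

theorem sum_list_map_comm {ι κ : Type*} (s : Finset ι) (l : List κ) (g : ι → κ → ℝ) :
    (l.map fun C => ∑ i ∈ s, g i C).sum = ∑ i ∈ s, (l.map fun C => g i C).sum := by
  induction l with
  | nil => simp
  | cons C l ih => simp [ih, sum_add_distrib]

/-- For layers `l_1, …, l_n` of operators, the sum of `f [B_n, […, [B_1, N]]]` over all the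
`B_j ∈ l_j`. The layer at the head of the list acts first. -/
def wordSum (f : Seminorm ℂ 𝔸) : List (List 𝔸) → Seminorm ℂ 𝔸
  | [] => f
  | l :: L => (l.map fun B => (wordSum f L).comp (adL B : 𝔸 →L[ℂ] 𝔸).toLinearMap).sum

theorem wordSum_cons_apply (f : Seminorm ℂ 𝔸) (l : List 𝔸) (L : List (List 𝔸)) (N : 𝔸) :
    wordSum f (l :: L) N = (l.map fun B => wordSum f L (adL B N)).sum := by
  rw [wordSum, list_sum_seminorm_apply]; rfl

theorem wordSum_append (f : Seminorm ℂ 𝔸) (L L' : List (List 𝔸)) :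
    wordSum f (L ++ L') = wordSum (wordSum f L') L := by
  induction L with
  | nil => rfl
  | cons l L ih => rw [List.cons_append, wordSum, wordSum, ih]

theorem wordSum_add (f g : Seminorm ℂ 𝔸) (L : List (List 𝔸)) (N : 𝔸) :
    wordSum (f + g) L N = wordSum f L N + wordSum g L N := by
  induction L generalizing N with
  | nil => rfl
  | cons l L ih =>
    simp only [wordSum_cons_apply, ih]
    rw [← List.sum_map_add]

theorem wordSum_replicate_singleton (f : Seminorm ℂ 𝔸) (B : 𝔸) (j : ℕ) (N : 𝔸) :
    wordSum f (List.replicate j [B]) N = f ((adL B ^ j) N) := by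
  induction j generalizing N with
  | zero => rfl
  | succ j ih =>
    rw [List.replicate_succ, wordSum_cons_apply, List.map_singleton, List.sum_singleton, ih,
      pow_succ]
    rfl

theorem seminorm_genCoeff_cons_le (f : Seminorm ℂ 𝔸) (B : 𝔸) (l : List 𝔸) (n : ℕ) :
    f (genCoeff (B :: l) n) ≤ (if n = 0 then f B else 0) +
      ∑ ij ∈ antidiagonal n,
        (ij.1.factorial : ℝ)⁻¹ * wordSum f (List.replicate ij.1 [B]) (genCoeff l ij.2) := by
  rw [genCoeff]
  refine (map_add_le_add f _ _).trans (add_le_add ?_ ?_)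
  · split_ifs <;> simp
  · refine (seminorm_sum_le f _ _).trans (sum_le_sum fun ij _ => ?_)
    rw [map_smul_eq_mul, wordSum_replicate_singleton]
    simp

theorem sum_antidiagonal_inv_factorial_mul_pow (x : ℝ) (n : ℕ) :
    ∑ ij ∈ antidiagonal n, (ij.1.factorial : ℝ)⁻¹ * (x ^ ij.2 / ij.2.factorial) =
      (x + 1) ^ n / n.factorial := by
  rw [add_comm x 1, (Commute.all (1 : ℝ) x).add_pow', sum_div]
  refine sum_congr rfl fun ij hij => ?_
  have h := mem_antidiagonal.mp hij
  have hc : (n.choose ij.1 : ℝ) = n.factorial / (ij.1.factorial * ij.2.factorial) := by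
    rw [← h, Nat.choose_symm_add, Nat.add_choose,
      Nat.cast_div (Nat.factorial_mul_factorial_dvd_factorial_add _ _)
      (by positivity)]
    push_cast; rfl
  rw [nsmul_eq_mul, hc, one_pow, one_mul]
  have := Nat.factorial_ne_zero n
  field_simp

/-- A bound that is uniform in the words bounds the Taylor coefficients of the generator. -/
theorem seminorm_genCoeff_le_of_words (f : Seminorm ℂ 𝔸) (l : List 𝔸) (n : ℕ) {K : ℝ}
    (hK : 0 ≤ K)
    (h : ∀ w : List 𝔸, w.length = n → (∀ B ∈ w, B ∈ l) → ∀ B ∈ l,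
      wordSum f (w.map fun B => [B]) B ≤ K) :
    f (genCoeff l n) ≤ (l.length : ℝ) ^ (n + 1) / n.factorial * K := by
  induction l generalizing f n with
  | nil => simp [genCoeff]
  | cons B l ih =>
    set x : ℝ := (l.length : ℝ) with hx
    have hx0 : 0 ≤ x := Nat.cast_nonneg _
    have h1 : ∀ ij ∈ antidiagonal n, (ij.1.factorial : ℝ)⁻¹ *
        wordSum f (List.replicate ij.1 [B]) (genCoeff l ij.2) ≤
        (ij.1.factorial : ℝ)⁻¹ * (x ^ ij.2 / ij.2.factorial) * (x * K) := by
      intro ij hij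
      rw [mul_assoc]
      refine mul_le_mul_of_nonneg_left ?_ (by positivity)
      refine (ih _ ij.2 ?_).trans_eq (by rw [pow_succ]; ring)
      intro w hw hwl C hC
      rw [← wordSum_append]
      have hrep : (w.map fun B => [B]) ++ List.replicate ij.1 [B] =
          (w ++ List.replicate ij.1 B).map fun B => [B] := by simp
      rw [hrep]
      refine h _ ?_ ?_ C (List.mem_cons_of_mem _ hC)
      · rw [List.length_append, List.length_replicate, hw, add_comm, mem_antidiagonal.mp hij]
      · intro D hD
        rcases List.mem_append.mp hD with hD | hD
        · exact List.mem_cons_of_mem _ (hwl D hD)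
        · rw [List.eq_of_mem_replicate hD]; exact List.mem_cons_self
    have h0 : (if n = 0 then f B else 0) ≤ (x + 1) ^ n / n.factorial * K := by
      split_ifs with hn
      · subst hn
        have h2 := h [] rfl (by simp) B List.mem_cons_self
        simpa [wordSum] using h2
      · positivity
    refine (seminorm_genCoeff_cons_le f B l n).trans ((add_le_add h0 (sum_le_sum h1)).trans_eq ?_)
    rw [← sum_mul, sum_antidiagonal_inv_factorial_mul_pow, List.length_cons, Nat.cast_succ, ← hx,
      pow_succ]
    ring

theorem wordSum_replicate_le_cons (f : Seminorm ℂ 𝔸) (B : 𝔸) (l : List 𝔸) (n : ℕ) (N : 𝔸) :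
    wordSum f (List.replicate n l) N ≤ wordSum f (List.replicate n (B :: l)) N := by
  induction n generalizing N with
  | zero => rfl
  | succ n ih =>
    rw [List.replicate_succ, List.replicate_succ, wordSum_cons_apply, wordSum_cons_apply,
      List.map_cons, List.sum_cons]
    refine le_trans ?_ (le_add_of_nonneg_left (apply_nonneg _ _))
    exact List.sum_le_sum fun C _ => ih _

/-- Among the words of length `n` over `B :: l` are those that begin with letters from `l` and end
with a power of `B`. -/
theorem sum_wordSum_replicate_le (f : Seminorm ℂ 𝔸) (B : 𝔸) (l : List 𝔸) (n : ℕ) (N : 𝔸) :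
    ∑ ij ∈ antidiagonal n, wordSum (wordSum f (List.replicate ij.1 [B]))
      (List.replicate ij.2 l) N ≤ wordSum f (List.replicate n (B :: l)) N := by
  induction n generalizing f with
  | zero => simp [wordSum]
  | succ n ih =>
    have hB : wordSum f [B :: l] = wordSum f [[B]] + wordSum f [l] := by
      simp [wordSum]
    rw [Nat.sum_antidiagonal_succ, List.replicate_succ' (a := B :: l), wordSum_append, hB,
      wordSum_add, add_comm]
    refine add_le_add ?_ ?_
    · refine le_trans (sum_le_sum fun ij _ => ?_) (ih _)
      rw [← wordSum_append (L := List.replicate ij.1 [B]), ← List.replicate_succ']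
    · simp only [List.replicate_zero]
      rw [List.replicate_succ', wordSum_append]
      exact wordSum_replicate_le_cons _ _ _ _ _

/-- The Taylor coefficients of the generator, bounded by the sum over all the words. -/
theorem seminorm_genCoeff_le_wordSum (f : Seminorm ℂ 𝔸) (l : List 𝔸) (n : ℕ) :
    f (genCoeff l n) ≤ (l.map fun B => wordSum f (List.replicate n l) B).sum := by
  induction l generalizing f n with
  | nil => simp [genCoeff]
  | cons B l ih =>
    refine (seminorm_genCoeff_cons_le f B l n).trans ?_
    rw [List.map_cons, List.sum_cons]
    refine add_le_add ?_ ?_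
    · split_ifs with hn
      · subst hn; rfl
      · exact apply_nonneg _ _
    · have h1 : ∀ ij ∈ antidiagonal n, (ij.1.factorial : ℝ)⁻¹ *
          wordSum f (List.replicate ij.1 [B]) (genCoeff l ij.2) ≤
          (l.map fun C => wordSum (wordSum f (List.replicate ij.1 [B]))
            (List.replicate ij.2 l) C).sum := by
        intro ij _
        refine le_trans ?_ (ih _ _)
        refine mul_le_of_le_one_left (apply_nonneg _ _) (inv_le_one_of_one_le₀ ?_)
        exact_mod_cast Nat.succ_le_of_lt (Nat.factorial_pos _)
      refine (sum_le_sum h1).trans ?_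
      rw [← sum_list_map_comm]
      exact List.sum_le_sum fun C _ => sum_wordSum_replicate_le _ _ _ _ _

end Words

/-! ### Positive operators on qubits -/

section Operators

variable {N k : ℕ}

/-- State vectors of `N` qubits. -/
abbrev StateVec (N : ℕ) : Type := EuclideanSpace ℂ (Fin N → Fin 2)

/-- The action of an operator on state vectors. -/
abbrev act (A : Op N) : StateVec N →L[ℂ] StateVec N := Matrix.toEuclideanCLM (𝕜 := ℂ) A

/-- The expectation value `⟨ψ|A|ψ⟩`. -/
def energy (A : Op N) (ψ : StateVec N) : ℝ := (inner ℂ ψ (act A ψ)).re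

theorem norm_act (A : Op N) : ‖act A‖ = ‖A‖ := rfl

theorem act_mul_apply (A B : Op N) (ψ : StateVec N) : act (A * B) ψ = act A (act B ψ) := by
  simp only [act, map_mul]; rfl

theorem inner_act_left (A : Op N) (φ ψ : StateVec N) :
    inner ℂ (act A φ) ψ = inner ℂ φ (act (star A) ψ) := by
  simp only [act, map_star]
  exact (ContinuousLinearMap.adjoint_inner_right _ _ _).symm

theorem energy_sum {ι : Type*} (s : Finset ι) (A : ι → Op N) (ψ : StateVec N) :
    energy (∑ i ∈ s, A i) ψ = ∑ i ∈ s, energy (A i) ψ := by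
  simp only [energy, act, map_sum, _root_.sum_apply, inner_sum, Complex.re_sum]

theorem exists_eq_star_mul_self {A : Op N} (hA : A.PosSemidef) : ∃ C : Op N, A = star C * C := by
  open scoped MatrixOrder in
  exact CStarAlgebra.nonneg_iff_eq_star_mul_self.mp hA.nonneg

theorem energy_star_mul_self (C : Op N) (ψ : StateVec N) :
    energy (star C * C) ψ = ‖act C ψ‖ ^ 2 := by
  rw [energy, act_mul_apply, ← inner_act_left, inner_self_eq_norm_sq_to_K]
  norm_cast

theorem energy_nonneg {A : Op N} (hA : A.PosSemidef) (ψ : StateVec N) : 0 ≤ energy A ψ := by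
  obtain ⟨C, rfl⟩ := exists_eq_star_mul_self hA
  rw [energy_star_mul_self]
  positivity

theorem norm_act_sq_le {A : Op N} (hA : A.PosSemidef) (ψ : StateVec N) :
    ‖act A ψ‖ ^ 2 ≤ ‖A‖ * energy A ψ := by
  obtain ⟨C, rfl⟩ := exists_eq_star_mul_self hA
  rw [energy_star_mul_self, act_mul_apply, CStarRing.norm_star_mul_self, ← sq, ← mul_pow]
  have h := (act (star C)).le_opNorm (act C ψ)
  rw [norm_act, norm_star] at h
  exact pow_le_pow_left₀ (norm_nonneg _) h 2

theorem norm_inner_act_le {A : Op N} (hA : A.PosSemidef) (φ ψ : StateVec N) :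
    ‖inner ℂ φ (act A ψ)‖ ≤ (energy A φ + energy A ψ) / 2 := by
  obtain ⟨C, rfl⟩ := exists_eq_star_mul_self hA
  rw [energy_star_mul_self, energy_star_mul_self, act_mul_apply, ← inner_act_left]
  have h := norm_inner_le_norm (𝕜 := ℂ) (act C φ) (act C ψ)
  nlinarith [sq_nonneg (‖act C φ‖ - ‖act C ψ‖)]

theorem energy_le_norm_mul (A : Op N) (ψ : StateVec N) : energy A ψ ≤ ‖A‖ * ‖ψ‖ ^ 2 := by
  have h1 := (Complex.abs_re_le_norm (inner ℂ ψ (act A ψ))).trans (norm_inner_le_norm _ _)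
  have h2 := (act A).le_opNorm ψ
  rw [norm_act] at h2
  refine (le_abs_self _).trans (h1.trans ?_)
  nlinarith [norm_nonneg ψ]

theorem norm_le_of_forall_act {A : Op N} {K : ℝ} (hK : 0 ≤ K)
    (h : ∀ ψ, ‖act A ψ‖ ≤ K * ‖ψ‖) : ‖A‖ ≤ K := by
  rw [← norm_act]
  exact ContinuousLinearMap.opNorm_le_bound _ hK h

theorem norm_le_norm_add {A D : Op N} (hA : A.PosSemidef) (hD : D.PosSemidef) :
    ‖A‖ ≤ ‖A + D‖ := by
  have h : ∀ ψ, ‖act A ψ‖ ^ 2 ≤ ‖A‖ * ‖A + D‖ * ‖ψ‖ ^ 2 := by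
    intro ψ
    have h1 : energy A ψ ≤ energy (A + D) ψ := by
      have : energy (A + D) ψ = energy A ψ + energy D ψ := by
        simp [energy, act]
      rw [this]
      exact le_add_of_nonneg_right (energy_nonneg hD ψ)
    rw [mul_assoc]
    exact (norm_act_sq_le hA ψ).trans
      (mul_le_mul_of_nonneg_left (h1.trans (energy_le_norm_mul _ ψ)) (norm_nonneg _))
  have h2 : ‖A‖ ≤ √(‖A‖ * ‖A + D‖) := by
    refine norm_le_of_forall_act (Real.sqrt_nonneg _) fun ψ => ?_
    refine (Real.le_sqrt (norm_nonneg _) (by positivity)).mpr (h ψ) |>.trans_eq ?_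
    rw [Real.sqrt_mul (by positivity), Real.sqrt_sq (norm_nonneg _)]
  have h3 : ‖A‖ ^ 2 ≤ ‖A‖ * ‖A + D‖ := (Real.le_sqrt (norm_nonneg _) (by positivity)).mp h2
  rcases (norm_nonneg A).eq_or_lt with h0 | h0
  · rw [← h0]; positivity
  · rw [sq] at h3; exact le_of_mul_le_mul_left h3 h0

/-- A commutator with a positive operator gains no factor `2`, as `A` may be replaced by
`A - ‖A‖ / 2`, whose norm is at most `‖A‖ / 2`. -/
theorem norm_commutator_le {A : Op N} (hA : A.PosSemidef) (B : Op N) :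
    ‖A * B - B * A‖ ≤ ‖A‖ * ‖B‖ := by
  set c : ℝ := ‖A‖ / 2 with hc
  have hc0 : 0 ≤ c := by positivity
  have h1 : ‖A - (c : ℂ) • (1 : Op N)‖ ≤ c := by
    refine norm_le_of_forall_act hc0 fun ψ => ?_
    have e1 : act (A - (c : ℂ) • (1 : Op N)) ψ = act A ψ - (c : ℂ) • ψ := by
      simp only [act, map_sub, map_smul, map_one]; rfl
    have e2 := norm_sub_sq (𝕜 := ℂ) (act A ψ) ((c : ℂ) • ψ)
    have e3 : RCLike.re (inner ℂ (act A ψ) ((c : ℂ) • ψ)) = c * energy A ψ := by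
      rw [inner_smul_right, energy, RCLike.re_eq_complex_re, Complex.re_ofReal_mul]
      congr 1
      exact inner_re_symm (𝕜 := ℂ) _ _
    rw [e3, norm_smul, Complex.norm_real, Real.norm_of_nonneg hc0] at e2
    have e4 := norm_act_sq_le hA ψ
    have e5 : ‖A‖ = 2 * c := by rw [hc]; ring
    rw [e5] at e4
    rw [e1]
    refine (sq_le_sq₀ (norm_nonneg _) (by positivity)).mp ?_
    rw [e2]
    linarith
  have h2 : A * B - B * A = (A - (c : ℂ) • 1) * B - B * (A - (c : ℂ) • 1) := by
    simp [sub_mul, mul_sub]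
  rw [h2]
  refine (norm_sub_le _ _).trans ?_
  have h3 := norm_mul_le (A - (c : ℂ) • (1 : Op N)) B
  have h4 := norm_mul_le B (A - (c : ℂ) • (1 : Op N))
  have h5 : ‖A - (c : ℂ) • (1 : Op N)‖ * ‖B‖ ≤ c * ‖B‖ :=
    mul_le_mul_of_nonneg_right h1 (norm_nonneg _)
  have e5 : ‖A‖ = 2 * c := by rw [hc]; ring
  rw [e5]
  linarith

end Operators

/-! ### Supports of operators -/

section Locality

variable {N k : ℕ}

theorem SupportedOn.mul_apply {X Y : Finset (Fin N)} {A B : Op N} (hXY : Disjoint X Y)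
    {M : Matrix (X → Fin 2) (X → Fin 2) ℂ} {M' : Matrix (Y → Fin 2) (Y → Fin 2) ℂ}
    (hA : ∀ s t : Fin N → Fin 2,
      A s t = if ∀ i, i ∉ X → s i = t i then M (fun i => s i) (fun i => t i) else 0)
    (hB : ∀ s t : Fin N → Fin 2,
      B s t = if ∀ i, i ∉ Y → s i = t i then M' (fun i => s i) (fun i => t i) else 0)
    (s t : Fin N → Fin 2) :
    (A * B) s t = if ∀ i, i ∉ X → i ∉ Y → s i = t i then
      M (fun i => s i) (fun i => t i) * M' (fun i => s i) (fun i => t i) else 0 := by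
  classical
  rw [Matrix.mul_apply, sum_eq_single (fun i => if i ∈ X then t i else s i)]
  · have hXY' : ∀ i ∈ Y, i ∉ X := fun i hY hX => disjoint_left.mp hXY hX hY
    rw [hA, hB, if_pos (fun i hi => by simp [hi])]
    have e1 : (fun i : X => if (i : Fin N) ∈ X then t i else s i) = fun i : X => t i := by
      ext i; simp
    have e2 : (fun i : Y => if (i : Fin N) ∈ X then t i else s i) = fun i : Y => s i := by
      ext i; simp [hXY' i i.2]
    have e3 : (∀ i, i ∉ Y → (if i ∈ X then t i else s i) = t i) ↔
        ∀ i, i ∉ X → i ∉ Y → s i = t i := by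
      refine forall_congr' fun i => ?_
      by_cases hX : i ∈ X <;> simp [hX]
    rw [e1, e2]
    simp only [e3]
    split_ifs <;> simp
  · intro u _ hu
    rw [hA, hB]
    split_ifs with h1 h2
    · exfalso
      apply hu
      ext i
      split_ifs with hX
      · rw [h2 i (disjoint_left.mp hXY hX)]
      · rw [h1 i hX]
    all_goals simp
  · simp

/-- Operators on disjoint sets of sites commute. -/
theorem SupportedOn.commute {X Y : Finset (Fin N)} {A B : Op N} (hA : SupportedOn X A)
    (hB : SupportedOn Y B) (hXY : Disjoint X Y) : Commute A B := by
  obtain ⟨M, hM⟩ := hA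
  obtain ⟨M', hM'⟩ := hB
  ext s t
  rw [SupportedOn.mul_apply hXY hM hM', SupportedOn.mul_apply hXY.symm hM' hM, mul_comm]
  refine if_congr ?_ rfl rfl
  exact forall_congr' fun i => imp.swap

/-- The operators that commute with everything supported on a set disjoint from `Z`. These are
exactly the operators supported on `Z`, described in a way that is evidently stable under
products and sums. -/
def ActsOn (Z : Finset (Fin N)) (A : Op N) : Prop :=
  ∀ (Y : Finset (Fin N)) (B : Op N), Disjoint Y Z → SupportedOn Y B → Commute B A

theorem SupportedOn.actsOn {X : Finset (Fin N)} {A : Op N} (hA : SupportedOn X A) : ActsOn X A :=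
  fun _ _ hd hB => hB.commute hA hd

theorem ActsOn.adL {X Z : Finset (Fin N)} {A B : Op N} (hA : SupportedOn X A) (hB : ActsOn Z B) :
    ActsOn (Z ∪ X) (adL A B) := by
  intro Y C hd hC
  rw [disjoint_union_right] at hd
  have h1 := hC.commute hA hd.2
  have h2 := hB Y C hd.1 hC
  exact (h1.mul_right h2).sub_right (h2.mul_right h1)

theorem ActsOn.adL_eq_zero {X Z : Finset (Fin N)} {A B : Op N} (hA : SupportedOn X A)
    (hB : ActsOn Z B) (h : Disjoint X Z) : LowEnergyTrotter.adL A B = 0 := by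
  rw [adL_apply, (hB X A h hA).eq, sub_self]

/-- The terms of a `k`-local Hamiltonian together with a scalar factor of norm at most `1`. -/
structure LocalGen (N k : ℕ) extends LocalHamiltonian N k where
  /-- the scalar factor -/
  coeff : ℂ
  norm_coeff_le : ‖coeff‖ ≤ 1

namespace LocalGen

/-- The operator, the scalar factor times the Hamiltonian. -/
def op (B : LocalGen N k) : Op N := B.coeff • B.toLocalHamiltonian.H

theorem seminorm_op_le (B : LocalGen N k) (f : Seminorm ℂ (Op N)) :
    f B.op ≤ ∑ X, f (B.term X) := by
  rw [op, map_smul_eq_mul, LocalHamiltonian.H]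
  exact (mul_le_of_le_one_left (apply_nonneg _ _) B.norm_coeff_le).trans (seminorm_sum_le f _ _)

/-- Only the terms that meet `Z` contribute to the commutator with an operator acting on `Z`. -/
theorem seminorm_adL_op_le (B : LocalGen N k) (f : Seminorm ℂ (Op N)) {Z : Finset (Fin N)}
    {A : Op N} (hA : ActsOn Z A) :
    f (adL B.op A) ≤ ∑ X with ¬ Disjoint X Z, f (adL (B.term X) A) := by
  have h1 : adL B.op A = B.coeff • ∑ X with ¬ Disjoint X Z, adL (B.term X) A := by
    rw [op, adL_smul, LocalHamiltonian.H]
    have h2 : adL (∑ X, B.term X) A = ∑ X, adL (B.term X) A := by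
      simp [sum_mul, mul_sum, sum_sub_distrib]
    rw [smul_apply, h2]
    congr 1
    symm
    refine sum_subset (filter_subset _ _) fun X _ hX => ?_
    refine hA.adL_eq_zero (B.supported X) ?_
    simpa using hX
  rw [h1, map_smul_eq_mul]
  exact (mul_le_of_le_one_left (apply_nonneg _ _) B.norm_coeff_le).trans (seminorm_sum_le f _ _)

end LocalGen

/-- The sum over the sets that meet `Z`, bounded by a sum over the sites of `Z`. -/
theorem sum_not_disjoint_le {a : Finset (Fin N) → ℝ} (ha : ∀ X, 0 ≤ a X) (Z : Finset (Fin N)) :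
    ∑ X with ¬ Disjoint X Z, a X ≤ ∑ i ∈ Z, ∑ X with i ∈ X, a X := by
  have h1 : ∀ i ∈ Z, ∑ X with i ∈ X, a X = ∑ X, if i ∈ X then a X else 0 :=
    fun i _ => sum_filter _ _
  rw [sum_congr rfl h1, sum_comm, sum_filter]
  refine sum_le_sum fun X _ => ?_
  have h0 : ∀ i ∈ Z, 0 ≤ if i ∈ X then a X else 0 := fun i _ => by split_ifs <;> simp [ha]
  by_cases h : Disjoint X Z
  · rw [if_neg (not_not.mpr h)]
    exact sum_nonneg h0
  · rw [if_pos h]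
    obtain ⟨i, hX, hZ⟩ := not_disjoint_iff.mp h
    refine le_trans ?_ (single_le_sum h0 hZ)
    rw [if_pos hX]

/-- The total over the sites of the sum over the sets containing the site. -/
theorem sum_sum_mem_eq (a : Finset (Fin N) → ℝ) :
    ∑ i : Fin N, ∑ X with i ∈ X, a X = ∑ X, (X.card : ℝ) * a X := by
  have h1 : ∀ i : Fin N, ∑ X with i ∈ X, a X = ∑ X, if i ∈ X then a X else 0 :=
    fun i => sum_filter _ _
  simp_rw [h1]
  rw [sum_comm]
  refine sum_congr rfl fun X _ => ?_
  rw [← sum_filter, sum_const, nsmul_eq_mul]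
  simp

end Locality

/-! ### Nested commutators of local terms -/

section NestedCommutators

variable {N k : ℕ}

/-- The extensiveness of a layer of Hamiltonians, taken together, is at most `g`. -/
def LayerExtensive (l : List (LocalGen N k)) (g : ℝ) : Prop :=
  ∀ i : Fin N, (l.map fun B => ∑ X with i ∈ X, ‖B.term X‖).sum ≤ g

/-- The operators of a list of layers. -/
abbrev layerOps (L : List (List (LocalGen N k))) : List (List (Op N)) :=
  L.map fun l => l.map LocalGen.op

theorem layer_sum_not_disjoint_le (l : List (LocalGen N k))
    {a : LocalGen N k → Finset (Fin N) → ℝ} (ha : ∀ B X, 0 ≤ a B X) (Z : Finset (Fin N)) :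
    (l.map fun B => ∑ X with ¬ Disjoint X Z, a B X).sum ≤
      ∑ i ∈ Z, (l.map fun B => ∑ X with i ∈ X, a B X).sum := by
  rw [← sum_list_map_comm]
  exact List.sum_le_sum fun B _ => sum_not_disjoint_le (ha B) Z

theorem LayerExtensive.sum_not_disjoint_le {l : List (LocalGen N k)} {g : ℝ}
    (hl : LayerExtensive l g) (Z : Finset (Fin N)) :
    (l.map fun B => ∑ X with ¬ Disjoint X Z, ‖B.term X‖).sum ≤ Z.card * g := by
  refine (layer_sum_not_disjoint_le l (fun B X => norm_nonneg (B.term X)) Z).trans ?_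
  refine (sum_le_sum fun i _ => hl i).trans_eq ?_
  rw [sum_const, nsmul_eq_mul]

theorem LayerExtensive.sum_nonempty_le {l : List (LocalGen N k)} {g : ℝ}
    (hl : LayerExtensive l g) :
    (l.map fun B => ∑ X, if X = ∅ then 0 else ‖B.term X‖).sum ≤ N * g := by
  have h1 : ∀ B : LocalGen N k, (∑ X, if X = ∅ then 0 else ‖B.term X‖) ≤
      ∑ i : Fin N, ∑ X with i ∈ X, ‖B.term X‖ := by
    intro B
    rw [sum_sum_mem_eq]
    refine sum_le_sum fun X _ => ?_
    split_ifs with h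
    · positivity
    · have : (1 : ℝ) ≤ X.card := by
        exact_mod_cast card_pos.mpr (nonempty_iff_ne_empty.mpr h)
      exact le_mul_of_one_le_left (norm_nonneg _) this
  refine (List.sum_le_sum fun B _ => h1 B).trans ?_
  rw [sum_list_map_comm]
  refine (sum_le_sum fun i _ => hl i).trans_eq ?_
  simp

theorem mul_succ_ascFactorial (s n : ℕ) :
    (s : ℝ) * ((s + 1).ascFactorial n : ℝ) = (s.ascFactorial (n + 1) : ℝ) := by
  rw [Nat.ascFactorial_succ, ← Nat.succ_ascFactorial]
  push_cast; rfl

theorem norm_adL_term_le (B : LocalGen N k) (X : Finset (Fin N)) (A : Op N) :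
    ‖adL (B.term X) A‖ ≤ ‖B.term X‖ * ‖A‖ :=
  norm_commutator_le (B.posSemidef X) A

/-- The terms on more than `k` sites vanish, so a commutator with a term enlarges the support by
at most `k` sites. -/
theorem card_union_le_of_term_ne_zero {B : LocalGen N k} {X Z : Finset (Fin N)} {s : ℕ}
    (hX : B.term X ≠ 0) (hZ : Z.card ≤ s * k) : (Z ∪ X).card ≤ (s + 1) * k := by
  have h1 : X.card ≤ k := by
    by_contra! h
    exact hX (B.isLocal X h)
  calc (Z ∪ X).card ≤ Z.card + X.card := card_union_le _ _
    _ ≤ s * k + k := add_le_add hZ h1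
    _ = (s + 1) * k := by ring

/-- Sums over nested commutators in the operator norm. Attaching a term to a cluster of `s` terms
can be done with total norm at most `s k g`. -/
theorem wordSum_le_of_forall_actsOn {f : Seminorm ℂ (Op N)} {V g : ℝ} (hg : 0 ≤ g)
    (hV : 0 ≤ V)
    (hf : ∀ (Z : Finset (Fin N)) (s : ℕ) (A : Op N), ActsOn Z A → Z.card ≤ s * k →
      f A ≤ V ^ s * ‖A‖)
    (L : List (List (LocalGen N k))) (hL : ∀ l ∈ L, LayerExtensive l g)
    (Z : Finset (Fin N)) (s : ℕ) (A : Op N) (hA : ActsOn Z A) (hZ : Z.card ≤ s * k) :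
    wordSum f (layerOps L) A ≤
      (k * g) ^ L.length * s.ascFactorial L.length * V ^ (s + L.length) * ‖A‖ := by
  induction L generalizing Z s A with
  | nil => simpa [wordSum] using hf Z s A hA hZ
  | cons l L ih =>
    have hl := hL l List.mem_cons_self
    replace ih := ih fun l' hl' => hL l' (List.mem_cons_of_mem _ hl')
    set n := L.length with hn
    set C : ℝ := (k * g) ^ n * (s + 1).ascFactorial n * V ^ (s + 1 + n) * ‖A‖ with hC
    have hC0 : 0 ≤ C := by positivity
    have h1 : ∀ B : LocalGen N k, wordSum f (layerOps L) (adL B.op A) ≤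
        (∑ X with ¬ Disjoint X Z, ‖B.term X‖) * C := by
      intro B
      refine (B.seminorm_adL_op_le _ hA).trans ?_
      rw [sum_mul]
      refine sum_le_sum fun X _ => ?_
      by_cases hX : B.term X = 0
      · rw [hX]; simp
      · refine (ih (Z ∪ X) (s + 1) _ (ActsOn.adL (B.supported X) hA)
          (card_union_le_of_term_ne_zero hX hZ)).trans ?_
        rw [hC, mul_left_comm]
        exact mul_le_mul_of_nonneg_left (norm_adL_term_le B X A) (by positivity)
    rw [layerOps, List.map_cons, wordSum_cons_apply, List.map_map]
    refine (List.sum_le_sum fun B _ => h1 B).trans ?_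
    rw [List.sum_map_mul_right]
    have h2 : (l.map fun B => ∑ X with ¬ Disjoint X Z, ‖B.term X‖).sum ≤ (s * k : ℝ) * g := by
      refine (hl.sum_not_disjoint_le Z).trans (mul_le_mul_of_nonneg_right ?_ hg)
      exact_mod_cast hZ
    refine (mul_le_mul_of_nonneg_right h2 hC0).trans_eq ?_
    rw [List.length_cons, ← hn, ← mul_succ_ascFactorial, hC, pow_succ, add_right_comm s 1 n,
      ← add_assoc]
    ring

/-- The version of `wordSum_le_of_forall_actsOn` that sums over the innermost operator as well. A
term on the empty set is a scalar and drops out of every commutator. -/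
theorem sum_wordSum_op_le {f : Seminorm ℂ (Op N)} {V g : ℝ} (hg : 0 ≤ g) (hV : 0 ≤ V)
    (hf : ∀ (Z : Finset (Fin N)) (s : ℕ) (A : Op N), ActsOn Z A → Z.card ≤ s * k →
      f A ≤ V ^ s * ‖A‖)
    (L : List (List (LocalGen N k))) (hL : ∀ l ∈ L, LayerExtensive l g) (hn : L.length ≠ 0)
    {l : List (LocalGen N k)} (hl : LayerExtensive l g) :
    (l.map fun B => wordSum f (layerOps L) B.op).sum ≤
      N * g * ((k * g) ^ L.length * L.length.factorial * V ^ (L.length + 1)) := by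
  have h1 : ∀ B : LocalGen N k, wordSum f (layerOps L) B.op ≤
      (∑ X, if X = ∅ then 0 else ‖B.term X‖) *
        ((k * g) ^ L.length * L.length.factorial * V ^ (L.length + 1)) := by
    intro B
    refine (B.seminorm_op_le _).trans ?_
    rw [sum_mul]
    refine sum_le_sum fun X _ => ?_
    split_ifs with hX
    · subst hX
      refine (wordSum_le_of_forall_actsOn hg hV hf L hL ∅ 0 _
        (B.supported ∅).actsOn (by simp)).trans_eq ?_
      obtain ⟨m, hm⟩ := Nat.exists_eq_succ_of_ne_zero hn
      rw [hm, Nat.zero_ascFactorial]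
      simp
    · by_cases hX0 : B.term X = 0
      · rw [hX0]; simp
      · refine (wordSum_le_of_forall_actsOn hg hV hf L hL X 1 _
          (B.supported X).actsOn ?_).trans_eq ?_
        · rw [one_mul]
          by_contra! h
          exact hX0 (B.isLocal X h)
        · rw [Nat.one_ascFactorial, add_comm 1]
          ring
  refine (List.sum_le_sum fun B _ => h1 B).trans ?_
  rw [List.sum_map_mul_right]
  exact mul_le_mul_of_nonneg_right hl.sum_nonempty_le (by positivity)

theorem mul_le_half_add {x y a b c d : ℝ} (hb : 0 ≤ b) (ha : 0 ≤ a)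
    (hc : 0 ≤ c) (hd : 0 ≤ d) (hx : x ^ 2 ≤ a * b) (hy : y ^ 2 ≤ c * d) :
    x * y ≤ (c * b + a * d) / 2 := by
  refine (le_abs_self _).trans (abs_le_of_sq_le_sq ?_ (by positivity))
  calc (x * y) ^ 2 = x ^ 2 * y ^ 2 := by ring
    _ ≤ (a * b) * (c * d) := mul_le_mul hx hy (sq_nonneg _) (by positivity)
    _ ≤ _ := by nlinarith [sq_nonneg (c * b - a * d)]

/-- The seminorm `A ↦ |⟨φ|A|ψ⟩|`. -/
def matrixElement (φ ψ : StateVec N) : Seminorm ℂ (Op N) :=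
  (normSeminorm ℂ ℂ).comp ((innerSL ℂ φ).toLinearMap ∘ₗ
    ((ContinuousLinearMap.apply ℂ (StateVec N) ψ).toLinearMap ∘ₗ
      (Matrix.toEuclideanCLM (𝕜 := ℂ) (n := Fin N → Fin 2)).toAlgEquiv.toLinearMap))

theorem matrixElement_apply (φ ψ : StateVec N) (A : Op N) :
    matrixElement φ ψ A = ‖inner ℂ φ (act A ψ)‖ := rfl

/-- The mean of the energies of the terms of a layer in the states `φ` and `ψ`. -/
def layerEnergy (φ ψ : StateVec N) (l : List (LocalGen N k)) : ℝ :=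
  (l.map fun B => ∑ X, (energy (B.term X) φ + energy (B.term X) ψ) / 2).sum

/-- The energies of a nested commutator of positive terms. Each of the monomials of the commutator
begins and ends with a term, so its matrix element is controlled by the energies of these two
terms. The numbers `ρ₁`, `ρ₂` are bounds for the sums of these energies over the monomials at the
left and right end, and `ν` bounds the number of the monomials, each counted with the product of
the norms. -/
structure EnergyBound (φ ψ : StateVec N) (A : Op N) (ν ρ₁ ρ₂ : ℝ) : Prop where
  nonneg_left : 0 ≤ ρ₁
  nonneg_right : 0 ≤ ρ₂
  norm_le : ‖A‖ ≤ ν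
  right_le : ‖act A ψ‖ ^ 2 ≤ ν * ρ₂
  left_le : ‖act (star A) φ‖ ^ 2 ≤ ν * ρ₁
  inner_le : ‖inner ℂ φ (act A ψ)‖ ≤ (ρ₁ + ρ₂) / 2

theorem EnergyBound.of_posSemidef {A : Op N} (hA : A.PosSemidef) (φ ψ : StateVec N) :
    EnergyBound φ ψ A ‖A‖ (energy A φ) (energy A ψ) where
  nonneg_left := energy_nonneg hA φ
  nonneg_right := energy_nonneg hA ψ
  norm_le := le_rfl
  right_le := norm_act_sq_le hA ψ
  left_le := by
    rw [Matrix.star_eq_conjTranspose, hA.isHermitian.eq]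
    exact norm_act_sq_le hA φ
  inner_le := norm_inner_act_le hA φ ψ

theorem act_adL_apply (h A : Op N) (ψ : StateVec N) :
    act (adL h A) ψ = act h (act A ψ) - act A (act h ψ) := by
  rw [← act_mul_apply, ← act_mul_apply]; simp [act]

theorem norm_act_adL_sq_le {h A : Op N} (hh : h.PosSemidef) {ψ : StateVec N} {ν ρ : ℝ}
    (hν : ‖A‖ ≤ ν) (hA : ‖act A ψ‖ ^ 2 ≤ ν * ρ) :
    ‖act (adL h A) ψ‖ ^ 2 ≤ (2 * ‖h‖ * ν) * (‖h‖ * ρ + ν * energy h ψ) := by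
  have hν0 : 0 ≤ ν := (norm_nonneg _).trans hν
  have h1 : ‖act h (act A ψ)‖ ≤ ‖h‖ * ‖act A ψ‖ := (act h).le_opNorm _
  have h2 : ‖act A (act h ψ)‖ ≤ ν * ‖act h ψ‖ :=
    ((act A).le_opNorm _).trans (mul_le_mul_of_nonneg_right hν (norm_nonneg _))
  have h3 := norm_act_sq_le hh ψ
  have h4 : ‖act (adL h A) ψ‖ ≤ ‖h‖ * ‖act A ψ‖ + ν * ‖act h ψ‖ := by
    rw [act_adL_apply]; exact (norm_sub_le _ _).trans (add_le_add h1 h2)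
  calc ‖act (adL h A) ψ‖ ^ 2 ≤ (‖h‖ * ‖act A ψ‖ + ν * ‖act h ψ‖) ^ 2 :=
        pow_le_pow_left₀ (norm_nonneg _) h4 2
    _ ≤ 2 * (‖h‖ ^ 2 * ‖act A ψ‖ ^ 2) + 2 * (ν ^ 2 * ‖act h ψ‖ ^ 2) := by
        nlinarith [sq_nonneg (‖h‖ * ‖act A ψ‖ - ν * ‖act h ψ‖)]
    _ ≤ 2 * (‖h‖ ^ 2 * (ν * ρ)) + 2 * (ν ^ 2 * (‖h‖ * energy h ψ)) := by gcongr
    _ = _ := by ring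

theorem EnergyBound.adL {φ ψ : StateVec N} {h A : Op N} {ν ρ₁ ρ₂ : ℝ} (hh : h.PosSemidef)
    (hA : EnergyBound φ ψ A ν ρ₁ ρ₂) :
    EnergyBound φ ψ (adL h A) (2 * ‖h‖ * ν) (‖h‖ * ρ₁ + ν * energy h φ)
      (‖h‖ * ρ₂ + ν * energy h ψ) := by
  have hν0 : 0 ≤ ν := (norm_nonneg _).trans hA.norm_le
  have h1 := energy_nonneg hh φ
  have h2 := energy_nonneg hh ψ
  have hρ₁ := hA.nonneg_left
  have hρ₂ := hA.nonneg_right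
  have hstar : star h = h := hh.isHermitian.eq
  refine ⟨by positivity, by positivity, ?_, norm_act_adL_sq_le hh hA.norm_le hA.right_le, ?_, ?_⟩
  · refine (norm_commutator_le hh A).trans ?_
    have := mul_le_mul_of_nonneg_left hA.norm_le (norm_nonneg h)
    have h3 : 0 ≤ ‖h‖ * ν := by positivity
    linarith
  · have e1 : star (LowEnergyTrotter.adL h A) = -LowEnergyTrotter.adL h (star A) := by
      rw [adL_apply, adL_apply, star_sub, star_mul, star_mul, hstar, neg_sub]
    have e2 : act (-LowEnergyTrotter.adL h (star A)) φ =
        -act (LowEnergyTrotter.adL h (star A)) φ := by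
      simp only [act, map_neg]; rfl
    rw [e1, e2, norm_neg]
    exact norm_act_adL_sq_le hh (by rw [norm_star]; exact hA.norm_le) hA.left_le
  · have e1 : inner ℂ φ (act (LowEnergyTrotter.adL h A) ψ) =
        inner ℂ (act h φ) (act A ψ) - inner ℂ (act (star A) φ) (act h ψ) := by
      rw [inner_act_left, inner_act_left, hstar, star_star, act_adL_apply, inner_sub_right]
    rw [e1]
    refine (norm_sub_le _ _).trans ?_
    have h3 : ‖inner ℂ (act h φ) (act A ψ)‖ ≤ (ν * energy h φ + ‖h‖ * ρ₂) / 2 :=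
      (norm_inner_le_norm _ _).trans
        (mul_le_half_add h1 (norm_nonneg _) hν0 hρ₂ (norm_act_sq_le hh φ) hA.right_le)
    have h4 : ‖inner ℂ (act (star A) φ) (act h ψ)‖ ≤ (ν * energy h ψ + ‖h‖ * ρ₁) / 2 := by
      refine (norm_inner_le_norm _ _).trans ?_
      rw [mul_comm]
      exact mul_le_half_add h2 (norm_nonneg _) hν0 hρ₁ (norm_act_sq_le hh ψ) hA.left_le
    linarith

/-- The sum over the nested commutators with a fixed innermost operator, in a matrix element. It
splits into the contribution `ρ₁ + ρ₂` of the energies of this operator and into a sum over its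
sites of weights `β` that collect the energies of the outer terms. -/
theorem exists_wordSum_matrixElement_le (φ ψ : StateVec N) {g e : ℝ} (hg : 0 ≤ g)
    (L : List (List (LocalGen N k)))
    (hL : ∀ l ∈ L, LayerExtensive l g ∧ layerEnergy φ ψ l ≤ e) (s : ℕ) :
    ∃ β : Fin N → ℝ, (∀ i, 0 ≤ β i) ∧
      s * g * ∑ i, β i ≤
        (2 ^ L.length - 1) * ((k * g) ^ L.length * s.ascFactorial L.length) * e ∧
      ∀ (Z : Finset (Fin N)) (A : Op N) (ν ρ₁ ρ₂ : ℝ), ActsOn Z A → Z.card ≤ s * k →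
        EnergyBound φ ψ A ν ρ₁ ρ₂ →
        wordSum (matrixElement φ ψ) (layerOps L) A ≤
          (k * g) ^ L.length * s.ascFactorial L.length * ((ρ₁ + ρ₂) / 2) + ν * ∑ i ∈ Z, β i := by
  induction L generalizing s with
  | nil =>
    refine ⟨0, fun _ => le_rfl, by simp, fun Z A ν ρ₁ ρ₂ _ _ hb => ?_⟩
    simpa [wordSum, matrixElement_apply] using hb.inner_le
  | cons l L ih =>
    obtain ⟨hl, hle⟩ := hL l List.mem_cons_self
    obtain ⟨β, hβ0, hβ, hword⟩ := ih (fun l' hl' => hL l' (List.mem_cons_of_mem _ hl')) (s + 1)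
    set n := L.length with hn
    set c : ℝ := (k * g) ^ n * (s + 1).ascFactorial n with hc
    have hc0 : 0 ≤ c := by positivity
    let en : LocalGen N k → Finset (Fin N) → ℝ := fun B X =>
      (energy (B.term X) φ + energy (B.term X) ψ) / 2
    have hen : ∀ B X, 0 ≤ en B X := fun B X => by
      have := energy_nonneg (B.posSemidef X) φ
      have := energy_nonneg (B.posSemidef X) ψ
      positivity
    let w : LocalGen N k → Finset (Fin N) → ℝ := fun B X => ‖B.term X‖ * ∑ j ∈ X, β j
    have hw : ∀ B X, 0 ≤ w B X := fun B X =>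
      mul_nonneg (norm_nonneg _) (sum_nonneg fun j _ => hβ0 j)
    let P : Fin N → ℝ := fun i => (l.map fun B => ∑ X with i ∈ X, en B X).sum
    let R : Fin N → ℝ := fun i => (l.map fun B => ∑ X with i ∈ X, w B X).sum
    have hP0 : ∀ i, 0 ≤ P i := fun i => List.sum_nonneg (by
      simp only [List.mem_map]; rintro _ ⟨B, _, rfl⟩; exact sum_nonneg fun X _ => hen B X)
    have hR0 : ∀ i, 0 ≤ R i := fun i => List.sum_nonneg (by
      simp only [List.mem_map]; rintro _ ⟨B, _, rfl⟩; exact sum_nonneg fun X _ => hw B X)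
    have hcard : ∀ (B : LocalGen N k) (X : Finset (Fin N)) (x : ℝ), (B.term X = 0 → x = 0) →
        0 ≤ x → (X.card : ℝ) * x ≤ k * x := by
      intro B X x hx hx0
      by_cases hX : B.term X = 0
      · rw [hx hX]; simp
      · refine mul_le_mul_of_nonneg_right ?_ hx0
        have : X.card ≤ k := by
          by_contra! h
          exact hX (B.isLocal X h)
        exact_mod_cast this
    have hPsum : ∑ i, P i ≤ k * e := by
      have h1 : ∑ i, P i = (l.map fun B => ∑ i, ∑ X with i ∈ X, en B X).sum :=
        (sum_list_map_comm _ _ _).symm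
      rw [h1]
      have h2 : ∀ B : LocalGen N k, ∑ i, ∑ X with i ∈ X, en B X ≤ k * ∑ X, en B X := by
        intro B
        rw [sum_sum_mem_eq, mul_sum]
        exact sum_le_sum fun X _ => hcard B X _ (fun h => by simp [en, h, energy, act]) (hen B X)
      refine (List.sum_le_sum fun B _ => h2 B).trans ?_
      rw [List.sum_map_mul_left]
      exact mul_le_mul_of_nonneg_left hle (Nat.cast_nonneg k)
    have hRsum : ∑ i, R i ≤ k * g * ∑ i, β i := by
      have h1 : ∑ i, R i = (l.map fun B => ∑ i, ∑ X with i ∈ X, w B X).sum :=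
        (sum_list_map_comm _ _ _).symm
      rw [h1]
      have h2 : ∀ B : LocalGen N k, ∑ i, ∑ X with i ∈ X, w B X ≤
          k * ∑ i, (∑ X with i ∈ X, ‖B.term X‖) * β i := by
        intro B
        have h3 : ∑ i, (∑ X with i ∈ X, ‖B.term X‖) * β i = ∑ X, w B X := by
          have : ∀ i, (∑ X with i ∈ X, ‖B.term X‖) * β i =
              ∑ X, if i ∈ X then ‖B.term X‖ * β i else 0 := fun i => by
            rw [sum_filter, sum_mul]
            exact sum_congr rfl fun X _ => by split_ifs <;> simp
          simp_rw [this]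
          rw [sum_comm]
          refine sum_congr rfl fun X _ => ?_
          simp only [w]
          rw [mul_sum, ← sum_filter]
          simp
        rw [sum_sum_mem_eq, h3, mul_sum]
        exact sum_le_sum fun X _ => hcard B X _ (fun h => by simp [w, h]) (hw B X)
      refine (List.sum_le_sum fun B _ => h2 B).trans ?_
      rw [List.sum_map_mul_left, mul_assoc]
      refine mul_le_mul_of_nonneg_left ?_ (Nat.cast_nonneg k)
      rw [sum_list_map_comm, mul_sum]
      refine sum_le_sum fun i _ => ?_
      rw [List.sum_map_mul_right]
      exact mul_le_mul_of_nonneg_right (hl i) (hβ0 i)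
    -- `P i` is the energy and `R i` the weight of the terms at `i` that the next commutator can
    -- attach; the factor `2` in the first and the last part is the number of monomials `h A`, `A h`
    -- that a commutator makes out of `A`
    refine ⟨fun i => 2 * (s * (k * g)) * β i + c * P i + 2 * R i, fun i => ?_, ?_, ?_⟩
    · have := hβ0 i; have := hP0 i; have := hR0 i
      positivity
    · simp only [sum_add_distrib, ← mul_sum]
      have hsg : 0 ≤ (s : ℝ) * g := by positivity
      calc (s : ℝ) * g * (2 * (s * (k * g)) * ∑ i, β i + c * ∑ i, P i + 2 * ∑ i, R i)
          ≤ s * g * (2 * (s * (k * g)) * ∑ i, β i + c * (k * e) + 2 * (k * g * ∑ i, β i)) := by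
            gcongr
        _ = 2 * s * (k * g) * ((s + 1 : ℕ) * g * ∑ i, β i) + s * c * (k * g) * e := by
            push_cast; ring
        _ ≤ 2 * s * (k * g) * ((2 ^ n - 1) * c * e) + s * c * (k * g) * e := by
            gcongr
        _ = (2 ^ (n + 1) - 1) * ((k * g) * (k * g) ^ n * (s * (s + 1).ascFactorial n)) * e := by
            rw [hc]; ring
        _ = _ := by rw [mul_succ_ascFactorial, List.length_cons, ← hn, pow_succ' (k * g : ℝ)]
    · intro Z A ν ρ₁ ρ₂ hA hZ hb
      have hν0 : 0 ≤ ν := (norm_nonneg _).trans hb.norm_le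
      have hρ : 0 ≤ (ρ₁ + ρ₂) / 2 := by
        have := hb.nonneg_left; have := hb.nonneg_right; positivity
      have hβZ : 0 ≤ ∑ i ∈ Z, β i := sum_nonneg fun i _ => hβ0 i
      have h1 : ∀ B : LocalGen N k,
          wordSum (matrixElement φ ψ) (layerOps L) (adL B.op A) ≤
          (∑ X with ¬ Disjoint X Z, ‖B.term X‖) * (c * ((ρ₁ + ρ₂) / 2) + 2 * ν * ∑ i ∈ Z, β i) +
            ((∑ X with ¬ Disjoint X Z, en B X) * (ν * c) +
              (∑ X with ¬ Disjoint X Z, w B X) * (2 * ν)) := by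
        intro B
        refine (B.seminorm_adL_op_le _ hA).trans ?_
        simp only [sum_mul, ← sum_add_distrib]
        refine sum_le_sum fun X _ => ?_
        by_cases hX : B.term X = 0
        · have h2 := hen B X
          have h3 := hw B X
          rw [hX]
          simp only [norm_zero, zero_mul, zero_add]
          refine le_trans (by simp) (add_nonneg (mul_nonneg h2 (mul_nonneg hν0 hc0))
            (mul_nonneg h3 (mul_nonneg two_pos.le hν0)))
        · refine (hword (Z ∪ X) _ _ _ _ (ActsOn.adL (B.supported X) hA)
            (card_union_le_of_term_ne_zero hX hZ) (hb.adL (B.posSemidef X))).trans ?_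
          have h2 : ∑ i ∈ Z ∪ X, β i ≤ ∑ i ∈ Z, β i + ∑ i ∈ X, β i := by
            rw [← sum_union_inter]
            exact le_add_of_nonneg_right (sum_nonneg fun i _ => hβ0 i)
          have h3 : 0 ≤ 2 * ‖B.term X‖ * ν := by positivity
          refine (add_le_add_right (mul_le_mul_of_nonneg_left h2 h3) _).trans_eq ?_
          simp only [en, w, hc]
          ring
      rw [layerOps, List.map_cons, wordSum_cons_apply, List.map_map]
      refine (List.sum_le_sum fun B _ => h1 B).trans ?_
      rw [List.sum_map_add, List.sum_map_add, List.sum_map_mul_right, List.sum_map_mul_right,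
        List.sum_map_mul_right]
      have h2 : (l.map fun B => ∑ X with ¬ Disjoint X Z, ‖B.term X‖).sum ≤ (s * k : ℝ) * g := by
        refine (hl.sum_not_disjoint_le Z).trans (mul_le_mul_of_nonneg_right ?_ hg)
        exact_mod_cast hZ
      have h3 := layer_sum_not_disjoint_le l hen Z
      have h4 := layer_sum_not_disjoint_le l hw Z
      calc _ ≤ (s * k : ℝ) * g * (c * ((ρ₁ + ρ₂) / 2) + 2 * ν * ∑ i ∈ Z, β i) +
            ((∑ i ∈ Z, P i) * (ν * c) + (∑ i ∈ Z, R i) * (2 * ν)) := by gcongr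
        _ = (k * g) * (k * g) ^ n * (s * (s + 1).ascFactorial n) * ((ρ₁ + ρ₂) / 2) +
            ν * ∑ i ∈ Z, (2 * (s * (k * g)) * β i + c * P i + 2 * R i) := by
            simp only [sum_add_distrib, ← mul_sum]
            rw [hc]; ring
        _ = _ := by rw [mul_succ_ascFactorial, List.length_cons, ← hn, pow_succ' (k * g : ℝ)]

/-- Sums over nested commutators in a matrix element, bounded by the energy instead of by the
number of sites. -/
theorem sum_wordSum_matrixElement_le (φ ψ : StateVec N) {g e : ℝ} (hg : 0 ≤ g)
    (L : List (List (LocalGen N k)))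
    (hL : ∀ l ∈ L, LayerExtensive l g ∧ layerEnergy φ ψ l ≤ e) {l : List (LocalGen N k)}
    (hl : LayerExtensive l g ∧ layerEnergy φ ψ l ≤ e) :
    (l.map fun B => wordSum (matrixElement φ ψ) (layerOps L) B.op).sum ≤
      2 ^ L.length * (k * g) ^ L.length * L.length.factorial * e := by
  obtain ⟨β, hβ0, hβ, hword⟩ := exists_wordSum_matrixElement_le φ ψ hg L hL 1
  rw [Nat.cast_one, one_mul, Nat.one_ascFactorial] at hβ
  rw [Nat.one_ascFactorial] at hword
  set C : ℝ := (k * g) ^ L.length * L.length.factorial with hC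
  have h1 : ∀ B : LocalGen N k, wordSum (matrixElement φ ψ) (layerOps L) B.op ≤
      C * (∑ X, (energy (B.term X) φ + energy (B.term X) ψ) / 2) +
        ∑ i, (∑ X with i ∈ X, ‖B.term X‖) * β i := by
    intro B
    refine (B.seminorm_op_le _).trans ?_
    have h2 : ∑ i, (∑ X with i ∈ X, ‖B.term X‖) * β i = ∑ X, ‖B.term X‖ * ∑ j ∈ X, β j := by
      have : ∀ i, (∑ X with i ∈ X, ‖B.term X‖) * β i =
          ∑ X, if i ∈ X then ‖B.term X‖ * β i else 0 := fun i => by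
        rw [sum_filter, sum_mul]
        exact sum_congr rfl fun X _ => by split_ifs <;> simp
      simp_rw [this]
      rw [sum_comm]
      refine sum_congr rfl fun X _ => ?_
      rw [mul_sum, ← sum_filter]
      simp
    rw [h2, mul_sum, ← sum_add_distrib]
    refine sum_le_sum fun X _ => ?_
    by_cases hX : B.term X = 0
    · rw [hX]; simp [energy, act]
    · refine hword X _ _ _ _ (B.supported X).actsOn ?_
        (EnergyBound.of_posSemidef (B.posSemidef X) φ ψ)
      rw [one_mul]
      by_contra! h
      exact hX (B.isLocal X h)
  refine (List.sum_le_sum fun B _ => h1 B).trans ?_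
  rw [List.sum_map_add, List.sum_map_mul_left]
  have h3 : (l.map fun B => ∑ i, (∑ X with i ∈ X, ‖B.term X‖) * β i).sum ≤ g * ∑ i, β i := by
    rw [sum_list_map_comm]
    rw [mul_sum]
    refine sum_le_sum fun i _ => ?_
    rw [List.sum_map_mul_right]
    exact mul_le_mul_of_nonneg_right (hl.1 i) (hβ0 i)
  have h4 : C * layerEnergy φ ψ l ≤ C * e := mul_le_mul_of_nonneg_left hl.2 (by positivity)
  calc _ ≤ C * e + (2 ^ L.length - 1) * C * e := add_le_add h4 (h3.trans hβ)
    _ = _ := by rw [hC]; ring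

end NestedCommutators

/-! ### Groups of commuting terms -/

section SiteWeights

variable {N k : ℕ}

theorem adL_commute {𝔸 : Type*} [NormedRing 𝔸] [NormedAlgebra ℂ 𝔸] {A B : 𝔸}
    (h : Commute A B) : Commute (adL A) (adL B) := by
  ext C
  simp only [mul_apply_eq, adL_apply]
  have h1 : A * (B * C) = B * (A * C) := by rw [← mul_assoc, h.eq, mul_assoc]
  have h2 : C * B * A = C * A * B := by rw [mul_assoc, ← h.eq, mul_assoc]
  simp only [mul_sub, sub_mul, h1, h2, ← mul_assoc]
  abel

theorem adL_sum {𝔸 ι : Type*} [NormedRing 𝔸] [NormedAlgebra ℂ 𝔸] (s : Finset ι) (A : ι → 𝔸) :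
    adL (∑ i ∈ s, A i) = ∑ i ∈ s, adL (A i) := by
  ext C
  simp [sum_mul, mul_sum, sum_sub_distrib]

theorem add_pow_apply_of_commute {E : Type*} [NormedAddCommGroup E] [NormedSpace ℂ E]
    {D D' : E →L[ℂ] E} (h : Commute D D') {x : E} (hx : D' x = 0) (j : ℕ) :
    ((D + D') ^ j) x = (D ^ j) x := by
  induction j with
  | zero => rfl
  | succ j ih =>
    have h1 : D' ((D ^ j) x) = 0 := by
      rw [← mul_apply_eq, ← (h.pow_left j).eq, mul_apply_eq, hx, map_zero]
    rw [pow_succ', mul_apply_eq, ih, add_apply, h1, add_zero, ← mul_apply_eq,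
      ← pow_succ']

/-- The generators with central elements added: only the zeroth Taylor coefficient changes. -/
theorem exists_genCoeff_eq_add_central {ι 𝔸 : Type*} [NormedRing 𝔸] [NormedAlgebra ℂ 𝔸]
    {u v : ι → 𝔸} (h : ∀ i C, Commute (u i - v i) C) (l : List ι) :
    ∃ z : 𝔸, (∀ C, Commute z C) ∧ ∀ n, genCoeff (l.map u) n =
      genCoeff (l.map v) n + if n = 0 then z else 0 := by
  induction l with
  | nil => exact ⟨0, fun C => Commute.zero_left C, fun n => by simp [genCoeff]⟩
  | cons B l ih =>
    obtain ⟨z, hz, hl⟩ := ih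
    refine ⟨u B - v B + z, fun C => (h B C).add_left (hz C), fun n => ?_⟩
    have had : adL (u B) = adL (v B) := by
      ext C
      have := (h B C).eq
      rw [sub_mul, mul_sub] at this
      rw [adL_apply, adL_apply, sub_eq_sub_iff_sub_eq_sub, this]
    have hzero : ∀ j, j ≠ 0 → (adL (v B) ^ j) z = 0 := by
      intro j hj
      obtain ⟨m, rfl⟩ := Nat.exists_eq_succ_of_ne_zero hj
      rw [pow_succ, mul_apply_eq, adL_apply, (hz _).eq, sub_self, map_zero]
    simp only [List.map_cons, genCoeff, had, hl]
    simp only [map_add, smul_add, sum_add_distrib]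
    have hsum : ∑ ij ∈ antidiagonal n, (ij.1.factorial : ℂ)⁻¹ •
        (adL (v B) ^ ij.1) (if ij.2 = 0 then z else 0) = if n = 0 then z else 0 := by
      by_cases hn : n = 0
      · subst hn; simp
      · rw [if_neg hn]
        refine sum_eq_zero fun ij hij => ?_
        split_ifs with h2
        · rw [hzero ij.1, smul_zero]
          have := mem_antidiagonal.mp hij
          omega
        · rw [map_zero, smul_zero]
    rw [hsum]
    split_ifs <;> abel

/-- Nested commutators with a family of positive terms, in a seminorm that grows exponentially
with the weights of the sites an operator acts on. -/
theorem seminorm_sum_adL_pow_le (B : LocalGen N k) {f : Seminorm ℂ (Op N)} {a : Fin N → ℝ}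
    (ha : ∀ i, 0 ≤ a i)
    (hf : ∀ Z A, ActsOn Z A → f A ≤ ‖A‖ * Real.exp (∑ i ∈ Z, a i))
    (𝒳 : Finset (Finset (Fin N))) (j : ℕ) {Z : Finset (Fin N)} {A : Op N} (hA : ActsOn Z A) :
    f (((∑ X ∈ 𝒳, adL (B.term X)) ^ j) A) ≤
      (∑ X ∈ 𝒳, ‖B.term X‖ * Real.exp (∑ i ∈ X, a i)) ^ j *
        (‖A‖ * Real.exp (∑ i ∈ Z, a i)) := by
  induction j generalizing Z A with
  | zero => simpa using hf Z A hA
  | succ j ih =>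
    set σ := ∑ X ∈ 𝒳, ‖B.term X‖ * Real.exp (∑ i ∈ X, a i) with hσ
    have hσ0 : 0 ≤ σ := sum_nonneg fun X _ => by positivity
    rw [pow_succ, mul_apply_eq, _root_.sum_apply, map_sum]
    refine (seminorm_sum_le f _ _).trans ?_
    rw [pow_succ, mul_assoc, hσ, sum_mul, mul_sum]
    refine sum_le_sum fun X _ => ?_
    refine (ih (ActsOn.adL (B.supported X) hA)).trans ?_
    rw [← hσ]
    refine mul_le_mul_of_nonneg_left ?_ (by positivity)
    have h1 : ∑ i ∈ Z ∪ X, a i ≤ ∑ i ∈ Z, a i + ∑ i ∈ X, a i := by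
      rw [← sum_union_inter]
      exact le_add_of_nonneg_right (sum_nonneg fun i _ => ha i)
    calc _ ≤ (‖B.term X‖ * ‖A‖) * (Real.exp (∑ i ∈ Z, a i) * Real.exp (∑ i ∈ X, a i)) := by
          rw [← Real.exp_add]
          gcongr
          exact norm_adL_term_le B X A
      _ = _ := by ring

theorem norm_term_mul_exp_le (B : LocalGen N k) {a : Fin N → ℝ} (hak : ∀ i, k * a i ≤ 1)
    (X : Finset (Fin N)) :
    ‖B.term X‖ * Real.exp (∑ i ∈ X, a i) ≤ Real.exp 1 * ‖B.term X‖ := by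
  by_cases hX : B.term X = 0
  · rw [hX]; simp
  · rw [mul_comm]
    refine mul_le_mul_of_nonneg_right (Real.exp_le_exp.mpr ?_) (norm_nonneg _)
    have hXk : X.card ≤ k := by
      by_contra! h
      exact hX (B.isLocal X h)
    rcases Nat.eq_zero_or_pos k with hk | hk
    · have : X = ∅ := by rw [← card_eq_zero]; omega
      simp [this]
    have hk' : (0 : ℝ) < k := by exact_mod_cast hk
    have h4 : ∑ i ∈ X, a i ≤ X.card * (1 / k : ℝ) := by
      rw [← nsmul_eq_mul]
      exact sum_le_card_nsmul _ _ _ fun i _ => (le_div_iff₀' hk').mpr (hak i)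
    refine h4.trans ?_
    rw [mul_one_div, div_le_one hk']
    exact_mod_cast hXk

/-- If the terms of `B` commute, all the nested commutators `ad_B^j A` only involve the terms that
meet the set on which `A` acts. -/
theorem seminorm_adL_op_pow_le (B : LocalGen N k)
    (hB : ∀ X Y, Commute (B.term X) (B.term Y)) {f : Seminorm ℂ (Op N)} {a : Fin N → ℝ}
    (ha : ∀ i, 0 ≤ a i) (hak : ∀ i, k * a i ≤ 1)
    (hf : ∀ Z A, ActsOn Z A → f A ≤ ‖A‖ * Real.exp (∑ i ∈ Z, a i)) (j : ℕ)
    {Z : Finset (Fin N)} {A : Op N} (hA : ActsOn Z A) :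
    f ((adL B.op ^ j) A) ≤
      (Real.exp 1 * ∑ i ∈ Z, ∑ X with i ∈ X, ‖B.term X‖) ^ j *
        (‖A‖ * Real.exp (∑ i ∈ Z, a i)) := by
  have h1 : adL B.op = B.coeff • ((∑ X with ¬ Disjoint X Z, adL (B.term X)) +
      ∑ X with ¬ ¬ Disjoint X Z, adL (B.term X)) := by
    rw [LocalGen.op, adL_smul, LocalHamiltonian.H, adL_sum, sum_filter_add_sum_filter_not]
  have h2 : ((adL B.op) ^ j) A =
      B.coeff ^ j • ((∑ X with ¬ Disjoint X Z, adL (B.term X)) ^ j) A := by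
    rw [h1, smul_pow_apply, add_pow_apply_of_commute]
    · exact Commute.sum_left _ _ _ fun X _ => Commute.sum_right _ _ _ fun Y _ =>
        adL_commute (hB X Y)
    · rw [_root_.sum_apply]
      refine sum_eq_zero fun X hX => hA.adL_eq_zero (B.supported X) ?_
      simpa using hX
  rw [h2, map_smul_eq_mul, norm_pow]
  refine (mul_le_of_le_one_left (apply_nonneg _ _)
    (pow_le_one₀ (norm_nonneg _) B.norm_coeff_le)).trans ?_
  refine (seminorm_sum_adL_pow_le B ha hf _ j hA).trans ?_
  refine mul_le_mul_of_nonneg_right (pow_le_pow_left₀ (sum_nonneg fun X _ => by positivity) ?_ j)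
    (by positivity)
  refine (sum_le_sum fun X _ => norm_term_mul_exp_le B hak X).trans ?_
  rw [← mul_sum]
  exact mul_le_mul_of_nonneg_left (sum_not_disjoint_le (fun X => norm_nonneg _) Z)
    (Real.exp_pos 1).le

/-- The seminorm `A ↦ ∑_{j < M} τ^j / j! f(ad_B^j A)`. -/
def adSeries (f : Seminorm ℂ (Op N)) (B : Op N) (τ : ℝ) (M : ℕ) : Seminorm ℂ (Op N) :=
  ∑ j ∈ range M, f.comp (((τ ^ j / j.factorial : ℝ) : ℂ) • adL B ^ j).toLinearMap

theorem adSeries_apply (f : Seminorm ℂ (Op N)) (B : Op N) {τ : ℝ} (hτ : 0 ≤ τ) (M : ℕ)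
    (A : Op N) :
    adSeries f B τ M A = ∑ j ∈ range M, τ ^ j / j.factorial * f ((adL B ^ j) A) := by
  have h1 : ∀ s : Finset ℕ, (∑ j ∈ s, f.comp
      (((τ ^ j / j.factorial : ℝ) : ℂ) • adL B ^ j).toLinearMap) A =
      ∑ j ∈ s, f.comp (((τ ^ j / j.factorial : ℝ) : ℂ) • adL B ^ j).toLinearMap A := by
    intro s
    induction s using Finset.induction_on with
    | empty => rfl
    | insert j s hj ih => rw [sum_insert hj, sum_insert hj, _root_.add_apply, ih]
  rw [adSeries, h1]
  refine sum_congr rfl fun j _ => ?_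
  change f (((τ ^ j / j.factorial : ℝ) : ℂ) • (adL B ^ j) A) = _
  rw [map_smul_eq_mul, Complex.norm_real, Real.norm_of_nonneg (by positivity)]

theorem sum_pow_mul_genCoeff_cons_le (f : Seminorm ℂ (Op N)) (B : Op N) (l : List (Op N))
    {τ : ℝ} (hτ : 0 ≤ τ) (M : ℕ) :
    ∑ n ∈ range M, τ ^ n * f (genCoeff (B :: l) n) ≤
      f B + ∑ r ∈ range M, τ ^ r * adSeries f B τ M (genCoeff l r) := by
  let T : ℕ × ℕ → ℝ := fun ij =>
    τ ^ ij.2 * (τ ^ ij.1 / ij.1.factorial * f ((adL B ^ ij.1) (genCoeff l ij.2)))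
  have hT : ∀ ij, 0 ≤ T ij := fun ij => by
    have := apply_nonneg f ((adL B ^ ij.1) (genCoeff l ij.2))
    positivity
  have h1 : ∀ n, τ ^ n * f (genCoeff (B :: l) n) ≤
      (if n = 0 then f B else 0) + ∑ ij ∈ antidiagonal n, T ij := by
    intro n
    refine (mul_le_mul_of_nonneg_left (seminorm_genCoeff_cons_le f B l n)
      (by positivity)).trans_eq ?_
    rw [mul_add, mul_sum]
    congr 1
    · split_ifs with h
      · rw [h, pow_zero, one_mul]
      · rw [mul_zero]
    · refine sum_congr rfl fun ij hij => ?_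
      simp only [T]
      rw [wordSum_replicate_singleton, ← mem_antidiagonal.mp hij, pow_add]
      ring
  refine (sum_le_sum fun n _ => h1 n).trans ?_
  rw [sum_add_distrib]
  refine add_le_add ?_ ?_
  · rw [sum_ite_eq']
    split_ifs
    · rfl
    · exact apply_nonneg _ _
  · have h2 : ∑ r ∈ range M, τ ^ r * adSeries f B τ M (genCoeff l r) =
        ∑ ij ∈ range M ×ˢ range M, T ij := by
      rw [sum_product_right]
      refine sum_congr rfl fun r _ => ?_
      rw [adSeries_apply f B hτ, mul_sum]
    rw [h2, ← sum_biUnion (fun m _ n _ hmn => disjoint_left.mpr fun ij hm hn =>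
      hmn ((mem_antidiagonal.mp hm).symm.trans (mem_antidiagonal.mp hn)))]
    refine sum_le_sum_of_subset_of_nonneg (fun ij hij => ?_) fun ij _ _ => hT ij
    obtain ⟨n, hn, hij⟩ := mem_biUnion.mp hij
    have := mem_antidiagonal.mp hij
    have := mem_range.mp hn
    rw [mem_product, mem_range, mem_range]
    omega

/-- The Taylor coefficients of the generator for groups of commuting terms. Each of the
exponentials multiplies the weight of a site by a factor that is controlled by the terms of the
group at this site, so that the number of the exponentials does not matter. -/
theorem sum_pow_mul_genCoeff_le {τ : ℝ} (hτ : 0 ≤ τ) (M : ℕ) (l : List (LocalGen N k))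
    (hl : ∀ B ∈ l, ∀ X Y, Commute (B.term X) (B.term Y)) (f : Seminorm ℂ (Op N))
    (a : Fin N → ℝ) (ha : ∀ i, 0 ≤ a i)
    (hf : ∀ Z A, ActsOn Z A → f A ≤ ‖A‖ * Real.exp (∑ i ∈ Z, a i))
    (hsmall : ∀ i, k * (a i + τ * (Real.exp 1 *
      (l.map fun B => ∑ X with i ∈ X, ‖B.term X‖).sum)) ≤ 1) :
    ∑ n ∈ range M, τ ^ n * f (genCoeff (l.map LocalGen.op) n) ≤
      Real.exp 1 * (l.map fun B => ∑ X, ‖B.term X‖).sum := by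
  induction l generalizing f a with
  | nil => simp [genCoeff]
  | cons B l ih =>
    have hdens : ∀ (B : LocalGen N k) i, 0 ≤ ∑ X with i ∈ X, ‖B.term X‖ :=
      fun B i => sum_nonneg fun X _ => norm_nonneg _
    have hlsum : ∀ i, 0 ≤ (l.map fun B => ∑ X with i ∈ X, ‖B.term X‖).sum := fun i =>
      List.sum_nonneg (by simp only [List.mem_map]; rintro _ ⟨C, _, rfl⟩; exact hdens C i)
    have hak : ∀ i, k * a i ≤ 1 := by
      intro i
      refine le_trans (mul_le_mul_of_nonneg_left ?_ (Nat.cast_nonneg k)) (hsmall i)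
      rw [List.map_cons, List.sum_cons]
      have := hdens B i; have := hlsum i
      exact le_add_of_nonneg_right (by positivity)
    have hroot : f B.op ≤ Real.exp 1 * ∑ X, ‖B.term X‖ := by
      refine (B.seminorm_op_le f).trans ?_
      rw [mul_sum]
      refine sum_le_sum fun X _ => le_trans ?_ (norm_term_mul_exp_le B hak X)
      exact hf X _ (B.supported X).actsOn
    have hstep := ih (fun C hC => hl C (List.mem_cons_of_mem _ hC)) (adSeries f B.op τ M)
      (fun i => a i + τ * (Real.exp 1 * ∑ X with i ∈ X, ‖B.term X‖))
      (fun i => by have := ha i; have := hdens B i; positivity) ?_ ?_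
    · refine (sum_pow_mul_genCoeff_cons_le f B.op (l.map LocalGen.op) hτ M).trans ?_
      rw [List.map_cons, List.sum_cons, mul_add]
      exact add_le_add hroot hstep
    · intro Z A hA
      rw [adSeries_apply _ _ hτ]
      set σ := Real.exp 1 * ∑ i ∈ Z, ∑ X with i ∈ X, ‖B.term X‖ with hσ
      have hσ0 : 0 ≤ σ := mul_nonneg (Real.exp_pos 1).le (sum_nonneg fun i _ => hdens B i)
      have h1 : ∀ j, τ ^ j / j.factorial * f ((adL B.op ^ j) A) ≤
          (τ * σ) ^ j / j.factorial * (‖A‖ * Real.exp (∑ i ∈ Z, a i)) := by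
        intro j
        refine (mul_le_mul_of_nonneg_left (seminorm_adL_op_pow_le B
          (hl B List.mem_cons_self) ha hak hf j hA) (by positivity)).trans_eq ?_
        rw [mul_pow]; ring
      refine (sum_le_sum fun j _ => h1 j).trans ?_
      rw [← sum_mul]
      refine (mul_le_mul_of_nonneg_right (Real.sum_le_exp_of_nonneg (by positivity) M)
        (by positivity)).trans_eq ?_
      rw [sum_add_distrib, ← mul_sum, ← mul_sum, ← hσ, Real.exp_add]
      ring
    · intro i
      have := hsmall i
      rw [List.map_cons, List.sum_cons] at this
      refine le_trans (le_of_eq ?_) this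
      ring

/-- The Hamiltonian without its constant term. -/
def LocalGen.eraseEmpty (B : LocalGen N k) : LocalGen N k where
  term X := if X = ∅ then 0 else B.term X
  posSemidef X := by
    split_ifs
    · exact Matrix.PosSemidef.zero
    · exact B.posSemidef X
  supported X := by
    split_ifs with h
    · exact ⟨0, fun s t => by simp⟩
    · exact B.supported X
  isLocal X h := by
    split_ifs
    · rfl
    · exact B.isLocal X h
  coeff := B.coeff
  norm_coeff_le := B.norm_coeff_le

theorem SupportedOn.univ (A : Op N) : SupportedOn Finset.univ A := by
  refine ⟨fun s t => A (fun i => s ⟨i, mem_univ i⟩) (fun i => t ⟨i, mem_univ i⟩), fun s t => ?_⟩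
  rw [if_pos (fun i hi => absurd (mem_univ i) hi)]

theorem LocalGen.commute_op_sub_eraseEmpty (B : LocalGen N k) (C : Op N) :
    Commute (B.op - B.eraseEmpty.op) C := by
  have h1 : B.op - B.eraseEmpty.op = B.coeff • B.term ∅ := by
    simp only [op, LocalHamiltonian.H, eraseEmpty]
    rw [← smul_sub, ← sum_sub_distrib]
    congr 1
    rw [sum_eq_single ∅]
    · simp
    · intro X _ hX; simp [hX]
    · simp
  rw [h1]
  exact ((B.supported ∅).commute (SupportedOn.univ C) (disjoint_empty_left _)).smul_left _

/-- For groups of commuting terms, the Taylor coefficients of the generator are bounded without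
the factorials of `sum_wordSum_op_le`. -/
theorem pow_mul_norm_genCoeff_le {τ g : ℝ} (hτ : 0 ≤ τ) (l : List (LocalGen N k))
    (hl : ∀ B ∈ l, ∀ X Y, Commute (B.term X) (B.term Y)) (hg : LayerExtensive l g)
    (hsmall : k * (τ * (Real.exp 1 * g)) ≤ 1) {n : ℕ} (hn : n ≠ 0) :
    τ ^ n * ‖genCoeff (l.map LocalGen.op) n‖ ≤ Real.exp 1 * (N * g) := by
  obtain ⟨z, -, hz⟩ := exists_genCoeff_eq_add_central
    (fun B : LocalGen N k => B.commute_op_sub_eraseEmpty) l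
  rw [hz n, if_neg hn, add_zero]
  have hmap : l.map (fun B => B.eraseEmpty.op) = (l.map LocalGen.eraseEmpty).map LocalGen.op := by
    simp
  have hle : ∀ B : LocalGen N k, ∀ i, ∑ X with i ∈ X, ‖B.eraseEmpty.term X‖ ≤
      ∑ X with i ∈ X, ‖B.term X‖ := by
    intro B i
    refine sum_le_sum fun X _ => ?_
    simp only [LocalGen.eraseEmpty]
    split_ifs <;> simp
  have key := sum_pow_mul_genCoeff_le hτ (n + 1) (l.map LocalGen.eraseEmpty) ?_
    (normSeminorm ℂ (Op N)) 0 (fun _ => le_rfl) (fun Z A _ => by simp) ?_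
  · rw [hmap]
    refine le_trans ?_ (key.trans (mul_le_mul_of_nonneg_left ?_ (Real.exp_pos 1).le))
    · exact single_le_sum (f := fun n => τ ^ n *
        normSeminorm ℂ (Op N) (genCoeff ((l.map LocalGen.eraseEmpty).map LocalGen.op) n))
        (fun i _ => mul_nonneg (by positivity) (apply_nonneg _ _)) (self_mem_range_succ n)
    · refine le_trans (le_of_eq ?_) hg.sum_nonempty_le
      rw [List.map_map]
      congr 1
      refine List.map_congr_left fun B _ => sum_congr rfl fun X _ => ?_
      simp only [LocalGen.eraseEmpty]
      split_ifs <;> simp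
  · intro B hB X Y
    obtain ⟨C, hC, rfl⟩ := List.mem_map.mp hB
    simp only [LocalGen.eraseEmpty]
    split_ifs <;> simp [hl C hC X Y]
  · intro i
    refine le_trans (mul_le_mul_of_nonneg_left ?_ (Nat.cast_nonneg k)) hsmall
    rw [Pi.zero_apply, zero_add, List.map_map]
    refine mul_le_mul_of_nonneg_left (mul_le_mul_of_nonneg_left ?_ (Real.exp_pos 1).le) hτ
    exact (List.sum_le_sum fun B _ => hle B i).trans (hg i)

end SiteWeights

/-! ### Spectral projections -/

section Spectral

variable {N k : ℕ}

/-- The function `f` of a Hermitian operator, defined by diagonalization. -/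
def spectralFn {A : Op N} (hA : A.IsHermitian) (f : ℝ → ℂ) : Op N :=
  (hA.eigenvectorUnitary : Op N) * Matrix.diagonal (fun n => f (hA.eigenvalues n)) *
    star (hA.eigenvectorUnitary : Op N)

variable {A : Op N} (hA : A.IsHermitian)

theorem spectralFn_mul (f f' : ℝ → ℂ) :
    spectralFn hA f * spectralFn hA f' = spectralFn hA fun x => f x * f' x := by
  have h1 : star (hA.eigenvectorUnitary : Op N) * (hA.eigenvectorUnitary : Op N) = 1 :=
    Unitary.coe_star_mul_self _
  have h2 : Matrix.diagonal (fun n => f (hA.eigenvalues n) * f' (hA.eigenvalues n)) =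
      Matrix.diagonal (fun n => f (hA.eigenvalues n)) *
        Matrix.diagonal (fun n => f' (hA.eigenvalues n)) :=
    (Matrix.diagonal_mul_diagonal _ _).symm
  rw [spectralFn, spectralFn, spectralFn, h2]
  simp only [mul_assoc]
  rw [← mul_assoc (star (hA.eigenvectorUnitary : Op N)), h1, one_mul]

theorem spectralFn_one : spectralFn hA (fun _ => 1) = 1 := by
  have h1 : (hA.eigenvectorUnitary : Op N) * star (hA.eigenvectorUnitary : Op N) = 1 :=
    Unitary.coe_mul_star_self _
  rw [spectralFn, Matrix.diagonal_one, mul_one, h1]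

theorem spectralFn_sub (f f' : ℝ → ℂ) :
    spectralFn hA (fun x => f x - f' x) = spectralFn hA f - spectralFn hA f' := by
  have h2 : Matrix.diagonal (fun n => f (hA.eigenvalues n) - f' (hA.eigenvalues n)) =
      Matrix.diagonal (fun n => f (hA.eigenvalues n)) -
        Matrix.diagonal (fun n => f' (hA.eigenvalues n)) :=
    (Matrix.diagonal_sub _ _).symm
  rw [spectralFn, spectralFn, spectralFn, h2, mul_sub, sub_mul]

theorem spectralFn_smul (z : ℂ) (f : ℝ → ℂ) :
    spectralFn hA (fun x => z * f x) = z • spectralFn hA f := by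
  have h2 : Matrix.diagonal (fun n => z * f (hA.eigenvalues n)) =
      z • Matrix.diagonal (fun n => f (hA.eigenvalues n)) :=
    Matrix.diagonal_smul z fun n => f (hA.eigenvalues n)
  rw [spectralFn, spectralFn, h2, mul_smul_comm, smul_mul_assoc]

theorem spectralFn_id : spectralFn hA (fun x => (x : ℂ)) = A := by
  conv_rhs => rw [hA.spectral_theorem]
  rfl

theorem star_spectralFn (f : ℝ → ℂ) :
    star (spectralFn hA f) = spectralFn hA fun x => star (f x) := by
  rw [spectralFn, star_mul, star_mul, star_star, Matrix.star_eq_conjTranspose (Matrix.diagonal _),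
    Matrix.diagonal_conjTranspose, ← mul_assoc]
  rfl

theorem norm_spectralFn_le {f : ℝ → ℂ} {K : ℝ} (hK : 0 ≤ K) (hf : ∀ x, ‖f x‖ ≤ K) :
    ‖spectralFn hA f‖ ≤ K := by
  rw [spectralFn, ← Unitary.coe_star, CStarRing.norm_mul_coe_unitary,
    CStarRing.norm_coe_unitary_mul, Matrix.l2_opNorm_diagonal]
  exact (pi_norm_le_iff_of_nonneg hK).mpr fun n => hf _

theorem exp_smul_eq_spectralFn (z : ℂ) :
    exp (z • A) = spectralFn hA fun x => Complex.exp (z * x) := by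
  have h1 : z • A = spectralFn hA fun x => z * x := by
    rw [spectralFn_smul, spectralFn_id]
  rw [h1, spectralFn, spectralFn]
  have h2 := Matrix.exp_units_conj (Unitary.toUnits hA.eigenvectorUnitary)
    (Matrix.diagonal fun n => z * (hA.eigenvalues n : ℂ))
  rw [Matrix.exp_diagonal] at h2
  refine h2.trans ?_
  congr 3
  ext n
  rw [Pi.coe_exp, Complex.exp_eq_exp_ℂ]

theorem norm_exp_imaginary_smul_le (hA : A.IsHermitian) {z : ℂ} (hz : z.re = 0) :
    ‖exp (z • A)‖ ≤ 1 := by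
  rw [exp_smul_eq_spectralFn hA]
  refine norm_spectralFn_le hA zero_le_one fun x => ?_
  rw [Complex.norm_exp]
  simp [hz]

/-- The indicator function of the energies up to `Δ`. -/
def lowIndicator (Δ x : ℝ) : ℂ := Set.indicator (Set.Iic Δ) 1 x

theorem lowEnergyProj_eq (Δ : ℝ) : lowEnergyProj A hA Δ = spectralFn hA (lowIndicator Δ) := by
  classical
  ext s t
  rw [lowEnergyProj, spectralFn, Matrix.mul_apply, Matrix.sum_apply, sum_filter]
  refine sum_congr rfl fun n _ => ?_
  rw [Matrix.mul_diagonal, lowIndicator, Set.indicator_apply, Matrix.star_apply]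
  simp only [Set.mem_Iic, Pi.one_apply]
  split_ifs
  · rw [Matrix.vecMulVec_apply, mul_one]; rfl
  · simp

theorem norm_lowIndicator_le (Δ x : ℝ) : ‖lowIndicator Δ x‖ ≤ 1 := by
  rw [lowIndicator, Set.indicator_apply]; split_ifs <;> simp

theorem norm_lowEnergyProj_le (Δ : ℝ) : ‖lowEnergyProj A hA Δ‖ ≤ 1 := by
  rw [lowEnergyProj_eq]
  exact norm_spectralFn_le hA zero_le_one (norm_lowIndicator_le Δ)

theorem exp_smul_mul_lowEnergyProj (z : ℂ) (Δ : ℝ) :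
    exp (z • A) * lowEnergyProj A hA Δ = lowEnergyProj A hA Δ * exp (z • A) := by
  rw [lowEnergyProj_eq, exp_smul_eq_spectralFn hA, spectralFn_mul, spectralFn_mul]
  simp only [mul_comm]

theorem star_lowIndicator (Δ x : ℝ) : star (lowIndicator Δ x) = lowIndicator Δ x := by
  rw [lowIndicator, Set.indicator_apply]; split_ifs <;> simp

theorem lowIndicator_mul_self (Δ x : ℝ) :
    lowIndicator Δ x * lowIndicator Δ x = lowIndicator Δ x := by
  rw [lowIndicator, Set.indicator_apply]; split_ifs <;> simp

theorem star_lowEnergyProj (Δ : ℝ) : star (lowEnergyProj A hA Δ) = lowEnergyProj A hA Δ := by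
  rw [lowEnergyProj_eq, star_spectralFn]
  simp only [star_lowIndicator]

theorem lowEnergyProj_mul_self (Δ : ℝ) :
    lowEnergyProj A hA Δ * lowEnergyProj A hA Δ = lowEnergyProj A hA Δ := by
  rw [lowEnergyProj_eq, spectralFn_mul]
  simp only [lowIndicator_mul_self]

theorem energy_lowEnergyProj_le (Δ : ℝ) {ψ : StateVec N}
    (hψ : act (lowEnergyProj A hA Δ) ψ = ψ) : energy A ψ ≤ Δ * ‖ψ‖ ^ 2 := by
  -- `(Δ - A) Π` is the square of `C`
  set C : Op N := spectralFn hA fun x => lowIndicator Δ x * (√(Δ - x) : ℝ) with hC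
  have h1 : star C * C = (Δ : ℂ) • lowEnergyProj A hA Δ - A * lowEnergyProj A hA Δ := by
    rw [hC, star_spectralFn, spectralFn_mul, lowEnergyProj_eq, ← spectralFn_smul]
    have e : A * spectralFn hA (lowIndicator Δ) =
        spectralFn hA fun x => (x : ℂ) * lowIndicator Δ x := by
      rw [← spectralFn_mul, spectralFn_id]
    rw [e, ← spectralFn_sub]
    congr 1
    ext x
    rw [star_mul', star_lowIndicator, lowIndicator, Set.indicator_apply]
    simp only [Set.mem_Iic, Pi.one_apply]
    split_ifs with hx
    · have : ((√(Δ - x) : ℝ) : ℂ) * (√(Δ - x) : ℝ) = Δ - x := by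
        rw [← Complex.ofReal_mul, Real.mul_self_sqrt (sub_nonneg.mpr hx)]; push_cast; rfl
      simp [this]
    · simp
  have h2 := energy_star_mul_self C ψ
  rw [h1] at h2
  have h3 : act ((Δ : ℂ) • lowEnergyProj A hA Δ - A * lowEnergyProj A hA Δ) ψ =
      (Δ : ℂ) • ψ - act A ψ := by
    have : act ((Δ : ℂ) • lowEnergyProj A hA Δ - A * lowEnergyProj A hA Δ) ψ =
      (Δ : ℂ) • act (lowEnergyProj A hA Δ) ψ - act (A * lowEnergyProj A hA Δ) ψ := by
      simp only [act, map_sub, map_smul]; rfl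
    rw [this, act_mul_apply, hψ]
  have h4 : (Δ : ℝ) * ‖ψ‖ ^ 2 - energy A ψ = ‖act C ψ‖ ^ 2 := by
    rw [← h2]
    unfold energy
    rw [h3, inner_sub_right, inner_smul_right, inner_self_eq_norm_sq_to_K, Complex.sub_re]
    congr 1
    rw [Complex.re_ofReal_mul]
    norm_cast
  nlinarith [sq_nonneg ‖act C ψ‖]

/-- A bound for matrix elements by energies gives a bound for the low-energy block. -/
theorem norm_lowEnergyProj_mul_le {Δ Δ' K : ℝ} (hK : 0 ≤ K) (hΔ : Δ ≤ Δ') (hΔ' : 0 ≤ Δ')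
    {D : Op N} (hD : ∀ φ ψ, ‖inner ℂ φ (act D ψ)‖ ≤ K * ((energy A φ + energy A ψ) / 2)) :
    ‖lowEnergyProj A hA Δ' * (D * lowEnergyProj A hA Δ)‖ ≤ K * Δ' := by
  refine norm_le_of_forall_act (by positivity) fun ψ => ?_
  set χ := act (lowEnergyProj A hA Δ) ψ with hχ
  set v := act (lowEnergyProj A hA Δ' * (D * lowEnergyProj A hA Δ)) ψ with hv
  have hv' : v = act (lowEnergyProj A hA Δ') (act D χ) := by
    rw [hv, act_mul_apply, act_mul_apply]
  have hPv : act (lowEnergyProj A hA Δ') v = v := by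
    rw [hv', ← act_mul_apply, lowEnergyProj_mul_self]
  have hPχ : act (lowEnergyProj A hA Δ) χ = χ := by
    rw [hχ, ← act_mul_apply, lowEnergyProj_mul_self]
  have hχψ : ‖χ‖ ≤ ‖ψ‖ := by
    refine ((act _).le_opNorm ψ).trans (mul_le_of_le_one_left (norm_nonneg _) ?_)
    exact norm_lowEnergyProj_le hA Δ
  have e1 : energy A v ≤ Δ' * ‖v‖ ^ 2 := energy_lowEnergyProj_le hA Δ' hPv
  have e2 : energy A χ ≤ Δ' * ‖ψ‖ ^ 2 :=
    (energy_lowEnergyProj_le hA Δ hPχ).trans (mul_le_mul hΔ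
      (pow_le_pow_left₀ (norm_nonneg _) hχψ 2) (by positivity) hΔ')
  have hinner : inner ℂ v (act D χ) = ((‖v‖ ^ 2 : ℝ) : ℂ) := by
    nth_rewrite 1 [← hPv]
    rw [inner_act_left, star_lowEnergyProj, ← hv', inner_self_eq_norm_sq_to_K]
    norm_cast
  rcases (norm_nonneg v).eq_or_lt with h0 | hvpos
  · rw [← h0]; positivity
  have hψpos : 0 < ‖ψ‖ := by
    by_contra! h
    have hψ0 : ψ = 0 := norm_le_zero_iff.mp h
    rw [hv, hψ0, map_zero, norm_zero] at hvpos
    exact lt_irrefl _ hvpos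
  have henergy : ∀ (x : ℝ) (w : StateVec N), energy A ((x : ℂ) • w) = x ^ 2 * energy A w := by
    intro x w
    rw [energy, map_smul, inner_smul_left, inner_smul_right, ← mul_assoc, Complex.conj_ofReal,
      ← Complex.ofReal_mul, Complex.re_ofReal_mul, energy, sq]
  -- the vectors are scaled so that both have the same norm
  have key := hD ((‖ψ‖ : ℂ) • v) ((‖v‖ : ℂ) • χ)
  rw [henergy, henergy, map_smul, inner_smul_left, inner_smul_right, hinner, norm_mul, norm_mul,
    Complex.norm_real, Complex.norm_conj, Complex.norm_real, Complex.norm_real, norm_norm,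
    norm_norm, norm_pow, norm_norm] at key
  have h5 : K * ((‖ψ‖ ^ 2 * energy A v + ‖v‖ ^ 2 * energy A χ) / 2) ≤
      K * (Δ' * ‖v‖ ^ 2 * ‖ψ‖ ^ 2) := by
    refine mul_le_mul_of_nonneg_left ?_ hK
    nlinarith [mul_le_mul_of_nonneg_left e1 (sq_nonneg ‖ψ‖),
      mul_le_mul_of_nonneg_left e2 (sq_nonneg ‖v‖)]
  have h6 : ‖v‖ * (‖ψ‖ * ‖v‖ ^ 2) ≤ K * Δ' * ‖ψ‖ * (‖ψ‖ * ‖v‖ ^ 2) := by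
    calc _ = ‖ψ‖ * (‖v‖ * ‖v‖ ^ 2) := by ring
      _ ≤ _ := key.trans h5
      _ = _ := by ring
  exact le_of_mul_le_mul_right h6 (by positivity)

/-- The seminorm `D ↦ ‖e^{λA} D e^{-λA}‖`. -/
def conjSeminorm (A : Op N) (lam : ℝ) : Seminorm ℂ (Op N) :=
  (normSeminorm ℂ (Op N)).comp (exp (adL ((lam : ℂ) • A))).toLinearMap

theorem conjSeminorm_apply (A : Op N) (lam : ℝ) (D : Op N) :
    conjSeminorm A lam D = ‖exp ((lam : ℂ) • A) * D * exp (-((lam : ℂ) • A))‖ := by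
  rw [← exp_adL_apply]; rfl

/-- An operator that can transfer only little energy, in the sense that its conjugation by
`e^{λA}` is bounded, is almost determined by its low-energy block. -/
theorem norm_mul_lowEnergyProj_le {Δ Δ' lam : ℝ} (hlam : 0 ≤ lam) (D : Op N) :
    ‖D * lowEnergyProj A hA Δ‖ ≤ ‖lowEnergyProj A hA Δ' * (D * lowEnergyProj A hA Δ)‖ +
      Real.exp (-(lam * (Δ' - Δ))) * conjSeminorm A lam D := by
  have hneg : exp (-((lam : ℂ) • A)) = exp ((-lam : ℂ) • A) := by rw [neg_smul]
  have h1 : D * lowEnergyProj A hA Δ = lowEnergyProj A hA Δ' * (D * lowEnergyProj A hA Δ) +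
      ((1 - lowEnergyProj A hA Δ') * exp (-((lam : ℂ) • A))) *
        (exp ((lam : ℂ) • A) * D * exp (-((lam : ℂ) • A))) *
          (exp ((lam : ℂ) • A) * lowEnergyProj A hA Δ) := by
    have e := exp_neg_mul_exp' ((lam : ℂ) • A)
    set Q := lowEnergyProj A hA Δ
    set Q' := lowEnergyProj A hA Δ'
    set W := exp ((lam : ℂ) • A)
    set W' := exp (-((lam : ℂ) • A))
    have : ((1 - Q') * W') * (W * D * W') * (W * Q) =
        (1 - Q') * (W' * W) * D * (W' * W) * Q := by simp only [mul_assoc]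
    rw [this, e]
    noncomm_ring
  have h2 : ‖(1 - lowEnergyProj A hA Δ') * exp (-((lam : ℂ) • A))‖ ≤ Real.exp (-(lam * Δ')) := by
    rw [lowEnergyProj_eq, ← spectralFn_one hA, ← spectralFn_sub, hneg,
      exp_smul_eq_spectralFn hA, spectralFn_mul]
    refine norm_spectralFn_le hA (Real.exp_pos _).le fun x => ?_
    rw [lowIndicator, Set.indicator_apply]
    simp only [Set.mem_Iic, Pi.one_apply]
    split_ifs with hx
    · simpa using (Real.exp_pos _).le
    · rw [sub_zero, one_mul, Complex.norm_exp, Real.exp_le_exp]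
      push Not at hx
      have : ((-lam : ℂ) * x).re = -(lam * x) := by simp
      rw [this]
      exact neg_le_neg (mul_le_mul_of_nonneg_left hx.le hlam)
  have h3 : ‖exp ((lam : ℂ) • A) * lowEnergyProj A hA Δ‖ ≤ Real.exp (lam * Δ) := by
    rw [lowEnergyProj_eq, exp_smul_eq_spectralFn hA, spectralFn_mul]
    refine norm_spectralFn_le hA (Real.exp_pos _).le fun x => ?_
    rw [lowIndicator, Set.indicator_apply]
    simp only [Set.mem_Iic, Pi.one_apply]
    split_ifs with hx
    · rw [mul_one, Complex.norm_exp, Real.exp_le_exp]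
      have : ((lam : ℂ) * x).re = lam * x := by simp
      rw [this]
      exact mul_le_mul_of_nonneg_left hx hlam
    · simpa using (Real.exp_pos _).le
  have h4 : Real.exp (-(lam * (Δ' - Δ))) = Real.exp (-(lam * Δ')) * Real.exp (lam * Δ) := by
    rw [← Real.exp_add]; congr 1; ring
  refine (congrArg norm h1).le.trans ((norm_add_le _ _).trans (add_le_add le_rfl ?_))
  rw [h4, mul_right_comm, conjSeminorm_apply]
  refine (norm_mul_le _ _).trans (mul_le_mul ?_ h3 (norm_nonneg _) (by positivity))
  exact (norm_mul_le _ _).trans (mul_le_mul_of_nonneg_right h2 (norm_nonneg _))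

end Spectral

/-! ### Imaginary-time evolution of local operators -/

section Conjugation

variable {N k : ℕ}

/-- The Hamiltonian as a generator with the scalar factor `1`. -/
def LocalHamiltonian.toLocalGen (h : LocalHamiltonian N k) : LocalGen N k where
  toLocalHamiltonian := h
  coeff := 1
  norm_coeff_le := by simp

theorem LocalHamiltonian.op_toLocalGen (h : LocalHamiltonian N k) : h.toLocalGen.op = h.H := by
  rw [LocalGen.op]; exact one_smul _ _

theorem hasSum_pow_mul_ascFactorial {x : ℝ} (hx0 : 0 ≤ x) (hx : x < 1) (s : ℕ) :
    HasSum (fun n : ℕ => x ^ n * s.ascFactorial n / n.factorial) (((1 - x)⁻¹) ^ s) := by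
  rcases Nat.eq_zero_or_pos s with rfl | hs
  · have h1 : ∀ n : ℕ, n ≠ 0 → x ^ n * (Nat.ascFactorial 0 n : ℝ) / n.factorial = 0 := by
      intro n hn
      obtain ⟨m, rfl⟩ := Nat.exists_eq_succ_of_ne_zero hn
      simp [Nat.zero_ascFactorial]
    simpa using hasSum_single 0 h1
  · obtain ⟨m, rfl⟩ := Nat.exists_eq_succ_of_ne_zero hs.ne'
    have h := hasSum_choose_mul_geometric_of_norm_lt_one m (r := x)
      (by rwa [Real.norm_of_nonneg hx0])
    rw [one_div, ← inv_pow] at h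
    convert! h using 2 with n
    rw [Nat.succ_eq_add_one, Nat.ascFactorial_eq_factorial_mul_choose]
    have h2 : (m + n).choose n = (n + m).choose m := by
      rw [add_comm m n, Nat.choose_symm_add]
    rw [h2]
    have : (n.factorial : ℝ) ≠ 0 := by positivity
    push_cast
    field_simp

/-- Evolution in imaginary time changes the norm of a local operator by a factor that depends only
on the size of its support. -/
theorem conjSeminorm_le (h : LocalHamiltonian N k) {g lam : ℝ} (hg : 0 ≤ g) (hh : h.IsExtensive g)
    (hlam : 0 ≤ lam) (hsmall : lam * (k * g) < 1) (Z : Finset (Fin N)) (s : ℕ) (A : Op N)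
    (hA : ActsOn Z A) (hZ : Z.card ≤ s * k) :
    conjSeminorm h.H lam A ≤ ((1 - lam * (k * g))⁻¹) ^ s * ‖A‖ := by
  have hx0 : 0 ≤ lam * (k * g) := by positivity
  have h1 : ∀ n : ℕ, ‖((n.factorial : ℂ)⁻¹) • (adL ((lam : ℂ) • h.H) ^ n) A‖ ≤
      (lam * (k * g)) ^ n * s.ascFactorial n / n.factorial * ‖A‖ := by
    intro n
    have h2 := wordSum_le_of_forall_actsOn (f := normSeminorm ℂ (Op N)) (V := 1) hg zero_le_one
      (fun Z s A _ _ => by simp) (List.replicate n [h.toLocalGen]) (by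
        intro l hl i
        rw [List.eq_of_mem_replicate hl]
        simp only [List.map_singleton, List.sum_singleton]
        exact hh i) Z s A hA hZ
    rw [layerOps, List.map_replicate, List.map_singleton, h.op_toLocalGen,
      wordSum_replicate_singleton, List.length_replicate, one_pow, mul_one,
      coe_normSeminorm] at h2
    rw [adL_smul, smul_pow_apply, norm_smul, norm_smul, norm_inv, norm_pow, Complex.norm_real,
      Real.norm_of_nonneg hlam, Complex.norm_natCast, mul_pow]
    calc _ ≤ (n.factorial : ℝ)⁻¹ * (lam ^ n * ((k * g) ^ n * s.ascFactorial n * ‖A‖)) := by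
          gcongr
      _ = _ := by ring
  have h3 := (hasSum_pow_mul_ascFactorial hx0 hsmall s).mul_right ‖A‖
  have h4 := hasSum_exp_apply (adL ((lam : ℂ) • h.H)) A
  change ‖exp (adL ((lam : ℂ) • h.H)) A‖ ≤ _
  rw [← h4.tsum_eq]
  exact tsum_of_norm_bounded h3 h1

end Conjugation

/-! ### The generator of a product formula -/

section TrotterGenerators

variable {N k c Γ : ℕ} {h : LocalHamiltonian N k}

theorem Splitting.norm_piece_le (S : Splitting h Γ) (γ : Fin Γ) (X : Finset (Fin N)) :
    ‖S.piece γ X‖ ≤ ‖h.term X‖ := by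
  rw [← S.sum_piece X, ← add_sum_erase univ (fun γ => S.piece γ X) (mem_univ γ)]
  exact norm_le_norm_add (S.posSemidef γ X) (Matrix.posSemidef_sum _ fun γ' _ => S.posSemidef γ' X)

theorem Splitting.isExtensive_of_sum (S : Splitting h Γ) {g : ℝ} (hS : S.IsExtensive g) :
    h.IsExtensive g := by
  intro i
  refine le_trans ?_ (hS i)
  rw [sum_comm]
  refine sum_le_sum fun X _ => ?_
  rw [← S.sum_piece X]
  exact norm_sum_le _ _

theorem Splitting.energy_piece_le (S : Splitting h Γ) (γ : Fin Γ) (ψ : StateVec N) :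
    ∑ X, energy (S.piece γ X) ψ ≤ energy h.H ψ := by
  rw [LocalHamiltonian.H, energy_sum]
  refine sum_le_sum fun X _ => ?_
  rw [← S.sum_piece X, energy_sum]
  exact single_le_sum (f := fun γ => energy (S.piece γ X) ψ)
    (fun γ _ => energy_nonneg (S.posSemidef γ X) ψ) (mem_univ γ)

theorem LocalHamiltonian.IsExtensive.nonneg {g : ℝ} (hg : h.IsExtensive g) (hN : 1 ≤ N) :
    0 ≤ g :=
  le_trans (sum_nonneg fun _ _ => norm_nonneg _) (hg ⟨0, hN⟩)

namespace ProductFormula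

variable (S : Splitting h Γ) (P : ProductFormula c Γ)

/-- The generator `-i α_v H_{γ_v}` of a factor of the product formula. -/
def gen (v : Fin (c * Γ)) : LocalGen N k where
  term := S.piece (P.label v)
  posSemidef := S.posSemidef _
  supported := S.supported _
  isLocal X hX := by
    have h1 := S.norm_piece_le (P.label v) X
    rw [h.isLocal X hX, norm_zero] at h1
    exact norm_le_zero_iff.mp h1
  coeff := -Complex.I * P.coeff v
  norm_coeff_le := by simpa using P.abs_coeff_le v

/-- The generators of all the factors of the product formula. -/
def gens : List (LocalGen N k) := List.ofFn (P.gen S)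

theorem length_gens : (P.gens S).length = c * Γ := List.length_ofFn

theorem op_gen (v : Fin (c * Γ)) :
    (P.gen S v).op = (-Complex.I * P.coeff v) • S.group (P.label v) := rfl

theorem isHermitian_group (γ : Fin Γ) : (S.group γ).IsHermitian :=
  (Matrix.posSemidef_sum _ fun X _ => S.posSemidef γ X).isHermitian

theorem prodExp_eq_prod {𝔸 : Type*} [NormedRing 𝔸] [NormedAlgebra ℂ 𝔸] (l : List 𝔸) (z : ℂ) :
    prodExp l z = (l.map fun B => exp (z • B)).prod := by
  induction l with
  | nil => rfl
  | cons B l ih => rw [prodExp, ih, List.map_cons, List.prod_cons]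

theorem eval_eq_prodExp (t : ℝ) :
    P.eval S t = prodExp ((P.gens S).map LocalGen.op) (t : ℂ) := by
  rw [prodExp_eq_prod, gens, List.map_map, List.map_ofFn, eval]
  congr 2
  funext v
  simp only [Function.comp_apply, op_gen, evol, smul_smul]
  congr 2
  push_cast
  ring

theorem evol_eq_exp (A : Op N) (t : ℝ) : evol A t = exp ((t : ℂ) • (-Complex.I • A)) := by
  rw [evol, smul_smul, mul_comm]

theorem norm_exp_op_le (τ : ℝ) {B : LocalGen N k} (hB : B ∈ P.gens S) (s : ℝ) :
    ‖exp (((s * τ : ℝ) : ℂ) • B.op)‖ ≤ 1 := by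
  obtain ⟨v, rfl⟩ := (List.mem_ofFn' _ _).mp hB
  rw [op_gen, smul_smul]
  refine norm_exp_imaginary_smul_le (isHermitian_group S _) ?_
  simp

theorem norm_prodExp_le {𝔸 : Type*} [NormedRing 𝔸] [NormOneClass 𝔸] [NormedAlgebra ℂ 𝔸]
    (l : List 𝔸) (z : ℂ) (hl : ∀ B ∈ l, ‖exp (z • B)‖ ≤ 1) : ‖prodExp l z‖ ≤ 1 := by
  induction l with
  | nil => rw [prodExp, norm_one]
  | cons B l ih =>
    rw [prodExp]
    exact (norm_mul_le _ _).trans (mul_le_one₀ (hl B List.mem_cons_self) (norm_nonneg _)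
      (ih fun C hC => hl C (List.mem_cons_of_mem _ hC)))

theorem norm_prodExpInv_le {𝔸 : Type*} [NormedRing 𝔸] [NormOneClass 𝔸] [NormedAlgebra ℂ 𝔸]
    (l : List 𝔸) (z : ℂ) (hl : ∀ B ∈ l, ‖exp (-(z • B))‖ ≤ 1) : ‖prodExpInv l z‖ ≤ 1 := by
  induction l with
  | nil => rw [prodExpInv, norm_one]
  | cons B l ih =>
    rw [prodExpInv]
    exact (norm_mul_le _ _).trans (mul_le_one₀ (ih fun C hC => hl C (List.mem_cons_of_mem _ hC))
      (norm_nonneg _) (hl B List.mem_cons_self))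

theorem norm_eval_le (t : ℝ) : ‖P.eval S t‖ ≤ 1 := by
  rw [eval_eq_prodExp]
  refine norm_prodExp_le _ _ fun B hB => ?_
  obtain ⟨C, hC, rfl⟩ := List.mem_map.mp hB
  simpa using norm_exp_op_le S P t hC 1

/-- The error of a product formula of order `p`, bounded by the Taylor coefficients of the
generator of the order `p` and above. -/
theorem trotterError_le_tsum {p : ℕ} (hp : 1 ≤ p) (hP : P.HasOrder S p) (Δ t : ℝ) (d : ℕ → ℝ)
    (hd : ∀ n, p ≤ n → |t| ^ n *
      ‖genCoeff ((P.gens S).map LocalGen.op) n * lowEnergyProj h.H h.isHermitian_H Δ‖ ≤ d n)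
    (hs : Summable fun n => d (n + p)) :
    trotterError S P Δ t ≤ |t| / (p + 1) * ∑' n, d (n + p) := by
  rw [trotterError, evol_eq_exp, eval_eq_prodExp]
  refine norm_error_le _ (-Complex.I • h.H) _ hp t d (fun τ => ?_) (fun τ => ?_) (fun τ => ?_)
    (fun τ => ?_) ?_ hd hs
  · rw [← eval_eq_prodExp]
    exact norm_eval_le S P τ
  · refine norm_prodExpInv_le _ _ fun B hB => ?_
    obtain ⟨C, hC, rfl⟩ := List.mem_map.mp hB
    simpa using norm_exp_op_le S P τ hC (-1)
  · rw [smul_smul]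
    exact norm_exp_imaginary_smul_le h.isHermitian_H (by simp)
  · rw [smul_smul]
    exact exp_smul_mul_lowEnergyProj h.isHermitian_H _ _
  · refine Asymptotics.IsBigO.congr_left hP fun τ => ?_
    rw [evol_eq_exp, eval_eq_prodExp]

theorem layerExtensive_gen {g : ℝ} (hg : h.IsExtensive g) (v : Fin (c * Γ)) :
    LayerExtensive [P.gen S v] g := by
  intro i
  rw [List.map_singleton, List.sum_singleton]
  exact (sum_le_sum fun X _ => S.norm_piece_le _ X).trans (hg i)

theorem layerEnergy_gen_le (φ ψ : StateVec N) (v : Fin (c * Γ)) :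
    layerEnergy φ ψ [P.gen S v] ≤ (energy h.H φ + energy h.H ψ) / 2 := by
  rw [layerEnergy, List.map_singleton, List.sum_singleton, ← sum_div, sum_add_distrib]
  have h1 := S.energy_piece_le (P.label v) φ
  have h2 := S.energy_piece_le (P.label v) ψ
  exact div_le_div_of_nonneg_right (add_le_add h1 h2) zero_le_two

variable {P}

theorem Repeats.sum_le (hP : P.Repeats) {a : Fin Γ → ℝ} (ha : ∀ γ, 0 ≤ a γ) :
    ∑ v, a (P.label v) ≤ c * ∑ γ, a γ := by
  rw [← sum_fiberwise_of_maps_to (g := P.label) (t := univ) fun v _ => mem_univ _, mul_sum]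
  refine sum_le_sum fun γ _ => ?_
  have h1 : ∑ v with P.label v = γ, a (P.label v) = ∑ v with P.label v = γ, a γ :=
    sum_congr rfl fun v hv => by rw [(mem_filter.mp hv).2]
  rw [h1, sum_const, nsmul_eq_mul]
  exact mul_le_mul_of_nonneg_right (by exact_mod_cast hP γ) (ha γ)

theorem Repeats.layerExtensive_gens (hP : P.Repeats) {g : ℝ} (hS : S.IsExtensive g) :
    LayerExtensive (P.gens S) (c * g) := by
  intro i
  rw [gens, List.map_ofFn, List.sum_ofFn]
  refine (hP.sum_le (a := fun γ => ∑ X with i ∈ X, ‖S.piece γ X‖)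
    fun γ => sum_nonneg fun _ _ => norm_nonneg _).trans ?_
  exact mul_le_mul_of_nonneg_left (hS i) (Nat.cast_nonneg c)

theorem Repeats.layerEnergy_gens_le (hP : P.Repeats) (φ ψ : StateVec N) :
    layerEnergy φ ψ (P.gens S) ≤ c * ((energy h.H φ + energy h.H ψ) / 2) := by
  rw [layerEnergy, gens, List.map_ofFn, List.sum_ofFn]
  refine (hP.sum_le (a := fun γ => ∑ X, (energy (S.piece γ X) φ + energy (S.piece γ X) ψ) / 2)
    fun γ => sum_nonneg fun X _ => ?_).trans (mul_le_mul_of_nonneg_left ?_ (Nat.cast_nonneg c))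
  · have := energy_nonneg (S.posSemidef γ X) φ
    have := energy_nonneg (S.posSemidef γ X) ψ
    positivity
  · have h1 : ∀ ψ, ∑ γ, ∑ X, energy (S.piece γ X) ψ = energy h.H ψ := by
      intro ψ
      rw [sum_comm, LocalHamiltonian.H, energy_sum]
      refine sum_congr rfl fun X _ => ?_
      rw [← energy_sum, S.sum_piece]
    simp only [← sum_div, sum_add_distrib, h1, le_refl]

theorem commute_term_of_mem_gens {B : LocalGen N k} (hB : B ∈ P.gens S) (X Y : Finset (Fin N)) :
    Commute (B.term X) (B.term Y) := by
  obtain ⟨v, rfl⟩ := (List.mem_ofFn' _ _).mp hB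
  exact S.commute _ X Y

end ProductFormula

/-- `f` grows at most by the factor `V` for each additional term in the support. -/
def GrowsBy (k : ℕ) (f : Seminorm ℂ (Op N)) (V : ℝ) : Prop :=
  ∀ (Z : Finset (Fin N)) (s : ℕ) (A : Op N), ActsOn Z A → Z.card ≤ s * k → f A ≤ V ^ s * ‖A‖

theorem growsBy_norm : GrowsBy k (normSeminorm ℂ (Op N)) 1 := fun Z s A _ _ => by simp

/-- The norm of an operator on the low-energy subspace, from the energy bound for its matrix
elements and from its locality. The imaginary time `1 / (4 k g)` makes the energies above the cutoff
`Δ + 4 k g log y` contribute with the factor `1 / y`. -/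
theorem norm_mul_lowEnergyProj_le_of_growsBy {g Δ y K : ℝ} {W : ℝ → ℝ} (hk : 1 ≤ k) (hg : 0 ≤ g)
    (hh : h.IsExtensive g) (hΔ : 0 ≤ Δ) (hy : 1 ≤ y) (hK : 0 ≤ K) {D : Op N}
    (hlow : ∀ φ ψ, matrixElement φ ψ D ≤ K * ((energy h.H φ + energy h.H ψ) / 2))
    (htail : ∀ f V, 0 ≤ V → GrowsBy k f V → f D ≤ g * W V) :
    ‖D * lowEnergyProj h.H h.isHermitian_H Δ‖ ≤
      K * (Δ + 4 * k * g * Real.log y) + g * W (4 / 3) / y := by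
  have hlog : 0 ≤ Real.log y := Real.log_nonneg hy
  set Δ' := Δ + 4 * k * g * Real.log y with hΔ'
  have hle : Δ ≤ Δ' := le_add_of_nonneg_right (by positivity)
  have h1 := norm_lowEnergyProj_mul_le h.isHermitian_H hK hle (hΔ.trans hle) hlow
  rcases hg.eq_or_lt with hg0 | hg0
  · -- for `g = 0`, the imaginary time is `0` and the second term vanishes
    have h2 := norm_mul_lowEnergyProj_le h.isHermitian_H (Δ := Δ) (Δ' := Δ') le_rfl D
    have h3 := htail (conjSeminorm h.H 0) 1 zero_le_one fun Z s A hA hZ => by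
      simpa using conjSeminorm_le h hg hh le_rfl (by simp) Z s A hA hZ
    rw [← hg0, zero_mul] at h3
    rw [← hg0, zero_mul, zero_div, add_zero]
    refine h2.trans (add_le_of_le_of_nonpos h1 ?_)
    exact mul_nonpos_of_nonneg_of_nonpos (Real.exp_pos _).le h3
  · have hk0 : (0 : ℝ) < k := by exact_mod_cast hk
    have hkg : (1 / (4 * k * g) : ℝ) * (k * g) = 1 / 4 := by field_simp
    have h2 := norm_mul_lowEnergyProj_le h.isHermitian_H (Δ := Δ) (Δ' := Δ')
      (lam := 1 / (4 * k * g)) (by positivity) D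
    have h3 := htail (conjSeminorm h.H (1 / (4 * k * g))) (4 / 3) (by norm_num)
        fun Z s A hA hZ => by
      have h4 := conjSeminorm_le h hg hh (lam := 1 / (4 * k * g)) (by positivity)
        (by rw [hkg]; norm_num) Z s A hA hZ
      rw [hkg] at h4
      norm_num at h4 ⊢
      exact h4
    have h4 : Real.exp (-(1 / (4 * k * g) * (Δ' - Δ))) = y⁻¹ := by
      have : (1 / (4 * k * g) : ℝ) * (Δ' - Δ) = Real.log y := by rw [hΔ']; field_simp; ring
      rw [this, Real.exp_neg, Real.exp_log (by linarith)]
    rw [h4] at h2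
    refine h2.trans (add_le_add h1 ?_)
    rw [div_eq_inv_mul (g * W (4 / 3))]
    exact mul_le_mul_of_nonneg_left h3 (by positivity)

namespace ProductFormula

variable (S : Splitting h Γ) (P : ProductFormula c Γ)

theorem exists_eq_map_of_forall_mem {α β : Type*} {F : α → β} {l : List α} {w : List β}
    (hw : ∀ b ∈ w, b ∈ l.map F) : ∃ w' : List α, w = w'.map F ∧ ∀ a ∈ w', a ∈ l := by
  induction w with
  | nil => exact ⟨[], rfl, by simp⟩
  | cons b w ih =>
    obtain ⟨w', rfl, hw'⟩ := ih fun b hb => hw b (List.mem_cons_of_mem _ hb)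
    obtain ⟨a, ha, rfl⟩ := List.mem_map.mp (hw b List.mem_cons_self)
    exact ⟨a :: w', rfl, by simpa [ha] using hw'⟩

theorem seminorm_genCoeff_gens_le (f : Seminorm ℂ (Op N)) (n : ℕ) {K : ℝ} (hK : 0 ≤ K)
    (hf : ∀ w : List (LocalGen N k), w.length = n → (∀ B ∈ w, ∃ v, B = P.gen S v) →
      ∀ v, wordSum f (layerOps (w.map fun B => [B])) (P.gen S v).op ≤ K) :
    f (genCoeff ((P.gens S).map LocalGen.op) n) ≤ (c * Γ : ℝ) ^ (n + 1) / n.factorial * K := by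
  have hlen : ((P.gens S).map LocalGen.op).length = c * Γ := by
    rw [List.length_map, length_gens]
  have hcast : (((P.gens S).map LocalGen.op).length : ℝ) = c * Γ := by rw [hlen]; push_cast; rfl
  rw [← hcast]
  refine seminorm_genCoeff_le_of_words f ((P.gens S).map LocalGen.op) n hK
    fun w hw hwl B hB => ?_
  obtain ⟨w', rfl, hw'⟩ := exists_eq_map_of_forall_mem hwl
  obtain ⟨C, hC, rfl⟩ := List.mem_map.mp hB
  obtain ⟨v, rfl⟩ := (List.mem_ofFn' _ _).mp hC
  have key := hf w' (by rwa [List.length_map] at hw) (fun B hB => by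
    obtain ⟨v, hv⟩ := (List.mem_ofFn' _ _).mp (hw' B hB)
    exact ⟨v, hv.symm⟩) v
  rw [layerOps, List.map_map] at key
  rw [List.map_map]
  exact key

end ProductFormula

end TrotterGenerators

/-! ### Bounds with explicit constants -/

section ExplicitBounds

variable {N k c Γ : ℕ} {h : LocalHamiltonian N k}

theorem hasSum_mul_pow_add {r : ℝ} (hr0 : 0 ≤ r) (hr : r < 1) (a : ℝ) (p : ℕ) :
    HasSum (fun n : ℕ => a * r ^ (n + p)) (a * (r ^ p / (1 - r))) := by
  have h1 := ((hasSum_geometric_of_lt_one hr0 hr).mul_left (r ^ p)).mul_left a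
  simp only [← pow_add, add_comm p] at h1
  exact h1

theorem exp_one_gt : (5 / 2 : ℝ) < Real.exp 1 := by
  have := Real.exp_one_gt_d9
  norm_num at this ⊢
  linarith

theorem high_energy_sum_le {T q g N y u ε k : ℝ} {p : ℕ} (hu0 : 0 ≤ u) (hu1 : u ≤ 2 / 5)
    (hk : 0 < k) (hε : 0 ≤ ε) (hqg : q * g * T = u / (2 * k))
    (hNy : N / y = 2 ^ p * k * ε / 2) :
    T / (p + 1) * (g * (q * N * (4 / 3)) / y * ((2 * u / 3) ^ p / (1 - 2 * u / 3))) ≤ ε := by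
  have hp0 : (0 : ℝ) ≤ p := Nat.cast_nonneg p
  have h1 : T / (p + 1) * (g * (q * N * (4 / 3)) / y * ((2 * u / 3) ^ p / (1 - 2 * u / 3))) =
      (q * g * T) * (N / y) * (4 / 3) * (2 * u / 3) ^ p / ((1 - 2 * u / 3) * (p + 1)) := by
    simp only [div_eq_mul_inv, mul_inv]; ring
  have h2 : (4 * u / 3) ^ p ≤ 1 := pow_le_one₀ (by positivity) (by linarith)
  have h3 : (4 * u / 3) ^ p = 2 ^ p * (2 * u / 3) ^ p := by
    rw [← mul_pow]; congr 1; ring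
  have h4 : u / (2 * k) * (2 ^ p * k * ε / 2) = 2 ^ p * (u * ε / 4) := by field_simp; ring
  have h5 : (11 / 15 : ℝ) ≤ (1 - 2 * u / 3) * (p + 1) := by nlinarith
  rw [h1, hqg, hNy, h4, div_le_iff₀ (by linarith)]
  calc 2 ^ p * (u * ε / 4) * (4 / 3) * (2 * u / 3) ^ p = u * (4 * u / 3) ^ p * ε / 3 := by
        rw [h3]; ring
    _ ≤ 2 / 5 * 1 * ε / 3 := by gcongr
    _ ≤ 11 / 15 * ε := by linarith
    _ ≤ _ := by rw [mul_comm]; gcongr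

theorem norm_sum_le_of_small_cutoff {T q g N u ε k : ℝ} {p : ℕ} (hu0 : 0 ≤ u) (hu1 : u ≤ 2 / 5)
    (hk : 0 < k) (hε : 0 ≤ ε) (hqg : q * g * T = u / (2 * k))
    (hN : N ≤ 2 ^ p * k * ε / 2) :
    T / (p + 1) * (g * (q * N) * ((u / 2) ^ p / (1 - u / 2))) ≤ 1 / 8 * ε := by
  have hp0 : (0 : ℝ) ≤ p := Nat.cast_nonneg p
  have h1 : T / (p + 1) * (g * (q * N) * ((u / 2) ^ p / (1 - u / 2))) =
      (q * g * T) * N * (u / 2) ^ p / ((1 - u / 2) * (p + 1)) := by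
    simp only [div_eq_mul_inv, mul_inv]; ring
  have h4 : u / (2 * k) * (2 ^ p * k * ε / 2) = 2 ^ p * (u * ε / 4) := by field_simp; ring
  have h5 : (8 / 10 : ℝ) ≤ (1 - u / 2) * (p + 1) := by nlinarith
  have h6 : u ^ p ≤ 1 := pow_le_one₀ hu0 (by linarith)
  have h7 : 2 ^ p * (u / 2) ^ p = u ^ p := by rw [← mul_pow]; congr 1; ring
  rw [h1, hqg, div_le_iff₀ (by linarith)]
  calc u / (2 * k) * N * (u / 2) ^ p ≤ u / (2 * k) * (2 ^ p * k * ε / 2) * (u / 2) ^ p := by gcongr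
    _ = u * u ^ p * ε / 4 := by rw [h4, ← h7]; ring
    _ ≤ 2 / 5 * 1 * ε / 4 := by gcongr
    _ ≤ 1 / 8 * ε * (8 / 10) := by linarith
    _ ≤ _ := by gcongr

theorem neg_le_of_small_cutoff {q g k T E L Δ ε u : ℝ} {p : ℕ} (hp : 1 ≤ p) (hq : 0 ≤ q)
    (hg : 0 ≤ g) (hk : 0 ≤ k) (hT : 0 ≤ T) (hE : 3 / 5 ≤ E) (hΔ : 0 ≤ Δ) (hε : 0 ≤ ε)
    (hu : u = 2 * q * k * g * T) (hu1 : u ≤ 2 / 5) (hL : -(2 ^ p * ε / 2) ≤ L) :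
    -(6 / 10 * ε) ≤ 2 * q / (E * (p + 1)) * u ^ p * (Δ + 4 * k * g * L) * T := by
  have hp1 : (1 : ℝ) ≤ p := by exact_mod_cast hp
  have hu0 : 0 ≤ u := by rw [hu]; positivity
  have hE0 : 0 < E := by linarith
  have h1 : -(4 * k * g * (2 ^ p * ε / 2)) ≤ Δ + 4 * k * g * L := by
    have : 4 * k * g * (-(2 ^ p * ε / 2)) ≤ 4 * k * g * L :=
      mul_le_mul_of_nonneg_left hL (by positivity)
    linarith
  have h2 : 2 * q / (E * (p + 1)) * u ^ p * (-(4 * k * g * (2 ^ p * ε / 2))) * T ≤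
      2 * q / (E * (p + 1)) * u ^ p * (Δ + 4 * k * g * L) * T := by gcongr
  refine le_trans ?_ h2
  have h3 : 2 * q / (E * (p + 1)) * u ^ p * (-(4 * k * g * (2 ^ p * ε / 2))) * T =
      -((2 * (2 * q * k * g * T) * (2 * u) ^ p * ε) / (E * (p + 1))) := by
    rw [mul_pow]
    simp only [div_eq_mul_inv]
    ring
  rw [h3, ← hu]
  refine neg_le_neg ?_
  have h5 : (6 / 5 : ℝ) ≤ E * (p + 1) := by nlinarith
  rw [div_le_iff₀ (by linarith)]
  have h6 : (2 * u) ^ p ≤ 2 * u := pow_le_of_le_one (by positivity) (by linarith) (by omega)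
  calc 2 * u * (2 * u) ^ p * ε ≤ 2 * u * (2 * u) * ε := by gcongr
    _ ≤ 2 * (2 / 5) * (2 * (2 / 5)) * ε := by gcongr
    _ ≤ 6 / 10 * ε * (6 / 5) := by linarith
    _ ≤ _ := by gcongr

theorem repeats_high_energy_sum_le {T c g N y u ε : ℝ} {p : ℕ} (hu0 : 0 ≤ u) (hu1 : u ≤ 1 / 2)
    (hcg : c * g * T ≤ 1 / 8) (hNy0 : 0 ≤ N / y) (hNy : N / y ≤ ε) :
    T / (p + 1) * (g * (c * N * (4 / 3)) / y * ((2 * u / 3) ^ p / (1 - 2 * u / 3))) ≤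
      1 / 4 * ε := by
  have hp0 : (0 : ℝ) ≤ p := Nat.cast_nonneg p
  have hε := hNy0.trans hNy
  have h1 : T / (p + 1) * (g * (c * N * (4 / 3)) / y * ((2 * u / 3) ^ p / (1 - 2 * u / 3))) =
      (c * g * T) * (N / y) * (4 / 3) * (2 * u / 3) ^ p / ((1 - 2 * u / 3) * (p + 1)) := by
    simp only [div_eq_mul_inv, mul_inv]; ring
  have h2 : (2 * u / 3) ^ p ≤ 1 := pow_le_one₀ (by positivity) (by linarith)
  have h4 : (2 / 3 : ℝ) ≤ (1 - 2 * u / 3) * (p + 1) := by nlinarith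
  rw [h1, div_le_iff₀ (by linarith)]
  calc c * g * T * (N / y) * (4 / 3) * (2 * u / 3) ^ p ≤ 1 / 8 * ε * (4 / 3) * 1 := by gcongr
    _ = 1 / 4 * ε * (2 / 3) := by ring
    _ ≤ _ := by gcongr

theorem high_order_sum_le {T c g N k ε r e s R : ℝ} {p : ℕ} (hT : 0 ≤ T) (hg : 0 ≤ g) (hc : 0 ≤ c)
    (hN : 0 < N) (hε : 0 ≤ ε) (hr : r ≤ 2 / 5) (he : 0 ≤ e)
    (hckg : c * k * g * T ≤ 1 / 8) (hR : R * e ≤ k * ε / (2 * N)) (hs : s ≤ R / (1 - r)) :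
    T / (p + 1) * (e * (N * (c * g)) * s) ≤ 1 / 4 * ε := by
  have hp0 : (0 : ℝ) ≤ p := Nat.cast_nonneg p
  have h4 : (3 / 5 : ℝ) ≤ (p + 1) * (1 - r) := by nlinarith
  calc T / (p + 1) * (e * (N * (c * g)) * s)
      ≤ T / (p + 1) * (e * (N * (c * g)) * (R / (1 - r))) := by gcongr
    _ = (c * g * T) * N * (R * e) / ((p + 1) * (1 - r)) := by
        simp only [div_eq_mul_inv, mul_inv]; ring
    _ ≤ (c * g * T) * N * (k * ε / (2 * N)) / ((p + 1) * (1 - r)) := by gcongr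
    _ = (c * k * g * T) * ε / 2 / ((p + 1) * (1 - r)) := by
        congr 1
        field_simp
    _ ≤ 1 / 8 * ε / 2 / ((p + 1) * (1 - r)) := by gcongr
    _ ≤ _ := by
        rw [div_le_iff₀ (by linarith)]
        calc 1 / 8 * ε / 2 ≤ 1 / 4 * ε * (3 / 5) := by linarith
          _ ≤ _ := by gcongr

namespace ProductFormula

variable (S : Splitting h Γ) (P : ProductFormula c Γ)

theorem matrixElement_genCoeff_le {g : ℝ} (hg0 : 0 ≤ g) (hg : h.IsExtensive g) (n : ℕ)
    (φ ψ : StateVec N) :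
    matrixElement φ ψ (genCoeff ((P.gens S).map LocalGen.op) n) ≤
      c * Γ * (2 * c * Γ * k * g) ^ n * ((energy h.H φ + energy h.H ψ) / 2) := by
  have hH : h.H.PosSemidef := Matrix.posSemidef_sum _ fun X _ => h.posSemidef X
  have h1 := energy_nonneg hH φ
  have h2 := energy_nonneg hH ψ
  refine (seminorm_genCoeff_gens_le S P _ n
    (K := 2 ^ n * (k * g) ^ n * n.factorial * ((energy h.H φ + energy h.H ψ) / 2))
    (by positivity) fun w hw hwl v => ?_).trans_eq ?_
  · have key := sum_wordSum_matrixElement_le φ ψ hg0 (w.map fun B => [B]) ?_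
      ⟨layerExtensive_gen S P hg v, layerEnergy_gen_le S P φ ψ v⟩
    · rw [List.map_singleton, List.sum_singleton, List.length_map, hw] at key
      exact key
    · intro l hl
      obtain ⟨B, hB, rfl⟩ := List.mem_map.mp hl
      obtain ⟨v', rfl⟩ := hwl B hB
      exact ⟨layerExtensive_gen S P hg v', layerEnergy_gen_le S P φ ψ v'⟩
  · have : (n.factorial : ℝ) ≠ 0 := by positivity
    field_simp
    ring

theorem seminorm_genCoeff_le {g : ℝ} (hg0 : 0 ≤ g) (hg : h.IsExtensive g) {n : ℕ} (hn : n ≠ 0)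
    {f : Seminorm ℂ (Op N)} {V : ℝ} (hV : 0 ≤ V) (hf : GrowsBy k f V) :
    f (genCoeff ((P.gens S).map LocalGen.op) n) ≤
      g * (c * Γ * N * (c * Γ * k * g) ^ n * V ^ (n + 1)) := by
  refine (seminorm_genCoeff_gens_le S P _ n
    (K := N * g * ((k * g) ^ n * n.factorial * V ^ (n + 1)))
    (by positivity) fun w hw hwl v => ?_).trans_eq ?_
  · have key := sum_wordSum_op_le hg0 hV hf (w.map fun B => [B]) ?_
      (by rwa [List.length_map, hw]) (layerExtensive_gen S P hg v)
    · rw [List.map_singleton, List.sum_singleton, List.length_map, hw] at key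
      exact key
    · intro l hl
      obtain ⟨B, hB, rfl⟩ := List.mem_map.mp hl
      obtain ⟨v', rfl⟩ := hwl B hB
      exact layerExtensive_gen S P hg v'
  · have : (n.factorial : ℝ) ≠ 0 := by positivity
    field_simp
    ring

variable {P} in
theorem Repeats.matrixElement_genCoeff_le (hP : P.Repeats) {g : ℝ} (hg0 : 0 ≤ g)
    (hS : S.IsExtensive g) (n : ℕ) (φ ψ : StateVec N) :
    matrixElement φ ψ (genCoeff ((P.gens S).map LocalGen.op) n) ≤
      c * (2 * c * k * g) ^ n * n.factorial * ((energy h.H φ + energy h.H ψ) / 2) := by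
  refine (seminorm_genCoeff_le_wordSum _ _ n).trans ?_
  have hl := And.intro (hP.layerExtensive_gens S hS) (hP.layerEnergy_gens_le S φ ψ)
  have key := sum_wordSum_matrixElement_le φ ψ (mul_nonneg (Nat.cast_nonneg c) hg0)
    (List.replicate n (P.gens S)) (fun l hl' => by rwa [List.eq_of_mem_replicate hl']) hl
  rw [layerOps, List.map_replicate, List.length_replicate] at key
  rw [List.map_map]
  refine key.trans_eq ?_
  ring

variable {P} in
theorem Repeats.seminorm_genCoeff_le (hP : P.Repeats) {g : ℝ} (hg0 : 0 ≤ g)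
    (hS : S.IsExtensive g) {n : ℕ} (hn : n ≠ 0)
    {f : Seminorm ℂ (Op N)} {V : ℝ} (hV : 0 ≤ V) (hf : GrowsBy k f V) :
    f (genCoeff ((P.gens S).map LocalGen.op) n) ≤
      g * (c * N * (c * k * g) ^ n * n.factorial * V ^ (n + 1)) := by
  refine (seminorm_genCoeff_le_wordSum _ _ n).trans ?_
  have hl := hP.layerExtensive_gens S hS
  have key := sum_wordSum_op_le (mul_nonneg (Nat.cast_nonneg c) hg0) hV hf
    (List.replicate n (P.gens S)) (fun l hl' => by rwa [List.eq_of_mem_replicate hl'])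
    (by rwa [List.length_replicate]) hl
  rw [layerOps, List.map_replicate, List.length_replicate] at key
  rw [List.map_map]
  refine key.trans_eq ?_
  ring

end ProductFormula

/-- The error bound with explicit constants, for a given number of factors. -/
theorem trotterError_le_of_length (S : Splitting h Γ) (P : ProductFormula c Γ) {p : ℕ}
    {g Δ ε t : ℝ} (hk : 1 ≤ k) (hkN : k ≤ N) (hp : 1 ≤ p) (hg : h.IsExtensive g)
    (hP : P.HasOrder S p) (hΔ : 0 ≤ Δ) (hε : 0 < ε)
    (ht : 2 * c * Γ * k * g * |t| ≤ 1 / Real.exp 1) :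
    trotterError S P Δ t ≤
      2 * c * Γ / ((1 - 1 / Real.exp 1) * (p + 1)) * (2 * c * Γ * k * g * |t|) ^ p *
        (Δ + 4 * k * g * Real.log (2 * N / (2 ^ p * k * ε))) * |t| + ε := by
  have hg0 : 0 ≤ g := hg.nonneg (hk.trans hkN)
  have hk0 : (0 : ℝ) < k := by exact_mod_cast hk
  have hN0 : (0 : ℝ) < N := by exact_mod_cast hk.trans hkN
  have hkN' : (k : ℝ) ≤ N := by exact_mod_cast hkN
  have he : 1 / Real.exp 1 ≤ 2 / 5 := by
    rw [div_le_div_iff₀ (Real.exp_pos 1) (by norm_num)]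
    linarith [exp_one_gt]
  set E : ℝ := 1 - 1 / Real.exp 1 with hE
  have hE' : 3 / 5 ≤ E := by rw [hE]; linarith
  set q : ℝ := c * Γ with hq
  have hq0 : 0 ≤ q := by positivity
  set u : ℝ := 2 * c * Γ * k * g * |t| with hu
  have hu0 : 0 ≤ u := by positivity
  have hu1 : u ≤ 2 / 5 := ht.trans he
  have hup : 0 ≤ u ^ p := by positivity
  have hqg : q * g * |t| = u / (2 * k) := by rw [hu, hq]; field_simp
  set y : ℝ := 2 * N / (2 ^ p * k * ε) with hy
  have hy0 : 0 < y := by positivity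
  have hNy : N / y = 2 ^ p * k * ε / 2 := by rw [hy]; field_simp
  set Q := lowEnergyProj h.H h.isHermitian_H Δ
  set G := fun n => genCoeff ((P.gens S).map LocalGen.op) n with hG
  have hp0 : (0 : ℝ) ≤ p := Nat.cast_nonneg p
  rcases le_or_gt 1 y with hy1 | hy1
  · have hlog : 0 ≤ Real.log y := Real.log_nonneg hy1
    set Δ' := Δ + 4 * k * g * Real.log y with hΔ'
    have hΔ'0 : 0 ≤ Δ' := by positivity
    have hd : ∀ n, p ≤ n → |t| ^ n * ‖G n * Q‖ ≤
        q * Δ' * u ^ n + g * (q * N * (4 / 3)) / y * (2 * u / 3) ^ n := by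
      intro n hn
      have h1 := norm_mul_lowEnergyProj_le_of_growsBy hk hg0 hg hΔ hy1
        (K := c * Γ * (2 * c * Γ * k * g) ^ n)
        (W := fun V => c * Γ * N * (c * Γ * k * g) ^ n * V ^ (n + 1)) (by positivity)
        (P.matrixElement_genCoeff_le S hg0 hg n)
        fun f V hV hf => P.seminorm_genCoeff_le S hg0 hg (by omega) hV hf
      refine (mul_le_mul_of_nonneg_left h1 (by positivity)).trans_eq ?_
      have e1 : (2 * u / 3) ^ n = (c * Γ * k * g) ^ n * (4 / 3) ^ n * |t| ^ n := by
        rw [← mul_pow, ← mul_pow, hu]; congr 1; ring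
      rw [e1, hu, hΔ', hq]
      ring
    have hs := (hasSum_mul_pow_add hu0 (by linarith) (q * Δ') p).add
      (hasSum_mul_pow_add (r := 2 * u / 3) (by positivity) (by linarith)
        (g * (q * N * (4 / 3)) / y) p)
    refine (P.trotterError_le_tsum S hp hP Δ t _ hd hs.summable).trans ?_
    rw [hs.tsum_eq, mul_add]
    refine add_le_add ?_ ?_
    · have h1 : 1 / (1 - u) ≤ 2 / E := by
        rw [div_le_div_iff₀ (by linarith) (by linarith)]
        linarith
      calc |t| / (p + 1) * (q * Δ' * (u ^ p / (1 - u)))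
          = (q * Δ' * u ^ p * |t| / (p + 1)) * (1 / (1 - u)) := by ring
        _ ≤ (q * Δ' * u ^ p * |t| / (p + 1)) * (2 / E) := by gcongr
        _ = _ := by rw [hq]; field_simp
    · exact high_energy_sum_le hu0 hu1 hk0 hε.le hqg hNy
  · -- the cutoff lies below `Δ`, and the bound in the operator norm is already small enough
    have hd : ∀ n, p ≤ n → |t| ^ n * ‖G n * Q‖ ≤ g * (q * N) * (u / 2) ^ n := by
      intro n hn
      have h1 : ‖G n‖ ≤ _ := P.seminorm_genCoeff_le S hg0 hg (n := n) (by omega) zero_le_one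
        growsBy_norm
      have h2 : ‖G n * Q‖ ≤ ‖G n‖ := (norm_mul_le _ _).trans
        (mul_le_of_le_one_right (norm_nonneg _) (norm_lowEnergyProj_le _ _))
      refine (mul_le_mul_of_nonneg_left (h2.trans h1) (by positivity)).trans_eq ?_
      have e1 : (u / 2) ^ n = (c * Γ * k * g) ^ n * |t| ^ n := by
        rw [← mul_pow, hu]; congr 1; ring
      rw [e1, one_pow, hq]
      ring
    have hs := hasSum_mul_pow_add (r := u / 2) (by positivity) (by linarith) (g * (q * N)) p
    refine (P.trotterError_le_tsum S hp hP Δ t _ hd hs.summable).trans ?_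
    rw [hs.tsum_eq]
    have hp1 : (1 : ℝ) ≤ p := by exact_mod_cast hp
    have hNk : (N : ℝ) ≤ 2 ^ p * k * ε / 2 := by
      rw [← hNy]
      exact le_div_self hN0.le hy0 hy1.le
    have hmain := norm_sum_le_of_small_cutoff hu0 hu1 hk0 hε.le hqg hNk
    have hlog : -(1 / y) ≤ Real.log y := by
      have := Real.log_le_sub_one_of_pos (inv_pos.mpr hy0)
      rw [Real.log_inv] at this
      rw [one_div]
      linarith
    have hyk : 1 / y ≤ 2 ^ p * ε / 2 := by
      rw [hy, one_div_div, div_le_div_iff₀ (by positivity) (by norm_num)]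
      have : 2 ^ p * ε * k ≤ 2 ^ p * ε * N := by gcongr
      linarith
    have hrhs := neg_le_of_small_cutoff (q := q) (T := |t|) (E := E) (Δ := Δ) (u := u) hp hq0 hg0
      hk0.le (abs_nonneg t) hE' hΔ hε.le (by rw [hu, hq]; ring) hu1 (by linarith : _ ≤ Real.log y)
    rw [hq, ← mul_assoc] at hrhs
    linarith

/-- The error bound with explicit constants, for a given number of repetitions of each group. The
Taylor coefficients up to the order `p₀ ~ log (N / ε)` are treated with their factorials, those
above this order with the geometric bound for commuting groups. -/
theorem trotterError_le_of_repeats (S : Splitting h Γ) (P : ProductFormula c Γ) {p p₀ : ℕ}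
    {g Δ ε t : ℝ} (hk : 1 ≤ k) (hkN : k ≤ N) (hp : 1 ≤ p) (hrep : P.Repeats)
    (hS : S.IsExtensive g) (hP : P.HasOrder S p) (hΔ : 0 ≤ Δ) (hε : 0 < ε) (hε1 : ε < 1)
    (hp₀ : p₀ = ⌈Real.log (2 * N / (k * ε)) + 1⌉₊)
    (ht : 2 * c * p₀ * k * g * |t| ≤ 1 / 2) :
    trotterError S P Δ t ≤
      4 * c / (p + 1) * (2 * c * p₀ * k * g * |t|) ^ p *
        (Δ + 4 * k * g * Real.log (Real.exp 2 * N / ε)) * |t| + ε := by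
  have hg : h.IsExtensive g := S.isExtensive_of_sum hS
  have hg0 : 0 ≤ g := hg.nonneg (hk.trans hkN)
  have hk0 : (0 : ℝ) < k := by exact_mod_cast hk
  have hk1 : (1 : ℝ) ≤ k := by exact_mod_cast hk
  have hN0 : (0 : ℝ) < N := by exact_mod_cast hk.trans hkN
  have hkN' : (k : ℝ) ≤ N := by exact_mod_cast hkN
  have hp0 : (0 : ℝ) ≤ p := Nat.cast_nonneg p
  have he := exp_one_gt
  set u : ℝ := 2 * c * p₀ * k * g * |t| with hu
  have hu0 : 0 ≤ u := by positivity
  have hup : 0 ≤ u ^ p := by positivity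
  have hp₀' : Real.log (2 * N / (k * ε)) + 1 ≤ p₀ := by rw [hp₀]; exact Nat.le_ceil _
  have hp₀2 : (2 : ℝ) ≤ p₀ := by
    have h1 : 0 < Real.log (2 * N / (k * ε)) := by
      refine Real.log_pos ?_
      rw [lt_div_iff₀ (by positivity)]
      nlinarith
    have h2 : (1 : ℝ) < p₀ := by linarith
    have h3 : 1 < p₀ := by exact_mod_cast h2
    exact_mod_cast h3
  have hckg : c * k * g * |t| ≤ 1 / 8 := by
    have h1 : 2 * (c * k * g * |t|) ≤ p₀ * (c * k * g * |t|) :=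
      mul_le_mul_of_nonneg_right hp₀2 (by positivity)
    have h2 : u = 2 * (p₀ * (c * k * g * |t|)) := by rw [hu]; ring
    linarith
  have hcg : c * g * |t| ≤ 1 / 8 := by
    refine le_trans ?_ hckg
    have h1 : 1 * (c * g * |t|) ≤ k * (c * g * |t|) :=
      mul_le_mul_of_nonneg_right hk1 (by positivity)
    linarith
  set y : ℝ := Real.exp 2 * N / ε with hy
  have he2 : 1 ≤ Real.exp 2 := Real.one_le_exp (by norm_num)
  have hy1 : 1 ≤ y := by
    rw [hy, le_div_iff₀ hε]
    have : (1 : ℝ) ≤ N := hk1.trans hkN'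
    nlinarith
  have hlog : 0 ≤ Real.log y := Real.log_nonneg hy1
  set Δ' := Δ + 4 * k * g * Real.log y with hΔ'
  have hΔ'0 : 0 ≤ Δ' := by positivity
  set r : ℝ := Real.exp (-1) with hr
  have hr0 : 0 < r := Real.exp_pos _
  have hre : r * Real.exp 1 = 1 := by rw [hr, ← Real.exp_add]; simp
  have hr1 : r ≤ 2 / 5 := by nlinarith
  have hrp : r ^ p₀ * Real.exp 1 ≤ k * ε / (2 * N) := by
    have h1 : r ^ p₀ * Real.exp 1 = Real.exp (1 - p₀) := by
      rw [hr, ← Real.exp_nat_mul, ← Real.exp_add]; congr 1; ring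
    have h2 : Real.exp (-Real.log (2 * N / (k * ε))) = k * ε / (2 * N) := by
      rw [Real.exp_neg, Real.exp_log (by positivity), inv_div]
    rw [h1, ← h2]
    exact Real.exp_le_exp.mpr (by linarith)
  set Q := lowEnergyProj h.H h.isHermitian_H Δ
  set G := fun n => genCoeff ((P.gens S).map LocalGen.op) n with hG
  let T : ℕ → ℝ := fun n => if p₀ ≤ n then r ^ n else 0
  have hT0 : ∀ n, 0 ≤ T n := fun n => by simp only [T]; split_ifs <;> positivity
  have hT : HasSum T (r ^ p₀ / (1 - r)) := by
    have h1 := hasSum_mul_pow_add hr0.le (by linarith) 1 p₀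
    rw [one_mul] at h1
    have h2 : ∑ i ∈ range p₀, T i = 0 := sum_eq_zero fun i hi => by
      simp only [T]; rw [if_neg (not_le.mpr (mem_range.mp hi))]
    have h3 := hasSum_nat_add_iff (f := T) (g := r ^ p₀ / (1 - r)) p₀
    rw [h2, add_zero] at h3
    refine h3.mp ?_
    convert! h1 using 2 with n
    simp [T]
  have hd : ∀ n, p ≤ n → |t| ^ n * ‖G n * Q‖ ≤
      c * Δ' * u ^ n + g * (c * N * (4 / 3)) / y * (2 * u / 3) ^ n +
        Real.exp 1 * (N * (c * g)) * T n := by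
    intro n hn
    rcases lt_or_ge n p₀ with hnp | hnp
    · have h1 := norm_mul_lowEnergyProj_le_of_growsBy hk hg0 hg hΔ hy1
        (K := c * (2 * c * k * g) ^ n * n.factorial)
        (W := fun V => c * N * (c * k * g) ^ n * n.factorial * V ^ (n + 1)) (by positivity)
        (hrep.matrixElement_genCoeff_le S hg0 hS n)
        fun f V hV hf => hrep.seminorm_genCoeff_le S hg0 hS (by omega) hV hf
      have hfac : (n.factorial : ℝ) ≤ p₀ ^ n := by
        exact_mod_cast n.factorial_le_pow.trans (Nat.pow_le_pow_left hnp.le n)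
      have hTn : T n = 0 := if_neg (not_le.mpr hnp)
      rw [hTn, mul_zero, add_zero]
      refine (mul_le_mul_of_nonneg_left h1 (by positivity)).trans ?_
      have e1 : (2 * u / 3) ^ n = (c * k * g) ^ n * p₀ ^ n * (4 / 3) ^ n * |t| ^ n := by
        rw [← mul_pow, ← mul_pow, ← mul_pow, hu]; congr 1; ring
      have e2 : u ^ n = (2 * c * k * g) ^ n * p₀ ^ n * |t| ^ n := by
        rw [← mul_pow, ← mul_pow, hu]; congr 1; ring
      calc |t| ^ n * (c * (2 * c * k * g) ^ n * n.factorial * (Δ + 4 * k * g * Real.log y) +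
            g * (c * N * (c * k * g) ^ n * n.factorial * (4 / 3) ^ (n + 1)) / y)
          ≤ |t| ^ n * (c * (2 * c * k * g) ^ n * p₀ ^ n * (Δ + 4 * k * g * Real.log y) +
            g * (c * N * (c * k * g) ^ n * p₀ ^ n * (4 / 3) ^ (n + 1)) / y) := by gcongr
        _ = _ := by rw [e1, e2, hΔ']; ring
    · -- with the time `e |t|`, the bound leaves the factor `e⁻ⁿ` at the time `|t|`
      have h1 := pow_mul_norm_genCoeff_le (τ := Real.exp 1 * |t|) (by positivity) (P.gens S)
        (fun B hB => ProductFormula.commute_term_of_mem_gens S hB)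
        (hrep.layerExtensive_gens S hS) (by
          have h2 : k * (Real.exp 1 * |t| * (Real.exp 1 * (c * g))) =
            Real.exp 1 * Real.exp 1 * (c * k * g * |t|) := by ring
          have h3 : Real.exp 1 < 2.8 := Real.exp_one_lt_d9.trans (by norm_num)
          have h4 : Real.exp 1 * Real.exp 1 ≤ 8 := by nlinarith
          rw [h2]
          calc _ ≤ 8 * (1 / 8 : ℝ) := by gcongr
            _ = 1 := by norm_num) (n := n) (by omega)
      have hTn : T n = r ^ n := if_pos hnp
      have h2 : ‖G n * Q‖ ≤ ‖G n‖ := (norm_mul_le _ _).trans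
        (mul_le_of_le_one_right (norm_nonneg _) (norm_lowEnergyProj_le _ _))
      have h3 : |t| ^ n * ‖G n * Q‖ ≤ Real.exp 1 * (N * (c * g)) * r ^ n := by
        calc |t| ^ n * ‖G n * Q‖ ≤ |t| ^ n * ‖G n‖ := by gcongr
          _ = r ^ n * ((Real.exp 1 * |t|) ^ n * ‖G n‖) := by
              rw [mul_pow, ← mul_assoc, ← mul_assoc, ← mul_pow, hre, one_pow, one_mul]
          _ ≤ r ^ n * (Real.exp 1 * (N * (c * g))) := by gcongr
          _ = _ := by ring
      rw [hTn]
      refine h3.trans (le_add_of_nonneg_left ?_)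
      positivity
  have hTp : Summable fun n => T (n + p) := (summable_nat_add_iff p).mpr hT.summable
  have hTle : ∑' n, T (n + p) ≤ r ^ p₀ / (1 - r) := by
    rw [← hT.tsum_eq, ← hT.summable.sum_add_tsum_nat_add p]
    exact le_add_of_nonneg_left (sum_nonneg fun i _ => hT0 i)
  have hs := ((hasSum_mul_pow_add hu0 (by linarith) (c * Δ') p).add
    (hasSum_mul_pow_add (r := 2 * u / 3) (by positivity) (by linarith)
      (g * (c * N * (4 / 3)) / y) p)).add (hTp.hasSum.mul_left (Real.exp 1 * (N * (c * g))))
  refine (P.trotterError_le_tsum S hp hP Δ t _ hd hs.summable).trans ?_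
  rw [hs.tsum_eq, mul_add, mul_add, add_assoc]
  refine add_le_add ?_ ?_
  · have h1 : 1 / (1 - u) ≤ 4 := by
      rw [div_le_iff₀ (by linarith)]
      linarith
    calc |t| / (p + 1) * (c * Δ' * (u ^ p / (1 - u)))
        = (c * Δ' * u ^ p * |t| / (p + 1)) * (1 / (1 - u)) := by ring
      _ ≤ (c * Δ' * u ^ p * |t| / (p + 1)) * 4 := by gcongr
      _ = _ := by ring
  · have hNy : N / y ≤ ε := by
      rw [hy, div_div_eq_mul_div, div_le_iff₀ (by positivity)]
      have h2 : 1 * (N * ε) ≤ Real.exp 2 * (N * ε) :=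
        mul_le_mul_of_nonneg_right he2 (by positivity)
      linarith
    have h1 := repeats_high_energy_sum_le (p := p) hu0 ht hcg (by positivity) hNy
    have h2 := high_order_sum_le (p := p) (abs_nonneg t) hg0 (Nat.cast_nonneg c) hN0 hε.le
      hr1 (Real.exp_pos 1).le hckg hrp hTle
    linarith

end ExplicitBounds

/-! ### The norms of the pieces of a splitting -/

section SplittingNorms

variable {N k : ℕ}

theorem inner_single_act_single (A : Op N) (s t : Fin N → Fin 2) :
    inner ℂ (EuclideanSpace.single s (1 : ℂ)) (act A (EuclideanSpace.single t (1 : ℂ))) =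
      A s t := by
  rw [EuclideanSpace.inner_single_left, map_one, one_mul, act, Matrix.ofLp_toEuclideanCLM]
  simp

theorem energy_single (A : Op N) (s : Fin N → Fin 2) :
    energy A (EuclideanSpace.single s (1 : ℂ)) = (A s s).re := by
  rw [energy, inner_single_act_single]

theorem norm_apply_le {A : Op N} (hA : A.PosSemidef) (s t : Fin N → Fin 2) :
    ‖A s t‖ ≤ ((A s s).re + (A t t).re) / 2 := by
  rw [← inner_single_act_single A s t, ← energy_single A s, ← energy_single A t]
  exact norm_inner_act_le hA _ _

theorem re_apply_self_le (A : Op N) (s : Fin N → Fin 2) : (A s s).re ≤ ‖A‖ := by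
  rw [← energy_single]
  refine (energy_le_norm_mul A _).trans_eq ?_
  simp

/-- The operator `|x⟩⟨y| ⊗ 1`, for bit strings `x`, `y` on the sites in `X`. -/
def matrixUnit (X : Finset (Fin N)) (x y : X → Fin 2) : Op N := fun s t =>
  if (∀ i, i ∉ X → s i = t i) ∧ (fun i : X => s i) = x ∧ (fun i : X => t i) = y then 1 else 0

theorem norm_matrixUnit_le (X : Finset (Fin N)) (x y : X → Fin 2) : ‖matrixUnit X x y‖ ≤ 1 := by
  have h1 : star (matrixUnit X x y) * matrixUnit X x y =
      Matrix.diagonal fun s => if (fun i : X => s i) = y then 1 else 0 := by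
    ext s t
    rw [Matrix.mul_apply, sum_eq_single (fun i => if hi : i ∈ X then x ⟨i, hi⟩ else s i)]
    · have e1 : (fun i : X => if hi : (i : Fin N) ∈ X then x ⟨i, hi⟩ else s i) = x := by
        ext i; simp
      have e2 : ∀ r : Fin N → Fin 2,
          (∀ i, i ∉ X → (if hi : i ∈ X then x ⟨i, hi⟩ else s i) = r i) ↔
            ∀ i, i ∉ X → s i = r i :=
        fun r => forall_congr' fun i => imp_congr_right fun hi => by rw [dif_neg hi]
      rw [Matrix.star_apply, matrixUnit, matrixUnit, Matrix.diagonal_apply]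
      simp only [e1, e2, implies_true, true_and]
      by_cases hs : (fun i : X => s i) = y
      · rw [if_pos hs, star_one, one_mul]
        refine if_congr ⟨fun ⟨h1, h2⟩ => ?_, fun hst => ?_⟩ rfl rfl
        · ext i
          by_cases hi : i ∈ X
          · rw [congrFun (hs.trans h2.symm) ⟨i, hi⟩]
          · rw [h1 i hi]
        · subst hst
          exact ⟨fun _ _ => rfl, hs⟩
      · rw [if_neg hs, star_zero, zero_mul, ite_self]
    · intro w _ hw
      have e1 : matrixUnit X x y w s = 0 := by
        refine if_neg fun ⟨h1, h2, _⟩ => hw ?_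
        ext i
        split_ifs with hi
        · rw [← h2]
        · rw [h1 i hi]
      rw [Matrix.star_apply, e1, star_zero, zero_mul]
    · simp
  have h2 : ‖matrixUnit X x y‖ * ‖matrixUnit X x y‖ ≤ 1 := by
    rw [← CStarRing.norm_star_mul_self, h1, Matrix.l2_opNorm_diagonal]
    refine (pi_norm_le_iff_of_nonneg zero_le_one).mpr fun s => ?_
    split_ifs <;> simp
  nlinarith [norm_nonneg (matrixUnit X x y)]

/-- The extension of a bit string by zeros. -/
def extendZero (X : Finset (Fin N)) (x : X → Fin 2) : Fin N → Fin 2 :=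
  fun i => if hi : i ∈ X then x ⟨i, hi⟩ else 0

/-- The norm of a positive operator on `X`, bounded by a linear functional of the operator. -/
theorem SupportedOn.norm_le {X : Finset (Fin N)} {A : Op N} (hX : SupportedOn X A)
    (hA : A.PosSemidef) :
    ‖A‖ ≤ ∑ x : X → Fin 2, ∑ y : X → Fin 2,
      ((A (extendZero X x) (extendZero X x)).re +
        (A (extendZero X y) (extendZero X y)).re) / 2 := by
  obtain ⟨M, hM⟩ := hX
  have h0 : ∀ x y : X → Fin 2, A (extendZero X x) (extendZero X y) = M x y := by
    intro x y
    rw [hM, if_pos (fun i hi => by simp [extendZero, hi])]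
    congr 1 <;> ext i <;> simp [extendZero]
  have h1 : A = ∑ x : X → Fin 2, ∑ y : X → Fin 2,
      A (extendZero X x) (extendZero X y) • matrixUnit X x y := by
    ext s t
    simp only [h0, Matrix.sum_apply, Matrix.smul_apply, matrixUnit, smul_eq_mul, mul_ite, mul_one,
      mul_zero]
    rw [hM, sum_eq_single (fun i : X => s i), sum_eq_single (fun i : X => t i)]
    · simp
    · intro y _ hy
      rw [if_neg]
      exact fun h => hy h.2.2.symm
    · simp
    · intro x _ hx
      refine sum_eq_zero fun y _ => ?_
      rw [if_neg]
      exact fun h => hx h.2.1.symm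
    · simp
  conv_lhs => rw [h1]
  refine (norm_sum_le _ _).trans (sum_le_sum fun x _ => (norm_sum_le _ _).trans
    (sum_le_sum fun y _ => ?_))
  rw [norm_smul]
  exact (mul_le_of_le_one_right (norm_nonneg _) (norm_matrixUnit_le X x y)).trans
    (norm_apply_le hA _ _)

/-- A splitting of a term on at most `k` qubits into positive pieces increases the sum of the norms
by a factor that depends on `k` only. -/
theorem Splitting.sum_norm_piece_le {h : LocalHamiltonian N k} {Γ : ℕ} (S : Splitting h Γ)
    (X : Finset (Fin N)) : ∑ γ, ‖S.piece γ X‖ ≤ 4 ^ k * ‖h.term X‖ := by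
  by_cases hX : k < X.card
  · have h1 : ∀ γ, ‖S.piece γ X‖ = 0 := fun γ => by
      have h2 := S.norm_piece_le γ X
      rw [h.isLocal X hX, norm_zero] at h2
      exact le_antisymm h2 (norm_nonneg _)
    simp only [h1, sum_const_zero]
    positivity
  have h1 : ∀ s, ∑ γ, (S.piece γ X s s).re = (h.term X s s).re := by
    intro s
    rw [← S.sum_piece X, Matrix.sum_apply, Complex.re_sum]
  have h2 : ∀ x : X → Fin 2, ∀ y : X → Fin 2,
      ∑ γ, ((S.piece γ X (extendZero X x) (extendZero X x)).re +
        (S.piece γ X (extendZero X y) (extendZero X y)).re) / 2 ≤ ‖h.term X‖ := by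
    intro x y
    rw [← sum_div, sum_add_distrib, h1, h1]
    have := re_apply_self_le (h.term X) (extendZero X x)
    have := re_apply_self_le (h.term X) (extendZero X y)
    linarith
  refine (sum_le_sum fun γ _ => (S.supported γ X).norm_le (S.posSemidef γ X)).trans ?_
  rw [sum_comm]
  refine (sum_le_sum fun x _ => ?_).trans (le_of_eq_of_le (sum_const (2 ^ X.card * ‖h.term X‖)) ?_)
  · rw [sum_comm]
    refine (sum_le_sum fun y _ => h2 x y).trans_eq ?_
    rw [sum_const, nsmul_eq_mul]
    simp
  · have h3 : (4 : ℝ) ^ X.card ≤ 4 ^ k := pow_le_pow_right₀ (by norm_num) (not_lt.mp hX)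
    have h4 : (4 : ℝ) ^ X.card = 2 ^ X.card * 2 ^ X.card := by rw [← mul_pow]; norm_num
    rw [nsmul_eq_mul, ← mul_assoc]
    refine mul_le_mul_of_nonneg_right (le_trans (le_of_eq ?_) h3) (norm_nonneg _)
    rw [h4]
    simp

theorem Splitting.isExtensive {h : LocalHamiltonian N k} {Γ : ℕ} (S : Splitting h Γ) {g : ℝ}
    (hg : h.IsExtensive g) : S.IsExtensive (4 ^ k * g) := by
  intro i
  rw [sum_comm]
  refine (sum_le_sum fun X _ => S.sum_norm_piece_le X).trans ?_
  rw [← mul_sum]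
  exact mul_le_mul_of_nonneg_left (hg i) (by positivity)

end SplittingNorms

/-! ### Bounds up to constants -/

section Asymptotic

variable {N k c Γ : ℕ} {h : LocalHamiltonian N k}

/-- On `N < k` qubits, a `k`-local Hamiltonian is `N`-local. -/
def LocalHamiltonian.restrictLocality (h : LocalHamiltonian N k) :
    LocalHamiltonian N (min k N) where
  term := h.term
  posSemidef := h.posSemidef
  supported := h.supported
  isLocal X hX := h.isLocal X (by
    have : X.card ≤ N := by simpa using card_le_univ X
    omega)

/-- The splitting of `LocalHamiltonian.restrictLocality`. -/
def Splitting.restrictLocality (S : Splitting h Γ) : Splitting h.restrictLocality Γ where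
  piece := S.piece
  posSemidef := S.posSemidef
  supported := S.supported
  commute := S.commute
  sum_piece := S.sum_piece

theorem trotterError_le_two (S : Splitting h Γ) (P : ProductFormula c Γ) (Δ t : ℝ) :
    trotterError S P Δ t ≤ 2 := by
  have h1 : ‖evol h.H t‖ ≤ 1 := norm_exp_imaginary_smul_le h.isHermitian_H (by simp)
  have h2 := P.norm_eval_le S t
  have h3 := norm_lowEnergyProj_le h.isHermitian_H Δ
  calc _ ≤ ‖evol h.H t - P.eval S t‖ * ‖lowEnergyProj h.H h.isHermitian_H Δ‖ := norm_mul_le _ _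
    _ ≤ (1 + 1) * 1 := by
        gcongr
        exact (norm_sub_le _ _).trans (add_le_add h1 h2)
    _ = 2 := by norm_num

theorem log_div_ge {ε : ℝ} (hN : 2 ≤ N) (hε : 0 < ε) (hε1 : ε < 1) :
    Real.log 2 ≤ Real.log (N / ε) := by
  refine Real.log_le_log (by norm_num) ?_
  have : (2 : ℝ) ≤ N := by exact_mod_cast hN
  rw [le_div_iff₀ hε]
  nlinarith

theorem one_half_lt_log_two : (1 / 2 : ℝ) < Real.log 2 :=
  lt_trans (by norm_num) Real.log_two_gt_d9

/-- The error for boundedly many groups. If the time is too large for the explicit bound, the right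
hand side exceeds `2`. -/
theorem trotterError_le_of_groups_le (S : Splitting h Γ) (P : ProductFormula c Γ) {p Γ₀ : ℕ}
    {g Δ ε t : ℝ} (hk : 1 ≤ k) (hp : 1 ≤ p) (hN : 2 ≤ N) (hΓ : Γ ≤ Γ₀) (hg : h.IsExtensive g)
    (hP : P.HasOrder S p) (hΔ : 0 ≤ Δ) (hε : 0 < ε) (hε1 : ε < 1) :
    trotterError S P Δ t ≤
      (2 * c * Γ₀ / (1 - 1 / Real.exp 1) * (2 * c * Γ₀ * k) ^ p +
        (Real.exp 1 * (2 * c * Γ₀ * k)) ^ (p + 1) + 1) * (g * |t|) ^ p *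
        (Δ + 4 * k * (g * Real.log (N / ε))) * |t| + ε := by
  have hg0 : 0 ≤ g := hg.nonneg (by omega)
  have hk1 : (1 : ℝ) ≤ k := by exact_mod_cast hk
  have hΓ' : (Γ : ℝ) ≤ Γ₀ := by exact_mod_cast hΓ
  have hkm : ((min k N : ℕ) : ℝ) ≤ k := by exact_mod_cast min_le_left k N
  have hkm1 : 1 ≤ min k N := by omega
  have hkm1' : (1 : ℝ) ≤ (min k N : ℕ) := by exact_mod_cast hkm1
  have hN0 : (0 : ℝ) < N := by exact_mod_cast (by omega : 0 < N)
  have hL := log_div_ge hN hε hε1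
  have hL2 := one_half_lt_log_two
  set L := Real.log (N / ε) with hLdef
  set M : ℝ := 2 * c * Γ₀ * k with hM
  have hM0 : 0 ≤ M := by positivity
  set x := g * |t| with hx
  have hx0 : 0 ≤ x := by positivity
  have hE : 0 < 1 - 1 / Real.exp 1 := by
    have : 1 / Real.exp 1 < 1 := by
      rw [div_lt_one (Real.exp_pos 1)]; linarith [exp_one_gt]
    linarith
  set E := 1 - 1 / Real.exp 1
  set C₁ : ℝ := 2 * c * Γ₀ / E * M ^ p with hC₁
  set C₂ : ℝ := (Real.exp 1 * M) ^ (p + 1) with hC₂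
  have hC₁0 : 0 ≤ C₁ := by positivity
  have hC₂0 : 0 ≤ C₂ := by positivity
  set Δ' := Δ + 4 * k * (g * L) with hΔ'
  have hgL : 0 ≤ g * L := mul_nonneg hg0 (by linarith)
  have hΔ'0 : 0 ≤ Δ' := by positivity
  have hu : 2 * c * Γ * (min k N : ℕ) * g * |t| ≤ M * x := by
    calc 2 * c * Γ * (min k N : ℕ) * g * |t| = 2 * c * Γ * (min k N : ℕ) * x := by rw [hx]; ring
      _ ≤ _ := by rw [hM]; gcongr
  rcases le_or_gt (2 * c * Γ * (min k N : ℕ) * g * |t|) (1 / Real.exp 1) with ht | ht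
  · have key := trotterError_le_of_length S.restrictLocality P hkm1 (min_le_right k N) hp
      (g := g) hg hP hΔ hε ht
    have hcut : Δ + 4 * (min k N : ℕ) * g *
        Real.log (2 * N / (2 ^ p * (min k N : ℕ) * ε)) ≤ Δ' := by
      have h1 : Real.log (2 * N / (2 ^ p * (min k N : ℕ) * ε)) ≤ L := by
        refine Real.log_le_log (by positivity) ?_
        rw [div_le_div_iff₀ (by positivity) hε]
        have h2 : (2 : ℝ) * 1 ≤ 2 ^ p * (min k N : ℕ) := by
          refine mul_le_mul ?_ hkm1' zero_le_one (by positivity)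
          exact le_self_pow₀ (by norm_num) (by omega)
        calc 2 * (N : ℝ) * ε = 2 * 1 * (N * ε) := by ring
          _ ≤ 2 ^ p * (min k N : ℕ) * (N * ε) := by gcongr
          _ = _ := by ring
      have h2 : 4 * (min k N : ℕ) * g * Real.log (2 * N / (2 ^ p * (min k N : ℕ) * ε)) ≤
          4 * (min k N : ℕ) * g * L := mul_le_mul_of_nonneg_left h1 (by positivity)
      have h3 : 4 * (min k N : ℕ) * g * L ≤ 4 * k * (g * L) := by
        rw [mul_assoc]; gcongr
      rw [hΔ']
      linarith
    refine key.trans (add_le_add ?_ le_rfl)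
    calc _ ≤ 2 * c * Γ / (E * (p + 1)) * (2 * c * Γ * (min k N : ℕ) * g * |t|) ^ p * Δ' * |t| := by
          gcongr
      _ ≤ 2 * c * Γ₀ / E * (M * x) ^ p * Δ' * |t| := by
          gcongr
          have : (0 : ℝ) ≤ p := Nat.cast_nonneg p
          nlinarith
      _ = C₁ * x ^ p * Δ' * |t| := by rw [hC₁, mul_pow]; ring
      _ ≤ _ := by
          gcongr
          linarith
  · have h1 : 1 ≤ Real.exp 1 * M * x := by
      have := ht.trans_le hu
      rw [div_lt_iff₀ (Real.exp_pos 1)] at this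
      linarith
    have h2 : 1 ≤ (Real.exp 1 * M * x) ^ (p + 1) := one_le_pow₀ h1
    have h3 : 2 ≤ 4 * k * L := by nlinarith
    have h4 : 2 ≤ C₂ * x ^ p * (4 * k * (g * L)) * |t| := by
      calc (2 : ℝ) ≤ (4 * k * L) * (Real.exp 1 * M * x) ^ (p + 1) := by nlinarith
        _ = C₂ * x ^ p * (4 * k * L) * x := by rw [hC₂, mul_pow _ x, pow_succ x]; ring
        _ = _ := by rw [hx]; ring
    calc trotterError S P Δ t ≤ 2 := trotterError_le_two S P Δ t
      _ ≤ C₂ * x ^ p * (4 * k * (g * L)) * |t| := h4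
      _ ≤ (C₁ + C₂ + 1) * x ^ p * Δ' * |t| := by
          gcongr
          · linarith
          · rw [hΔ']; linarith
      _ ≤ _ := by linarith

/-- The error for a bounded number of repetitions of each group. If the time is too large for the
explicit bound, the right hand side exceeds `2`. -/
theorem trotterError_le_of_log (S : Splitting h Γ) (P : ProductFormula c Γ) {p : ℕ}
    {g Δ ε t : ℝ} (hk : 1 ≤ k) (hp : 1 ≤ p) (hN : 2 ≤ N) (hrep : P.Repeats) (hg : h.IsExtensive g)
    (hP : P.HasOrder S p) (hΔ : 0 ≤ Δ) (hε : 0 < ε) (hε1 : ε < 1) :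
    trotterError S P Δ t ≤
      (4 * c * (10 * c * k * 4 ^ k) ^ p + (2 * (10 * c * k * 4 ^ k)) ^ (p + 1) + 1) *
        (g * |t| * Real.log (N / ε)) ^ p *
        (Δ + 16 * k * 4 ^ k * (g * Real.log (N / ε))) * |t| + ε := by
  have hg0 : 0 ≤ g := hg.nonneg (by omega)
  have hk1 : (1 : ℝ) ≤ k := by exact_mod_cast hk
  have hk4 : (1 : ℝ) ≤ 4 ^ k := one_le_pow₀ (by norm_num)
  have hkm : ((min k N : ℕ) : ℝ) ≤ k := by exact_mod_cast min_le_left k N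
  have hkm1 : 1 ≤ min k N := by omega
  have hkm1' : (1 : ℝ) ≤ (min k N : ℕ) := by exact_mod_cast hkm1
  have hN0 : (0 : ℝ) < N := by exact_mod_cast (by omega : 0 < N)
  have hL := log_div_ge hN hε hε1
  have hL2 : (0.6931471803 : ℝ) < Real.log 2 := Real.log_two_gt_d9
  set L := Real.log (N / ε) with hLdef
  have hL0 : 0 < L := by linarith
  set M : ℝ := 10 * c * k * 4 ^ k with hM
  have hM0 : 0 ≤ M := by positivity
  set x := g * |t| * L with hx
  have hx0 : 0 ≤ x := by positivity
  set C₁ : ℝ := 4 * c * M ^ p with hC₁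
  set C₂ : ℝ := (2 * M) ^ (p + 1) with hC₂
  have hC₁0 : 0 ≤ C₁ := by positivity
  have hC₂0 : 0 ≤ C₂ := by positivity
  set Δ' := Δ + 16 * k * 4 ^ k * (g * L) with hΔ'
  have hΔ'0 : 0 ≤ Δ' := by positivity
  obtain ⟨p₀, hp₀⟩ : ∃ p₀ : ℕ, p₀ = ⌈Real.log (2 * N / ((min k N : ℕ) * ε)) + 1⌉₊ := ⟨_, rfl⟩
  have hp₀L : (p₀ : ℝ) ≤ 5 * L := by
    have h1 : Real.log (2 * N / ((min k N : ℕ) * ε)) ≤ Real.log 2 + L := by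
      rw [hLdef, ← Real.log_mul (by norm_num) (by positivity)]
      refine Real.log_le_log (by positivity) ?_
      rw [mul_div_assoc']
      gcongr
      exact le_mul_of_one_le_left hε.le hkm1'
    rcases le_or_gt (Real.log (2 * N / ((min k N : ℕ) * ε)) + 1) 0 with h2 | h2
    · rw [hp₀, Nat.ceil_eq_zero.mpr h2]
      simp only [Nat.cast_zero]
      positivity
    · have h3 := Nat.ceil_lt_add_one h2.le
      rw [← hp₀] at h3
      linarith
  have hu : 2 * c * p₀ * (min k N : ℕ) * (4 ^ k * g) * |t| ≤ M * x := by
    calc 2 * c * p₀ * (min k N : ℕ) * (4 ^ k * g) * |t|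
        ≤ 2 * c * (5 * L) * k * (4 ^ k * g) * |t| := by gcongr
      _ = _ := by rw [hM, hx]; ring
  rcases le_or_gt (2 * c * p₀ * (min k N : ℕ) * (4 ^ k * g) * |t|) (1 / 2) with ht | ht
  · have key := trotterError_le_of_repeats S.restrictLocality P hkm1 (min_le_right k N) hp hrep
      (g := 4 ^ k * g) (S.isExtensive hg) hP hΔ hε hε1 hp₀ ht
    have hcut : Δ + 4 * (min k N : ℕ) * (4 ^ k * g) * Real.log (Real.exp 2 * N / ε) ≤ Δ' := by
      have h0 : Real.log (Real.exp 2 * N / ε) = 2 + L := by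
        rw [mul_div_assoc, Real.log_mul (Real.exp_pos 2).ne' (by positivity), Real.log_exp]
      have h1 : 2 + L ≤ 4 * L := by linarith
      rw [h0]
      calc _ ≤ Δ + 4 * k * (4 ^ k * g) * (4 * L) := by gcongr
        _ = _ := by rw [hΔ']; ring
    refine key.trans (add_le_add ?_ le_rfl)
    calc _ ≤ 4 * c / (p + 1) * (2 * c * p₀ * (min k N : ℕ) * (4 ^ k * g) * |t|) ^ p * Δ' * |t| := by
          gcongr
      _ ≤ 4 * c * (M * x) ^ p * Δ' * |t| := by
          gcongr
          refine div_le_self (by positivity) ?_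
          have : (0 : ℝ) ≤ p := Nat.cast_nonneg p
          linarith
      _ = C₁ * x ^ p * Δ' * |t| := by rw [hC₁, mul_pow]; ring
      _ ≤ _ := by
          gcongr
          linarith
  · have h1 : 1 ≤ 2 * M * x := by
      have := ht.trans_le hu
      linarith
    have h2 : 1 ≤ (2 * M * x) ^ (p + 1) := one_le_pow₀ h1
    have h3 : (2 : ℝ) ≤ 16 * k * 4 ^ k := by nlinarith
    have h4 : 2 ≤ C₂ * x ^ p * (16 * k * 4 ^ k * (g * L)) * |t| := by
      calc (2 : ℝ) ≤ (16 * k * 4 ^ k) * (2 * M * x) ^ (p + 1) := by nlinarith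
        _ = C₂ * x ^ p * (16 * k * 4 ^ k) * x := by rw [hC₂, mul_pow _ x, pow_succ x]; ring
        _ = _ := by
            nth_rewrite 2 [hx]
            ring
    calc trotterError S P Δ t ≤ 2 := trotterError_le_two S P Δ t
      _ ≤ C₂ * x ^ p * (16 * k * 4 ^ k * (g * L)) * |t| := h4
      _ ≤ (C₁ + C₂ + 1) * x ^ p * Δ' * |t| := by
          gcongr
          · linarith
          · rw [hΔ']; linarith
      _ ≤ _ := by linarith

end Asymptotic

end LowEnergyTrotter

end

/-- The first two parts are the order-of-magnitude bounds, for boundedly many groups and for any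
number of groups; the last two are the bounds with explicit constants. -/
theorem theorem1 :
    (∀ k p c Γ₀ : ℕ, 1 ≤ k → 1 ≤ p → ∃ a > (0 : ℝ), ∀ b > (0 : ℝ), ∃ C > (0 : ℝ),
      ∀ (N Γ : ℕ) (h : LowEnergyTrotter.LocalHamiltonian N k) (S : LowEnergyTrotter.Splitting h Γ)
        (P : LowEnergyTrotter.ProductFormula c Γ) (g Δ ε t : ℝ),
        2 ≤ N → Γ ≤ Γ₀ → h.IsExtensive g → P.HasOrder S p → 0 ≤ Δ → 0 < ε → ε < 1 →
        g * |t| ≤ b →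
        LowEnergyTrotter.trotterError S P Δ t ≤
          C * (g * |t|) ^ p * (Δ + a * (g * Real.log (N / ε))) * |t| + ε) ∧
    (∀ k p c : ℕ, 1 ≤ k → 1 ≤ p → ∃ a > (0 : ℝ), ∀ b > (0 : ℝ), ∃ C > (0 : ℝ),
      ∀ (N Γ : ℕ) (h : LowEnergyTrotter.LocalHamiltonian N k) (S : LowEnergyTrotter.Splitting h Γ)
        (P : LowEnergyTrotter.ProductFormula c Γ) (g Δ ε t : ℝ),
        2 ≤ N → P.Repeats → h.IsExtensive g → P.HasOrder S p → 0 ≤ Δ → 0 < ε → ε < 1 →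
        g * Real.log (N / ε) * |t| ≤ b →
        LowEnergyTrotter.trotterError S P Δ t ≤
          C * (g * |t| * Real.log (N / ε)) ^ p * (Δ + a * (g * Real.log (N / ε))) * |t| + ε) ∧
    (∀ (k p c N Γ : ℕ) (h : LowEnergyTrotter.LocalHamiltonian N k)
        (S : LowEnergyTrotter.Splitting h Γ) (P : LowEnergyTrotter.ProductFormula c Γ)
        (g Δ ε t : ℝ),
        1 ≤ k → k ≤ N → 1 ≤ p → h.IsExtensive g → P.HasOrder S p → 0 ≤ Δ → 0 < ε → ε < 1 →
        2 * c * Γ * k * g * |t| ≤ 1 / Real.exp 1 →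
        LowEnergyTrotter.trotterError S P Δ t ≤
          2 * c * Γ / ((1 - 1 / Real.exp 1) * (p + 1)) * (2 * c * Γ * k * g * |t|) ^ p *
            (Δ + 4 * k * g * Real.log (2 * N / (2 ^ p * k * ε))) * |t| + ε) ∧
    (∀ (k p c N Γ p₀ : ℕ) (h : LowEnergyTrotter.LocalHamiltonian N k)
        (S : LowEnergyTrotter.Splitting h Γ) (P : LowEnergyTrotter.ProductFormula c Γ)
        (g Δ ε t : ℝ),
        1 ≤ k → k ≤ N → 1 ≤ p → P.Repeats → S.IsExtensive g → P.HasOrder S p →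
        0 ≤ Δ → 0 < ε → ε < 1 → p₀ = ⌈Real.log (2 * N / (k * ε)) + 1⌉₊ →
        2 * c * p₀ * k * g * |t| ≤ 1 / 2 →
        LowEnergyTrotter.trotterError S P Δ t ≤
          4 * c / (p + 1) * (2 * c * p₀ * k * g * |t|) ^ p *
            (Δ + 4 * k * g * Real.log (Real.exp 2 * N / ε)) * |t| + ε) := by
  have hE : 0 < 1 - 1 / Real.exp 1 := by
    rw [sub_pos, div_lt_one (Real.exp_pos 1)]
    linarith [LowEnergyTrotter.exp_one_gt]
  refine ⟨fun k p c Γ₀ hk hp => ⟨4 * k, by positivity, fun b _ =>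
      ⟨2 * c * Γ₀ / (1 - 1 / Real.exp 1) * (2 * c * Γ₀ * k) ^ p +
        (Real.exp 1 * (2 * c * Γ₀ * k)) ^ (p + 1) + 1, by positivity, ?_⟩⟩,
    fun k p c hk hp => ⟨16 * k * 4 ^ k, by positivity, fun b _ =>
      ⟨4 * c * (10 * c * k * 4 ^ k) ^ p + (2 * (10 * c * k * 4 ^ k)) ^ (p + 1) + 1,
        by positivity, ?_⟩⟩, ?_, ?_⟩
  · intro N Γ h S P g Δ ε t hN hΓ hg hP hΔ hε hε1 _
    exact LowEnergyTrotter.trotterError_le_of_groups_le S P hk hp hN hΓ hg hP hΔ hε hε1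
  · intro N Γ h S P g Δ ε t hN hrep hg hP hΔ hε hε1 _
    exact LowEnergyTrotter.trotterError_le_of_log S P hk hp hN hrep hg hP hΔ hε hε1
  · intro k p c N Γ h S P g Δ ε t hk hkN hp hg hP hΔ hε _ ht
    exact LowEnergyTrotter.trotterError_le_of_length S P hk hkN hp hg hP hΔ hε ht
  · intro k p c N Γ p₀ h S P g Δ ε t hk hkN hp hrep hS hP hΔ hε hε1 hp₀ ht
    exact LowEnergyTrotter.trotterError_le_of_repeats S P hk hkN hp hrep hS hP hΔ hε hε1 hp₀ ht
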